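/- **Setting.** Party $A$ holds bits with MACs and party $B$ holds keys. An authenticated bit $[x]$ under the global key $\Delta\in\{0,1\}^\kappa$ of $B$ consists of a bit $x$ and a MAC $M_x=K_x\oplus x\Delta$ known to $A$, and a local key $K_x\in\{0,1\}^\kappa$ known to $B$. *Box $\mathrm{aAND}(\ell)$.* When called by the honest parties, it outputs uniformly random $[x_i],[y_i],[z_i]$ with $z_i=x_iy_i$, $i=1,\dots,\ell$ (bits and MACs to $A$; $\Delta$ and the local keys to $B$), under a uniformly random $\Delta$. A corrupted $A$ chooses all $x_i,y_i$ and all her MACs; a corrupted $B$ chooses $\Delta$ and all local keys. The adversary is told when an honest party calls the box, schedules the delivery of outputs, may at any time ask whether a given string equals $\Delta$, and, if some party is corrupted, may make the box output $\mathtt{fail}$ to the honest party instead of its output. *Box $\mathrm{LaAND}(n)$.* The same with $n$ triples, except that a corrupted $B$ may moreover, as often as he likes until $A$ gets her output, input $(i,g)$: if $g\neq x_i$ the box outputs $\mathtt{fail}$ to $A$ and gives her no other output; otherwise $B$ learns that the guess was right. *Protocol* (for positive integers $B,\ell$, and a $B$-wise independent random permutation $\pi$ of $\{1,\dots,B\ell\}$,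 i.e. one that maps any $B$ distinct points to a uniformly random $B$-tuple of distinct points). The parties call $\mathrm{LaAND}(B\ell)$ and output $\mathtt{fail}$ if they receive $\mathtt{fail}$. $A$ samples $\pi$ and sends it to $B$ over an authenticated, non-private channel; for $0\le j<\ell$ the triples with indices $\pi(jB+1),\dots,\pi(jB+B)$ form the $j$-th bucket. In each bucket the triples are combined one after the other: to combine $([x^1],[y^1],[z^1])$ and $([x^2],[y^2],[z^2])$, $A$ reveals $d=y^1\oplus y^2$ together with its MAC, $B$ checks the MAC and outputs $\mathtt{fail}$ if it is wrong, and the result is $[x^1]\oplus[x^2],\ [y^1],\ [z^1]\oplus[z^2]\oplus d[x^2]$. The $\ell$ results are the output. **Theorem.** There is a polynomial $p$ such that for all integers $B,\ell\ge 1$, $\kappa\ge 0$, every $B$-wise independent distribution of $\pi$, and every real $\psi$ with $(\log_2\ell+1)(B-1)\ge\psi$, the protocol securely implements $\mathrm{aAND}(\ell)$ in the $\mathrm{LaAND}(B\ell)$-hybrid model with security parameter $\psi$, in the UC sense with static active corruption of no party, of $A$, or of $B$: in each of these cases there is a simulator, each of whose activations costs at most $p(B,\ell,\kappa)$ (it may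 sample $\pi$ as $A$ does), such that every environment, even a computationally unbounded one, distinguishes the hybrid execution (in which it directs the adversary) from the ideal execution with $\mathrm{aAND}(\ell)$ and the simulator with advantage at most $2^{-\psi}$. Moreover, for all $B,\ell\ge1$, every $B$-wise independent distribution of $\pi$ and every (randomised) guessing strategy of a corrupted $B$ at uniformly random bits $x_1,\dots,x_{B\ell}$, the probability that all his guesses are right (so that he is undetected) and that all $B$ triples of some bucket are among those guessed is at most $(2\ell)^{1-B}$. -/

import Mathlib

open scoped ENNReal

noncomputable section

namespace BucketAND

/-! ### Interactive systems and environments -/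

/-- A probabilistic reactive system: it is activated with an input from `I`, updates its state and
answers with an output in `O`. -/
structure System (I O : Type) where
  State : Type
  start : PMF State
  step : State → I → PMF (State × O)

/-- An environment: a computationally unbounded, adaptive, randomised strategy that activates the
system a finite number of times and then outputs a bit. -/
structure Env (I O : Type) where
  rounds : ℕ
  next : List (I × O) → PMF I
  decide : List (I × O) → PMF Bool

/-- The joint law of the system state and the transcript after `t` activations. -/
def System.run {I O : Type} (W : System I O) (Z : Env I O) : ℕ → PMF (W.State × List (I × O))
  | 0 => W.start.bind fun s => PMF.pure (s, [])
  | t + 1 => (W.run Z t).bind fun p => (Z.next p.2).bind fun i => (W.step p.1 i).bind fun q =>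
      PMF.pure (q.1, p.2 ++ [(i, q.2)])

/-- The probability that the environment outputs `true` after interacting with the system. -/
def System.prob {I O : Type} (W : System I O) (Z : Env I O) : ℝ :=
  (((W.run Z Z.rounds).bind fun p => Z.decide p.2) true).toReal

/-! ### Authenticated bits -/

/-- Bit strings of length `κ`, with exclusive or as addition. -/
abbrev Str (κ : ℕ) := Fin κ → ZMod 2

/-- What the MAC holder has for an authenticated bit: the bit and its MAC. -/
abbrev Auth (κ : ℕ) := ZMod 2 × Str κ

/-- Data for the three authenticated bits `x`, `y`, `z` of one local AND. -/
abbrev Triple (V : Type) := V × V × V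

/-- Parties: the MAC holder `A` and the key holder `B`. -/
abbrev Party := Fin 2
abbrev Party.A : Party := 0
abbrev Party.B : Party := 1

/-- The bit `x` with its MAC `K ⊕ x Δ`. -/
def mac {κ : ℕ} (Δ : Str κ) (x : ZMod 2) (K : Str κ) : Auth κ := (x, K + x • Δ)

/-! ### The boxes -/

/-- Output of a box to `A`: bits and MACs, or `none` for `fail`. -/
abbrev AOut (n κ : ℕ) := Option (Fin n → Triple (Auth κ))

/-- Output of a box to `B`: the global key and the local keys, or `none` for `fail`. -/
abbrev BOut (n κ : ℕ) := Option (Str κ × (Fin n → Triple (Str κ)))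

/-- The values a corrupted `A` chooses for one triple: the bits `x` and `y`, and the MACs of `x`,
`y` and `z`. The bit `z` is always `x y`. -/
abbrev AChoice (κ : ℕ) := ZMod 2 × ZMod 2 × Triple (Str κ)

/-- The values a corrupted `B` chooses: the global key and all local keys. -/
abbrev BChoice (n κ : ℕ) := Str κ × (Fin n → Triple (Str κ))

/-- What the adversary can input to a box. -/
inductive BoxCmd (n κ : ℕ) : Type
  /-- global key query -/
  | keyQuery (Δ : Str κ)
  /-- the choice of a corrupted `A` -/
  | chooseA (v : Fin n → AChoice κ)
  /-- the choice of a corrupted `B` -/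
  | chooseB (v : BChoice n κ)
  /-- a guess of a corrupted `B` at the bit `x i` -/
  | guess (i : Fin n) (g : ZMod 2)
  /-- let the output to `p` be delivered -/
  | deliver (p : Party)
  /-- make the box output `fail` to `p` -/
  | abort (p : Party)

/-- What a box tells the adversary. -/
inductive BoxResp : Type
  | ack
  /-- the honest party `p` has called the box -/
  | started (p : Party)
  /-- the answer to a key query or to a guess; `1` if it was correct -/
  | answer (c : ZMod 2)

structure BoxState (n κ : ℕ) where
  Δ : Str κ
  x : Fin n → ZMod 2
  y : Fin n → ZMod 2
  K : Fin n → Triple (Str κ)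
  /-- the honest parties that have called the box -/
  started : Party → Bool
  /-- whether the corrupted party has chosen its values -/
  chosen : Bool
  /-- the parties that have received an output (possibly `fail`) -/
  done : Party → Bool

/-- The result of activating a box: new state, message to the adversary, outputs to `A` and `B`. -/
structure BoxOut (n κ : ℕ) where
  state : BoxState n κ
  resp : BoxResp
  outA : Option (AOut n κ)
  outB : Option (BOut n κ)

/-- The box samples the global key, the bits `x`, `y` and the local keys uniformly; the values of a
corrupted party are overwritten when that party chooses them. -/
def boxStart (n κ : ℕ) : PMF (BoxState n κ) :=
  (PMF.uniformOfFintype (Str κ × (Fin n → ZMod 2) × (Fin n → ZMod 2) ×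
    (Fin n → Triple (Str κ)))).map fun r =>
      { Δ := r.1, x := r.2.1, y := r.2.2.1, K := r.2.2.2,
        started := fun _ => false, chosen := false, done := fun _ => false }

variable {n κ : ℕ}

/-- The bits and MACs of `A`, with `z i = x i * y i`. -/
def BoxState.shareA (s : BoxState n κ) : Fin n → Triple (Auth κ) := fun i =>
  (mac s.Δ (s.x i) (s.K i).1, mac s.Δ (s.y i) (s.K i).2.1, mac s.Δ (s.x i * s.y i) (s.K i).2.2)

/-- Every honest party has called the box, and the corrupted one has chosen its values. -/
def BoxState.ready (corr : Option Party) (s : BoxState n κ) : Prop :=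
  ∀ p : Party, if corr = some p then s.chosen = true else s.started p = true

instance (corr : Option Party) (s : BoxState n κ) : Decidable (s.ready corr) := by
  unfold BoxState.ready; infer_instance

/-- An honest party calls the box; the adversary is told. -/
def boxCall (corr : Option Party) (p : Party) (s : BoxState n κ) : BoxState n κ × BoxResp :=
  if corr ≠ some p ∧ s.started p = false then
    ({ s with started := Function.update s.started p true }, .started p)
  else (s, .ack)

/-- Mark `p` as served. -/
def BoxState.finish (s : BoxState n κ) (p : Party) : BoxState n κ :=
  { s with done := Function.update s.done p true }

/-- The reaction of the box to the adversary; `corr` is the corrupted party, if any. With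
`leaky = true` this is the box that lets a corrupted `B` guess bits `x i`. Commands that are not
admissible have no effect. -/
def boxAdv (leaky : Bool) (corr : Option Party) (s : BoxState n κ) : BoxCmd n κ → BoxOut n κ
  | .keyQuery Δ' =>
      ⟨s, .answer (if (corr = some Party.B → s.chosen = true) ∧ Δ' = s.Δ then 1 else 0),
        none, none⟩
  | .chooseA v =>
      if corr = some Party.A ∧ s.chosen = false then
        ⟨{ s with
            x := fun i => (v i).1
            y := fun i => (v i).2.1
            K := fun i => ((v i).2.2.1 + (v i).1 • s.Δ, (v i).2.2.2.1 + (v i).2.1 • s.Δ,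
              (v i).2.2.2.2 + ((v i).1 * (v i).2.1) • s.Δ)
            chosen := true }, .ack, none, none⟩
      else ⟨s, .ack, none, none⟩
  | .chooseB v =>
      if corr = some Party.B ∧ s.chosen = false then
        ⟨{ s with Δ := v.1, K := v.2, chosen := true }, .ack, none, none⟩
      else ⟨s, .ack, none, none⟩
  | .guess i g =>
      if leaky = true ∧ corr = some Party.B ∧ s.started Party.A = true ∧ s.done Party.A = false then
        if s.x i = g then ⟨s, .answer 1, none, none⟩
        else ⟨s.finish Party.A, .answer 0, some none, none⟩
      else ⟨s, .ack, none, none⟩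
  | .deliver p =>
      if corr ≠ some p ∧ s.ready corr ∧ s.done p = false then
        ⟨s.finish p, .ack, if p = Party.A then some (some s.shareA) else none,
          if p = Party.B then some (some (s.Δ, s.K)) else none⟩
      else ⟨s, .ack, none, none⟩
  | .abort p =>
      if corr ≠ none ∧ corr ≠ some p ∧ s.started p = true ∧ s.done p = false then
        ⟨s.finish p, .ack, if p = Party.A then some none else none,
          if p = Party.B then some none else none⟩
      else ⟨s, .ack, none, none⟩

/-! ### The protocol

Buckets have size `b + 1` and there are `ℓ` of them. -/

/-- Combination of two triples with opened bit `d`. It is used for the bits and MACs of `A` as well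
as for the keys of `B`. -/
def combine {V : Type} [AddCommGroup V] [Module (ZMod 2) V] (d : ZMod 2) (s t : Triple V) :
    Triple V :=
  (s.1 + t.1, s.2.1, s.2.2 + t.2.2 + d • t.1)

/-- `A` combines the triples of a bucket one after the other; the first component lists the bits
`d` (with MACs) that she reveals. -/
def combineA {κ : ℕ} : (m : ℕ) → (Fin (m + 1) → Triple (Auth κ)) →
    (Fin m → Auth κ) × Triple (Auth κ)
  | 0, t => (Fin.elim0, t 0)
  | m + 1, t =>
      let r := combineA m fun k => t k.castSucc
      let s := t (Fin.last (m + 1))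
      let o := r.2.2.1 + s.2.1
      (Fin.snoc (α := fun _ => Auth κ) r.1 o, combine o.1 r.2 s)

/-- `B` combines the keys of a bucket, checking the MAC of each revealed bit; `none` if a check
fails. -/
def combineB {κ : ℕ} (Δ : Str κ) : (m : ℕ) → (Fin (m + 1) → Triple (Str κ)) →
    (Fin m → Auth κ) → Option (Triple (Str κ))
  | 0, t, _ => some (t 0)
  | m + 1, t, o =>
      (combineB Δ m (fun k => t k.castSucc) fun k => o k.castSucc).bind fun r =>
        let s := t (Fin.last (m + 1))
        let c := o (Fin.last m)
        if c.2 = r.2.1 + s.2.1 + c.1 • Δ then some (combine c.1 r s) else none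

/-- The position `j (b + 1) + k`, i.e. the `k`-th place of the `j`-th bucket. -/
def slot {b ℓ : ℕ} (j : Fin ℓ) (k : Fin (b + 1)) : Fin (ℓ * (b + 1)) := finProdFinEquiv (j, k)

/-- What `A` sends to `B`: the permutation, and the revealed bits with their MACs. -/
abbrev Msg (b ℓ κ : ℕ) := Equiv.Perm (Fin (ℓ * (b + 1))) × (Fin ℓ → Fin b → Auth κ)

variable {b ℓ : ℕ}

/-- `A` arranges her triples in buckets along `π` and combines. -/
def protocolA (π : Equiv.Perm (Fin (ℓ * (b + 1)))) (t : Fin (ℓ * (b + 1)) → Triple (Auth κ)) :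
    Msg b ℓ κ × (Fin ℓ → Triple (Auth κ)) :=
  ((π, fun j => (combineA b fun k => t (π (slot j k))).1),
    fun j => (combineA b fun k => t (π (slot j k))).2)

/-- The output of `B`, from his output of the leaky box and the message received (`none` if
malformed). He outputs `fail` if the message is malformed or some check fails. -/
def protocolB (v : BChoice (ℓ * (b + 1)) κ) (msg : Option (Msg b ℓ κ)) : BOut ℓ κ :=
  msg.bind fun m =>
    if h : ∀ j, (combineB v.1 b (fun k => v.2 (m.1 (slot j k))) (m.2 j)).isSome = true then
      some (v.1, fun j => (combineB v.1 b (fun k => v.2 (m.1 (slot j k))) (m.2 j)).get (h j))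
    else none

/-! ### The hybrid world -/

/-- What the environment, which also directs the adversary, can do. -/
inductive AdvCmd (b ℓ κ : ℕ) : Type
  /-- a command of the adversary to the leaky box -/
  | box (c : BoxCmd (ℓ * (b + 1)) κ)
  /-- a corrupted `A` sends a message to `B` -/
  | send (m : Msg b ℓ κ)
  /-- a corrupted `A` sends a malformed message to `B` -/
  | sendMalformed
  /-- the message in transit from an honest `A` is delivered to an honest `B` -/
  | forward

inductive EnvCmd (b ℓ κ : ℕ) : Type
  /-- honest party `p` is told to run the protocol -/
  | input (p : Party)
  | adv (c : AdvCmd b ℓ κ)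

/-- What the adversary reports: the message of the box, and a message sent by `A` (channels are
authenticated, not private). -/
abbrev AdvResp (b ℓ κ : ℕ) := BoxResp × Option (Msg b ℓ κ)

/-- What the environment sees: the report of the adversary and the outputs of honest parties. -/
structure EnvResp (b ℓ κ : ℕ) where
  resp : AdvResp b ℓ κ
  outA : Option (AOut ℓ κ)
  outB : Option (BOut ℓ κ)

structure HybridState (b ℓ κ : ℕ) where
  box : BoxState (ℓ * (b + 1)) κ
  /-- a message of an honest `A` -/
  transit : Option (Msg b ℓ κ)
  /-- what an honest `B` got from the leaky box -/
  keysB : Option (BChoice (ℓ * (b + 1)) κ)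
  /-- the first message an honest `B` received; `some none` if malformed -/
  inboxB : Option (Option (Msg b ℓ κ))

/-- `B` stores the first message; if he already has his keys he finishes. -/
def HybridState.receive (s : HybridState b ℓ κ) (m : Option (Msg b ℓ κ)) :
    HybridState b ℓ κ × EnvResp b ℓ κ :=
  if s.inboxB = none then
    ({ s with inboxB := some m }, ⟨(.ack, none), none, s.keysB.map fun v => protocolB v m⟩)
  else (s, ⟨(.ack, none), none, none⟩)

/-- One activation of the hybrid world, in which the parties run the protocol with the leaky box.
The honest `A` draws her permutation from `D`. -/
def hybridStep (D : PMF (Equiv.Perm (Fin (ℓ * (b + 1))))) (corr : Option Party)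
    (s : HybridState b ℓ κ) : EnvCmd b ℓ κ → PMF (HybridState b ℓ κ × EnvResp b ℓ κ)
  | .input p =>
      let q := boxCall corr p s.box
      PMF.pure ({ s with box := q.1 }, ⟨(q.2, none), none, none⟩)
  | .adv (.box c) =>
      let o := boxAdv true corr s.box c
      let s₁ : HybridState b ℓ κ := { s with box := o.state }
      match o.outA, o.outB with
      | none, none => PMF.pure (s₁, ⟨(o.resp, none), none, none⟩)
      | some none, _ => PMF.pure (s₁, ⟨(o.resp, none), some none, none⟩)
      | some (some t), _ => D.bind fun π =>
          let r := protocolA π t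
          PMF.pure ({ s₁ with transit := some r.1 }, ⟨(o.resp, some r.1), some (some r.2), none⟩)
      | none, some none => PMF.pure (s₁, ⟨(o.resp, none), none, some none⟩)
      | none, some (some v) =>
          PMF.pure ({ s₁ with keysB := some v },
            ⟨(o.resp, none), none, s.inboxB.map fun m => protocolB v m⟩)
  | .adv (.send m) =>
      PMF.pure (if corr = some Party.A then s.receive (some m)
        else (s, ⟨(.ack, none), none, none⟩))
  | .adv .sendMalformed =>
      PMF.pure (if corr = some Party.A then s.receive none else (s, ⟨(.ack, none), none, none⟩))
  | .adv .forward =>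
      PMF.pure (match corr, s.transit with
        | none, some m => s.receive (some m)
        | _, _ => (s, ⟨(.ack, none), none, none⟩))

/-- The protocol in the hybrid model. -/
def hybridWorld (κ : ℕ) (D : PMF (Equiv.Perm (Fin (ℓ * (b + 1))))) (corr : Option Party) :
    System (EnvCmd b ℓ κ) (EnvResp b ℓ κ) where
  State := HybridState b ℓ κ
  start := (boxStart (ℓ * (b + 1)) κ).map fun s => ⟨s, none, none, none⟩
  step := hybridStep D corr

/-! ### Efficient functions -/

/-- `Cost f c`: the function `f` is computed by a straight-line program of cost `c`. The programs
work on bits, indices, tuples, vectors and tagged unions; loops are unrolled, and data are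
immutable, so that tupling does not copy. -/
inductive Cost : {α β : Type} → (α → β) → ℕ → Prop
  | id {α : Type} : Cost (fun a : α => a) 1
  | comp {α β γ : Type} {f : α → β} {g : β → γ} {c d : ℕ} :
      Cost f c → Cost g d → Cost (fun a => g (f a)) (c + d)
  | unit {α : Type} : Cost (fun _ : α => ()) 1
  | bit {α : Type} (x : ZMod 2) : Cost (fun _ : α => x) 1
  | index {α : Type} {m : ℕ} (i : Fin m) : Cost (fun _ : α => i) 1
  | add : Cost (fun p : ZMod 2 × ZMod 2 => p.1 + p.2) 1
  | mul : Cost (fun p : ZMod 2 × ZMod 2 => p.1 * p.2) 1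
  | eqIndex {m : ℕ} : Cost (fun p : Fin m × Fin m => if p.1 = p.2 then (1 : ZMod 2) else 0) (m + 1)
  | pair {α β γ : Type} {f : α → β} {g : α → γ} {c d : ℕ} :
      Cost f c → Cost g d → Cost (fun a => (f a, g a)) (c + d + 1)
  | fst {α β : Type} : Cost (fun p : α × β => p.1) 1
  | snd {α β : Type} : Cost (fun p : α × β => p.2) 1
  | select {α : Type} : Cost (fun p : ZMod 2 × α × α => if p.1 = 1 then p.2.1 else p.2.2) 1
  | inl {α β : Type} : Cost (fun a : α => (Sum.inl a : α ⊕ β)) 1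
  | inr {α β : Type} : Cost (fun a : β => (Sum.inr a : α ⊕ β)) 1
  | cases {α β γ δ : Type} {f : α × γ → δ} {g : β × γ → δ} {c d : ℕ} :
      Cost f c → Cost g d →
      Cost (fun p : (α ⊕ β) × γ => p.1.elim (fun a => f (a, p.2)) fun a => g (a, p.2)) (c + d + 1)
  | vector {α β : Type} {m : ℕ} {f : Fin m → α → β} {c : Fin m → ℕ} :
      (∀ i, Cost (f i) (c i)) → Cost (fun a i => f i a) ((∑ i, c i) + 1)
  | lookup {α : Type} {m : ℕ} : Cost (fun p : (Fin m → α) × Fin m => p.1 p.2) (m + 1)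
  | perm {m : ℕ} : Cost (fun p : Equiv.Perm (Fin m) × Fin m => p.1 p.2) (m + 1)

/-! ### Simulators and the ideal world -/

/-- `BoxCmd` as a tagged union. -/
abbrev BoxCode (n κ : ℕ) :=
  Str κ ⊕ (Fin n → AChoice κ) ⊕ BChoice n κ ⊕ (Fin n × ZMod 2) ⊕ Party ⊕ Party

def BoxCmd.encode : BoxCmd n κ → BoxCode n κ
  | .keyQuery Δ => .inl Δ
  | .chooseA v => .inr (.inl v)
  | .chooseB v => .inr (.inr (.inl v))
  | .guess i g => .inr (.inr (.inr (.inl (i, g))))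
  | .deliver p => .inr (.inr (.inr (.inr (.inl p))))
  | .abort p => .inr (.inr (.inr (.inr (.inr p))))

def BoxCmd.decode : BoxCode n κ → BoxCmd n κ
  | .inl Δ => .keyQuery Δ
  | .inr (.inl v) => .chooseA v
  | .inr (.inr (.inl v)) => .chooseB v
  | .inr (.inr (.inr (.inl (i, g)))) => .guess i g
  | .inr (.inr (.inr (.inr (.inl p)))) => .deliver p
  | .inr (.inr (.inr (.inr (.inr p)))) => .abort p

/-- `BoxResp` as a tagged union. -/
abbrev RespCode := Unit ⊕ Party ⊕ ZMod 2

def BoxResp.encode : BoxResp → RespCode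
  | .ack => .inl ()
  | .started p => .inr (.inl p)
  | .answer c => .inr (.inr c)

def BoxResp.decode : RespCode → BoxResp
  | .inl () => .ack
  | .inr (.inl p) => .started p
  | .inr (.inr c) => .answer c

/-- `AdvCmd` as a tagged union. -/
abbrev AdvCode (b ℓ κ : ℕ) := BoxCode (ℓ * (b + 1)) κ ⊕ Msg b ℓ κ ⊕ Unit ⊕ Unit

def AdvCmd.encode : AdvCmd b ℓ κ → AdvCode b ℓ κ
  | .box c => .inl c.encode
  | .send m => .inr (.inl m)
  | .sendMalformed => .inr (.inr (.inl ()))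
  | .forward => .inr (.inr (.inr ()))

/-- What activates the simulator: a command of the environment to the adversary, or a message of
the ideal box. -/
abbrev SimIn (b ℓ κ : ℕ) := AdvCode b ℓ κ ⊕ RespCode

/-- What the simulator does: it inputs a command to the ideal box, or it reports to the
environment, possibly with a message that `A` is supposed to have sent. -/
abbrev SimOut (b ℓ κ : ℕ) := BoxCode ℓ κ ⊕ (RespCode × (Unit ⊕ Msg b ℓ κ))

/-- A simulator. In every step it uses fresh coins and a fresh permutation drawn like that of an
honest `A`. Per activation by the environment it takes at most `steps` steps. Its initial state and
its steps are computed at a cost within `budget`. -/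
structure Simulator (b ℓ κ budget : ℕ) where
  State : Type
  start : State
  coins : ℕ
  steps : ℕ
  step : State × SimIn b ℓ κ × Str coins × Equiv.Perm (Fin (ℓ * (b + 1))) → State × SimOut b ℓ κ
  coins_le : coins ≤ budget
  steps_le : steps ≤ budget
  start_cost : ∃ c ≤ budget, Cost (fun _ : Unit => start) c
  step_cost : ∃ c ≤ budget, Cost step c

/-- The simulator, activated with `e`, talks to the ideal box until it reports to the environment.
Outputs of the box to honest parties go directly to the environment. -/
def Simulator.run {budget : ℕ} (S : Simulator b ℓ κ budget)
    (D : PMF (Equiv.Perm (Fin (ℓ * (b + 1))))) (corr : Option Party) :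
    ℕ → S.State × BoxState ℓ κ → SimIn b ℓ κ →
      PMF ((S.State × BoxState ℓ κ) × EnvResp b ℓ κ)
  | 0, s, _ => PMF.pure (s, ⟨(.ack, none), none, none⟩)
  | q + 1, s, e =>
      (PMF.uniformOfFintype (Str S.coins)).bind fun r => D.bind fun π =>
        match S.step (s.1, e, r, π) with
        | (σ, .inr (c, m)) =>
            PMF.pure ((σ, s.2), ⟨(BoxResp.decode c, m.elim (fun _ => none) some), none, none⟩)
        | (σ, .inl c) =>
            let o := boxAdv false corr s.2 (BoxCmd.decode c)
            (S.run D corr q (σ, o.state) (.inr o.resp.encode)).bind fun w =>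
              PMF.pure (w.1, ⟨w.2.resp, o.outA.orElse fun _ => w.2.outA,
                o.outB.orElse fun _ => w.2.outB⟩)

/-- The ideal world: honest parties use the non-leaky box with `ℓ` triples, and the simulator takes
the place of the adversary. -/
def idealWorld {budget : ℕ} (S : Simulator b ℓ κ budget)
    (D : PMF (Equiv.Perm (Fin (ℓ * (b + 1))))) (corr : Option Party) :
    System (EnvCmd b ℓ κ) (EnvResp b ℓ κ) where
  State := S.State × BoxState ℓ κ
  start := (boxStart ℓ κ).map fun s => (S.start, s)
  step s
    | .input p =>
        let q := boxCall corr p s.2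
        S.run D corr S.steps (s.1, q.1) (.inr q.2.encode)
    | .adv c => S.run D corr S.steps s (.inl c.encode)

/-- The protocol with permutation distribution `D` securely implements the box for `ℓ`
authenticated local ANDs in the hybrid model with the leaky box for `ℓ (b + 1)` of them, against
static active corruption of no party, of `A` or of `B`: some simulator within the budget achieves
that no environment distinguishes the worlds with advantage more than `ε`. -/
def SecurelyImplements (b ℓ κ : ℕ) (D : PMF (Equiv.Perm (Fin (ℓ * (b + 1))))) (budget : ℕ)
    (ε : ℝ) : Prop :=
  ∀ corr : Option Party, ∃ S : Simulator b ℓ κ budget, ∀ Z : Env (EnvCmd b ℓ κ) (EnvResp b ℓ κ),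
    |(hybridWorld κ D corr).prob Z - (idealWorld S D corr).prob Z| ≤ ε

/-! ### Bucketing -/

/-- A random permutation is `k`-wise independent if it maps any `k` distinct points to a uniformly
random `k`-tuple of distinct points. -/
def KWiseIndependent (k : ℕ) {n : ℕ} (D : PMF (Equiv.Perm (Fin n))) : Prop :=
  ∀ s t : Fin k ↪ Fin n,
    D.toOuterMeasure {π | ∀ i, π (s i) = t i} = ((n.descFactorial k : ℕ) : ℝ≥0∞)⁻¹

/-- The probability that a corrupted `B`, guessing bits `x i` along a random list drawn from `G`,
passes undetected (all guesses are right) and that some bucket consists only of guessed triples.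
While `B` is undetected every answer he gets is the same, so an adaptive strategy is a random
list. -/
def leakProb (b ℓ : ℕ) (D : PMF (Equiv.Perm (Fin (ℓ * (b + 1)))))
    (G : PMF (List (Fin (ℓ * (b + 1)) × ZMod 2))) : ℝ :=
  (((PMF.uniformOfFintype (Fin (ℓ * (b + 1)) → ZMod 2)).bind fun x => G.bind fun L =>
    D.bind fun π => PMF.pure (x, L, π)).toOuterMeasure
      {w | (∀ p ∈ w.2.1, w.1 p.1 = p.2) ∧
        ∃ j : Fin ℓ, ∀ k : Fin (b + 1), ∃ g, (w.2.2 (slot j k), g) ∈ w.2.1}).toReal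

end BucketAND

end

/-! The simulator imitates the leaky box and the honest party, and in each case the law of what the
environment sees has to be compared. With `π` and the opened bits fixed, the protocol is linear over
`ZMod 2` (closed form `combineAll`): a bucket yields `X = ∑ xₖ` and `Y = y₀`, the opened bits are
`dₖ = y₀ + yₖ`, and `∑ xₖ yₖ + ∑ dₖ xₖ = X Y`.

No corruption: the results and the opened bits with their MACs are jointly uniform
(`uniform_map_resultOf`), since the opened bits depend on `y` alone and, for fixed `y`, the keys are
mapped by a surjective homomorphism. A message made of random coins is therefore a perfect
simulation.

Corrupted `A`: a false opened bit passes the check only if its MAC is off by exactly `Δ`. Her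
message and choices thus determine the only `Δ` under which a lie survives, and one key query
decides whether `B` accepts (`ViewA.checks_iff`). If a lie survives, the simulator knows `Δ` and can
correct the MAC of a wrong `z` (`ViewA.keysOf_values`). This simulation is perfect too.

Corrupted `B`: guesses are answered with fresh coins. The opened bits hide everything about `x`, and
`X` is uniform as soon as each bucket contains an unguessed `x` (`uniform_map_bucketX_fill`). Since
`π` is drawn after the guesses, `B`-wise independence and a union bound show that `s` guessed
triples fill some bucket with probability at most `ℓ · s.descFactorial B / (ℓ B).descFactorial B ≤ 2
^ s · (2 ℓ) ^ (1 - B)` (`toOuterMeasure_badPerms_le`); for `ℓ ≥ 2` this rests on the fact that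
`s.choose B / 2 ^ s` is largest at `s = 2 B`. As `s` guesses are all right with probability at most
`2 ^ (-s)`, the bound `(2 ℓ) ^ (1 - B)` follows, for the bare guessing game (`leakProb_le`) and for
the simulation.

For adaptive environments, distributions of states of the two worlds are related with an error that
may change at each activation (`Lift`, `System.advantage_le`). After `s` distinct right guesses the
error is `2 ^ s (2 ℓ) ^ (1 - B)`: a new guess doubles it with probability `1/2` and otherwise makes
it `0`, so its expectation is preserved (`liftB_guess`); it is spent when the output of `A` is
delivered (`liftB_deliver`). -/

noncomputable section

namespace BucketAND

section

/-! ### Expectations and couplings -/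

/-- The expectation of a nonnegative function. -/
def expect {α : Type} (p : PMF α) (h : α → ℝ≥0∞) : ℝ≥0∞ := ∑' a, p a * h a

theorem expect_pure {α : Type} (a : α) (h : α → ℝ≥0∞) : expect (PMF.pure a) h = h a := by
  unfold expect
  rw [tsum_eq_single a]
  · simp
  · intro b hb; simp [PMF.pure_apply, hb]

theorem expect_bind {α β : Type} (p : PMF α) (f : α → PMF β) (h : β → ℝ≥0∞) :
    expect (p.bind f) h = expect p fun a => expect (f a) h := by
  unfold expect
  simp only [PMF.bind_apply, ← ENNReal.tsum_mul_left, ← ENNReal.tsum_mul_right]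
  rw [ENNReal.tsum_comm]
  simp only [mul_assoc]

theorem expect_map {α β : Type} (p : PMF α) (f : α → β) (h : β → ℝ≥0∞) :
    expect (p.map f) h = expect p fun a => h (f a) := by
  rw [PMF.map, expect_bind]
  simp [expect_pure]

theorem expect_mono {α : Type} (p : PMF α) {h k : α → ℝ≥0∞} (hk : ∀ a, h a ≤ k a) :
    expect p h ≤ expect p k :=
  ENNReal.tsum_le_tsum fun a => mul_le_mul_right (hk a) _

theorem expect_add {α : Type} (p : PMF α) (h k : α → ℝ≥0∞) :
    expect p (fun a => h a + k a) = expect p h + expect p k := by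
  simp only [expect, mul_add, ENNReal.tsum_add]

theorem expect_const {α : Type} (p : PMF α) (c : ℝ≥0∞) : expect p (fun _ => c) = c := by
  simp [expect, ENNReal.tsum_mul_right]

theorem expect_le_one {α : Type} (p : PMF α) {h : α → ℝ≥0∞} (hh : ∀ a, h a ≤ 1) :
    expect p h ≤ 1 :=
  (expect_mono p hh).trans (expect_const p 1).le

theorem expect_comm {α β : Type} (p : PMF α) (q : PMF β) (h : α → β → ℝ≥0∞) :
    (expect p fun a => expect q fun b => h a b) = expect q fun b => expect p fun a => h a b := by
  simp only [expect, ← ENNReal.tsum_mul_left]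
  rw [ENNReal.tsum_comm]
  simp only [mul_left_comm]

theorem expect_indicator {α : Type} (p : PMF α) (s : Set α) :
    expect p (s.indicator 1) = p.toOuterMeasure s := by
  rw [PMF.toOuterMeasure_apply]
  refine tsum_congr fun a => ?_
  by_cases h : a ∈ s <;> simp [h]

/-! ### Approximate relational lifting, defined by test functions -/

section Lift

variable {S₁ S₂ : Type}

/-- Two functions with values in `[0, 1]`, given on the states of two systems, have expectations
that differ by at most `δ` under any pair of distributions related with error `δ`. -/
structure Compatible (R : PMF S₁ → PMF S₂ → ℝ≥0∞ → Prop) {O : Type}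
    (h₁ : S₁ × O → ℝ≥0∞) (h₂ : S₂ × O → ℝ≥0∞) : Prop where
  le_one_left : ∀ x, h₁ x ≤ 1
  le_one_right : ∀ x, h₂ x ≤ 1
  left : ∀ μ₁ μ₂ δ, R μ₁ μ₂ δ → ∀ o,
    expect μ₁ (fun s => h₁ (s, o)) ≤ expect μ₂ (fun s => h₂ (s, o)) + δ
  right : ∀ μ₁ μ₂ δ, R μ₁ μ₂ δ → ∀ o,
    expect μ₂ (fun s => h₂ (s, o)) ≤ expect μ₁ (fun s => h₁ (s, o)) + δ

/-- The lifting of a relation between distributions of states, with errors, to distributions of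
pairs of a state and an output. -/
def Lift (R : PMF S₁ → PMF S₂ → ℝ≥0∞ → Prop) {O : Type} (p : PMF (S₁ × O)) (q : PMF (S₂ × O))
    (ε : ℝ≥0∞) : Prop :=
  ∀ h₁ h₂, Compatible R h₁ h₂ → expect p h₁ ≤ expect q h₂ + ε ∧ expect q h₂ ≤ expect p h₁ + ε

variable {R : PMF S₁ → PMF S₂ → ℝ≥0∞ → Prop} {O : Type}

theorem Lift.of_rel {μ₁ : PMF S₁} {μ₂ : PMF S₂} {ε : ℝ≥0∞} (h : R μ₁ μ₂ ε) (o : O) :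
    Lift R (μ₁.map fun s => (s, o)) (μ₂.map fun s => (s, o)) ε := by
  intro h₁ h₂ hc
  simp only [expect_map]
  exact ⟨hc.left _ _ _ h o, hc.right _ _ _ h o⟩

theorem Lift.of_pure {s₁ : S₁} {s₂ : S₂} {ε : ℝ≥0∞} (h : R (PMF.pure s₁) (PMF.pure s₂) ε)
    (o : O) : Lift R (PMF.pure (s₁, o)) (PMF.pure (s₂, o)) ε := by
  simpa [PMF.pure_map] using Lift.of_rel h o

/-- Test functions take values in `[0, 1]`, so an error of at least `1` demands nothing. This is how
bad permutations are charged. -/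
theorem Lift.of_one_le {p : PMF (S₁ × O)} {q : PMF (S₂ × O)} {ε : ℝ≥0∞} (h : 1 ≤ ε) :
    Lift R p q ε := fun _ _ hc =>
  ⟨(expect_le_one p hc.le_one_left).trans (h.trans le_add_self),
    (expect_le_one q hc.le_one_right).trans (h.trans le_add_self)⟩

/-- Both sides draw the same `a`; the errors of the branches are averaged. A large error in an
unlikely branch is thus paid for by its probability. -/
theorem Lift.bind {α : Type} (ν : PMF α) {p : α → PMF (S₁ × O)} {q : α → PMF (S₂ × O)}
    {ε : α → ℝ≥0∞} {δ : ℝ≥0∞} (h : ∀ a, Lift R (p a) (q a) (ε a)) (hδ : expect ν ε ≤ δ) :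
    Lift R (ν.bind p) (ν.bind q) δ := by
  intro h₁ h₂ hc
  rw [expect_bind, expect_bind]
  constructor
  · refine (expect_mono ν fun a => (h a h₁ h₂ hc).1).trans ?_
    rw [expect_add]; gcongr
  · refine (expect_mono ν fun a => (h a h₁ h₂ hc).2).trans ?_
    rw [expect_add]; gcongr

/-- The independent coupling: it serves when the hidden values of the two worlds no longer matter,
so that any pairing of them will do. -/
theorem Lift.bind_bind {α β : Type} (μ : PMF α) (ν : PMF β) {p : α → PMF (S₁ × O)}
    {q : β → PMF (S₂ × O)} {ε : ℝ≥0∞} (h : ∀ a b, Lift R (p a) (q b) ε) :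
    Lift R (μ.bind p) (ν.bind q) ε := by
  have h₁ : μ.bind p = μ.bind fun a => ν.bind fun _ => p a := by simp [PMF.bind_const]
  have h₂ : ν.bind q = μ.bind fun _ => ν.bind q := by simp [PMF.bind_const]
  rw [h₁, h₂]
  exact Lift.bind μ (fun a => Lift.bind ν (fun b => h a b) (expect_const ν ε).le)
    (expect_const μ ε).le

/-- Coupling along a common marginal. -/
theorem Lift.map_of_marginal {α β γ : Type} {μ : PMF α} {ν : PMF β} {f : α → S₁ × O}
    {g : β → S₂ × O} (u : α → γ) (v : β → γ) (huv : μ.map u = ν.map v)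
    (h : ∀ a b, u a = v b → Lift R (PMF.pure (f a)) (PMF.pure (g b)) 0) :
    Lift R (μ.map f) (ν.map g) 0 := by
  intro h₁ h₂ hc
  -- With error `0` and point masses on both sides, the two inequalities in `Lift` force the test
  -- values to agree.
  have key : ∀ a b, u a = v b → h₁ (f a) = h₂ (g b) := by
    intro a b hab
    have := h a b hab h₁ h₂ hc
    simp only [expect_pure, add_zero] at this
    exact le_antisymm this.1 this.2
  simp only [expect_map, add_zero]
  constructor
  -- `H` is the supremum of the test function over a fibre of `u`. It dominates the left test
  -- function pointwise, and by `key` its value at `v b` is at most the right one, so it transports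
  -- the inequality through the common marginal.
  · let H : γ → ℝ≥0∞ := fun c => ⨆ (a) (_ : u a = c), h₁ (f a)
    calc expect μ (fun a => h₁ (f a)) ≤ expect μ fun a => H (u a) :=
          expect_mono μ fun a => le_iSup₂_of_le a rfl le_rfl
      _ = expect ν fun b => H (v b) := by rw [← expect_map μ u H, huv, expect_map]
      _ ≤ _ := expect_mono ν fun b => iSup₂_le fun a hab => (key a b hab).le
  · let H : γ → ℝ≥0∞ := fun c => ⨆ (b) (_ : v b = c), h₂ (g b)
    calc expect ν (fun b => h₂ (g b)) ≤ expect ν fun b => H (v b) :=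
          expect_mono ν fun b => le_iSup₂_of_le b rfl le_rfl
      _ = expect μ fun a => H (u a) := by rw [← expect_map ν v H, ← huv, expect_map]
      _ ≤ _ := expect_mono μ fun a => iSup₂_le fun b hab => (key a b hab.symm).ge

theorem Lift.mono {p : PMF (S₁ × O)} {q : PMF (S₂ × O)} {ε δ : ℝ≥0∞} (h : Lift R p q ε)
    (hεδ : ε ≤ δ) : Lift R p q δ := fun h₁ h₂ hc =>
  ⟨(h h₁ h₂ hc).1.trans (by gcongr), (h h₁ h₂ hc).2.trans (by gcongr)⟩

end Lift

/-! ### The advantage of an environment -/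

section Value

variable {I O : Type}

/-- The probability that the environment outputs `true` when `n` activations are left. -/
def System.value (W : System I O) (Z : Env I O) : ℕ → W.State → List (I × O) → ℝ≥0∞
  | 0, _, tr => Z.decide tr true
  | n + 1, s, tr => expect (Z.next tr) fun i => expect (W.step s i) fun q =>
      W.value Z n q.1 (tr ++ [(i, q.2)])

theorem System.expect_value_succ (W : System I O) (Z : Env I O) (n : ℕ)
    (p : PMF (W.State × List (I × O))) :
    expect p (fun p => W.value Z (n + 1) p.1 p.2) = expect p fun p => expect (Z.next p.2) fun i =>
      expect (W.step p.1 i) fun q => W.value Z n q.1 (p.2 ++ [(i, q.2)]) := rfl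

theorem System.value_le_one (W : System I O) (Z : Env I O) (n : ℕ) (s : W.State)
    (tr : List (I × O)) : W.value Z n s tr ≤ 1 := by
  induction n generalizing s tr with
  | zero => exact PMF.coe_le_one _ _
  | succ n ih => exact expect_le_one _ fun i => expect_le_one _ fun q => ih _ _

/-- `run` recurses forwards and `value` backwards in time; each step of the induction moves one
activation from one to the other. -/
theorem System.expect_run (W : System I O) (Z : Env I O) (n t : ℕ) :
    expect (W.run Z t) (fun p => W.value Z n p.1 p.2) =
      expect W.start fun s => W.value Z (t + n) s [] := by
  induction t generalizing n with
  | zero => simp [System.run, expect_bind, expect_pure]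
  | succ t ih =>
      simp only [System.run, expect_bind, expect_pure]
      rw [← System.expect_value_succ, ih (n + 1), show t + 1 + n = t + (n + 1) by omega]

theorem System.prob_eq (W : System I O) (Z : Env I O) :
    W.prob Z = (expect W.start fun s => W.value Z Z.rounds s []).toReal := by
  unfold System.prob
  congr 1
  have := W.expect_run Z 0 Z.rounds
  simp only [System.value, add_zero] at this
  rw [← this, PMF.bind_apply]
  rfl

/-- If the steps of two systems preserve a relation between distributions of states, with errors,
then no environment distinguishes the systems by more than the initial error. -/
theorem System.advantage_le (W₁ W₂ : System I O)
    (R : PMF W₁.State → PMF W₂.State → ℝ≥0∞ → Prop) {ε : ℝ≥0∞} (hε : ε ≠ ∞)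
    (hstart : Lift R (W₁.start.map fun s => (s, ())) (W₂.start.map fun s => (s, ())) ε)
    (hstep : ∀ μ₁ μ₂ δ, R μ₁ μ₂ δ → ∀ i,
      Lift R (μ₁.bind fun s => W₁.step s i) (μ₂.bind fun s => W₂.step s i) δ)
    (Z : Env I O) : |W₁.prob Z - W₂.prob Z| ≤ ε.toReal := by
  -- The value functions are themselves admissible test functions: applying `hstep` to those with
  -- `n` activations left gives the compatibility of those with `n + 1` left.
  have key : ∀ n tr, Compatible R (O := Unit) (fun x => W₁.value Z n x.1 tr)
      (fun x => W₂.value Z n x.1 tr) := by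
    intro n
    induction n with
    | zero =>
        intro tr
        refine ⟨fun _ => W₁.value_le_one .., fun _ => W₂.value_le_one .., ?_, ?_⟩ <;>
        · intro μ₁ μ₂ δ _ _
          simp only [System.value, expect_const]
          exact le_self_add
    | succ n ih =>
        intro tr
        have step : ∀ μ₁ μ₂ δ, R μ₁ μ₂ δ → ∀ i, _ := fun μ₁ μ₂ δ h i =>
          hstep μ₁ μ₂ δ h i (fun x => W₁.value Z n x.1 (tr ++ [(i, x.2)]))
            (fun x => W₂.value Z n x.1 (tr ++ [(i, x.2)]))
            ⟨fun _ => W₁.value_le_one .., fun _ => W₂.value_le_one ..,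
              fun μ₁ μ₂ δ h o => (ih (tr ++ [(i, o)])).left μ₁ μ₂ δ h (),
              fun μ₁ μ₂ δ h o => (ih (tr ++ [(i, o)])).right μ₁ μ₂ δ h ()⟩
        -- The next command depends on the transcript alone, so it may be drawn before the state.
        have swap : ∀ (W : System I O) (μ : PMF W.State),
            expect μ (fun s => W.value Z (n + 1) s tr) = expect (Z.next tr) fun i =>
              expect (μ.bind fun s => W.step s i) fun x => W.value Z n x.1 (tr ++ [(i, x.2)]) := by
          intro W μ
          simp only [System.value, expect_bind]
          rw [expect_comm]
        refine ⟨fun _ => W₁.value_le_one .., fun _ => W₂.value_le_one .., ?_, ?_⟩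
        · intro μ₁ μ₂ δ h _
          rw [swap W₁, swap W₂, ← expect_const (Z.next tr) δ, ← expect_add]
          exact expect_mono _ fun i => (step μ₁ μ₂ δ h i).1
        · intro μ₁ μ₂ δ h _
          rw [swap W₁, swap W₂, ← expect_const (Z.next tr) δ, ← expect_add]
          exact expect_mono _ fun i => (step μ₁ μ₂ δ h i).2
  have h := hstart _ _ (key Z.rounds [])
  simp only [expect_map] at h
  rw [System.prob_eq, System.prob_eq]
  have f₁ : (expect W₁.start fun s => W₁.value Z Z.rounds s []) ≠ ∞ :=
    ((expect_le_one _ fun s => W₁.value_le_one ..).trans_lt ENNReal.one_lt_top).ne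
  have f₂ : (expect W₂.start fun s => W₂.value Z Z.rounds s []) ≠ ∞ :=
    ((expect_le_one _ fun s => W₂.value_le_one ..).trans_lt ENNReal.one_lt_top).ne
  rw [abs_sub_le_iff]
  constructor
  · have := ENNReal.toReal_mono (ENNReal.add_ne_top.2 ⟨f₂, hε⟩) h.1
    rw [ENNReal.toReal_add f₂ hε] at this
    linarith
  · have := ENNReal.toReal_mono (ENNReal.add_ne_top.2 ⟨f₁, hε⟩) h.2
    rw [ENNReal.toReal_add f₁ hε] at this
    linarith

end Value

end

section

/-! ### Uniform distributions -/

section Uniform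

variable {α β γ : Type} [Fintype α] [Nonempty α] [Fintype β] [Nonempty β]

theorem eq_uniformOfFintype (p : PMF α) (h : ∀ a b, p a = p b) : p = PMF.uniformOfFintype α := by
  ext a
  have h₁ : (Fintype.card α : ℝ≥0∞) * p a = 1 := by
    rw [← p.tsum_coe, tsum_fintype, Finset.sum_congr rfl fun b _ => h b a]
    simp
  rw [PMF.uniformOfFintype_apply]
  exact ENNReal.eq_inv_of_mul_eq_one_left (by rwa [mul_comm])

/-- Any two fibres are matched by a bijection of the domain, so all of them have the same mass. -/
theorem uniform_map_of_fibers (f : α → β)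
    (h : ∀ b b', ∃ e : α ≃ α, ∀ a, f a = b ↔ f (e a) = b') :
    (PMF.uniformOfFintype α).map f = PMF.uniformOfFintype β := by
  classical
  refine eq_uniformOfFintype _ fun b b' => ?_
  obtain ⟨e, he⟩ := h b b'
  simp only [PMF.map_apply, PMF.uniformOfFintype_apply]
  rw [← e.tsum_eq fun a => if b' = f a then ((Fintype.card α : ℝ≥0∞))⁻¹ else 0]
  refine tsum_congr fun a => ?_
  simp only [eq_comm (a := b), eq_comm (a := b'), he a]

theorem uniform_map_equiv (e : α ≃ β) :
    (PMF.uniformOfFintype α).map e = PMF.uniformOfFintype β := by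
  classical
  refine uniform_map_of_fibers e fun b b' => ⟨Equiv.swap (e.symm b) (e.symm b'), fun a => ?_⟩
  rw [← Equiv.eq_symm_apply, ← Equiv.eq_symm_apply, Equiv.swap_apply_eq_iff, Equiv.swap_apply_right]

/-- Translation by a preimage of `-b + b'` carries the fibre over `b` to the one over `b'`. All
uniformity statements about the protocol below are reduced to surjectivity of a homomorphism. -/
theorem uniform_map_hom {α β : Type} [Fintype α] [AddGroup α] [Fintype β] [AddGroup β]
    (f : α →+ β) (hf : Function.Surjective f) :
    (PMF.uniformOfFintype α).map f = PMF.uniformOfFintype β := by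
  refine uniform_map_of_fibers f fun b b' => ?_
  obtain ⟨c, hc⟩ := hf (-b + b')
  refine ⟨Equiv.addRight c, fun a => ?_⟩
  simp only [Equiv.coe_addRight, map_add, hc]
  rw [← add_assoc, add_eq_right, ← sub_eq_add_neg, sub_eq_zero]

theorem uniform_prod : PMF.uniformOfFintype (α × β) =
    (PMF.uniformOfFintype α).bind fun a => (PMF.uniformOfFintype β).map fun b => (a, b) := by
  classical
  symm
  refine eq_uniformOfFintype _ ?_
  have : ∀ a b, ((PMF.uniformOfFintype α).bind fun a => (PMF.uniformOfFintype β).map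
      fun b => (a, b)) (a, b) = (Fintype.card α : ℝ≥0∞)⁻¹ * (Fintype.card β : ℝ≥0∞)⁻¹ := by
    intro a b
    rw [PMF.bind_apply, tsum_eq_single a]
    · rw [PMF.map_apply, tsum_eq_single b] <;> simp +contextual [eq_comm]
    · intro a' ha'
      rw [PMF.map_apply]
      simp [ha'.symm]
  rintro ⟨a, b⟩ ⟨a', b'⟩
  rw [this, this]

end Uniform

/-- A uniformly random function can be sampled by drawing one of its values separately. -/
theorem uniform_pi_update {n : ℕ} (i : Fin n) :
    PMF.uniformOfFintype (Fin n → ZMod 2) = (PMF.uniformOfFintype (ZMod 2)).bind fun r =>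
      (PMF.uniformOfFintype (Fin n → ZMod 2)).map fun u => Function.update u i r := by
  let f : ZMod 2 × (Fin n → ZMod 2) →+ (Fin n → ZMod 2) :=
    AddMonoidHom.mk' (fun p => Function.update p.2 i p.1) fun p q => by
      ext j; by_cases h : j = i
      · subst h; simp
      · simp [h]
  have hf : Function.Surjective f := fun u => ⟨(u i, u), by simp [f]⟩
  have h := uniform_map_hom f hf
  rw [uniform_prod, PMF.map_bind] at h
  simp only [PMF.map_comp] at h
  exact h.symm

/-! ### Buckets of guessed triples -/

/-- Consecutive binomials satisfy `(s + 1).choose k * (s + 1 - k) = s.choose k * (s + 1)`, and here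
`s + 1 ≤ 2 (s + 1 - k)`. -/
theorem choose_succ_le_two_mul {s k : ℕ} (h : 2 * k ≤ s + 1) :
    (s + 1).choose k ≤ 2 * s.choose k := by
  have := Nat.choose_mul_succ_eq s k
  rcases Nat.eq_zero_or_pos (s + 1 - k) with h0 | h0
  · obtain rfl : k = 0 := by omega
    simp
  · refine Nat.le_of_mul_le_mul_right ?_ h0
    rw [← this, mul_comm 2, mul_assoc]
    exact Nat.mul_le_mul_left _ (by omega)

theorem two_mul_choose_le_succ {s k : ℕ} (h : s + 1 ≤ 2 * k) :
    2 * s.choose k ≤ (s + 1).choose k := by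
  rcases Nat.lt_or_ge s k with h1 | h1
  · simp [Nat.choose_eq_zero_of_lt h1]
  have := Nat.choose_mul_succ_eq s k
  refine Nat.le_of_mul_le_mul_right (c := s + 1 - k) ?_ (by omega)
  rw [← this, mul_comm 2, mul_assoc]
  exact Nat.mul_le_mul_left _ (by omega)

/-- The quotient `s.choose k / 2 ^ s` grows up to `s = 2 k - 1` and decreases from there on, with
equal values at `2 k - 1` and `2 k`. Hence `s = 2 k` is a maximum: the best number of guesses is
twice the bucket size, if so many triples exist. -/
theorem choose_mul_two_pow_le (s k : ℕ) :
    s.choose k * 2 ^ (2 * k) ≤ 2 ^ s * (2 * k).choose k := by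
  rcases le_total (2 * k) s with h | h
  · induction s, h using Nat.le_induction with
    | base => rw [mul_comm]
    | succ s hs ih =>
        have := choose_succ_le_two_mul (s := s) (k := k) (by omega)
        calc _ ≤ 2 * s.choose k * 2 ^ (2 * k) := Nat.mul_le_mul_right _ this
          _ = 2 * (s.choose k * 2 ^ (2 * k)) := by ring
          _ ≤ 2 * (2 ^ s * (2 * k).choose k) := Nat.mul_le_mul_left _ ih
          _ = _ := by ring
  · induction h using Nat.decreasingInduction with
    | self => rw [mul_comm]
    | of_succ s hs ih =>
        have := two_mul_choose_le_succ (s := s) (k := k) (by omega)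
        refine le_of_mul_le_mul_left (a := 2) ?_ (by norm_num)
        calc _ = 2 * s.choose k * 2 ^ (2 * k) := by ring
          _ ≤ (s + 1).choose k * 2 ^ (2 * k) := Nat.mul_le_mul_right _ this
          _ ≤ _ := ih
          _ = _ := by ring

theorem descFactorial_mul_two_pow_le (s k : ℕ) :
    s.descFactorial k * 2 ^ (2 * k) ≤ 2 ^ s * (2 * k).descFactorial k := by
  rw [Nat.descFactorial_eq_factorial_mul_choose, Nat.descFactorial_eq_factorial_mul_choose]
  calc _ = k.factorial * (s.choose k * 2 ^ (2 * k)) := by ring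
    _ ≤ k.factorial * (2 ^ s * (2 * k).choose k) :=
      Nat.mul_le_mul_left _ (choose_mul_two_pow_le s k)
    _ = _ := by ring

/-- The inequality holds factor by factor: `(2 B - k) ℓ ≤ 2 (ℓ B - k)` amounts to `2 k ≤ k ℓ`. -/
theorem descFactorial_two_mul_le {ℓ : ℕ} (hℓ : 2 ≤ ℓ) (B : ℕ) :
    (2 * B).descFactorial B * ℓ ^ B ≤ 2 ^ B * (ℓ * B).descFactorial B := by
  suffices h : ∀ k ≤ B, (2 * B).descFactorial k * ℓ ^ k ≤ 2 ^ k * (ℓ * B).descFactorial k from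
    h B le_rfl
  intro k hk
  induction k with
  | zero => simp
  | succ k ih =>
      rw [Nat.descFactorial_succ, Nat.descFactorial_succ, pow_succ, pow_succ]
      calc _ = ((2 * B - k) * ℓ) * ((2 * B).descFactorial k * ℓ ^ k) := by ring
        _ ≤ (2 * (ℓ * B - k)) * (2 ^ k * (ℓ * B).descFactorial k) := by
            refine Nat.mul_le_mul ?_ (ih (by omega))
            have h1 : k ≤ ℓ * B := by nlinarith
            have h2 : k ≤ 2 * B := by omega
            zify [h1, h2]
            nlinarith
        _ = _ := by ring

/-- The union bound over the `ℓ` buckets with denominators cleared. For `ℓ ≥ 2` the two preceding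
estimates give it with a factor `2` to spare. They do not cover `ℓ = 1`, where the only bucket must
be guessed entirely. -/
theorem descFactorial_bucket_le {b ℓ s : ℕ} (hℓ : 1 ≤ ℓ) (hs : s ≤ ℓ * (b + 1)) :
    ℓ * s.descFactorial (b + 1) * (2 * ℓ) ^ b ≤
      2 ^ s * (ℓ * (b + 1)).descFactorial (b + 1) := by
  rcases hℓ.eq_or_lt with rfl | hℓ
  · rcases Nat.lt_or_ge s (b + 1) with h | h
    · rw [Nat.descFactorial_eq_zero_iff_lt.2 h]; simp
    · obtain rfl : s = b + 1 := by omega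
      simp only [one_mul, mul_one]
      rw [mul_comm]
      exact Nat.mul_le_mul_right _ (Nat.pow_le_pow_right (by norm_num) (by omega))
  · have h1 := descFactorial_mul_two_pow_le s (b + 1)
    have h2 := descFactorial_two_mul_le hℓ (b + 1)
    refine le_of_mul_le_mul_left (a := 2 ^ (2 * (b + 1))) ?_ (by positivity)
    calc _ = (s.descFactorial (b + 1) * 2 ^ (2 * (b + 1))) * (2 ^ b * ℓ ^ (b + 1)) := by ring
      _ ≤ (2 ^ s * (2 * (b + 1)).descFactorial (b + 1)) * (2 ^ b * ℓ ^ (b + 1)) :=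
        Nat.mul_le_mul_right _ h1
      _ = 2 ^ s * 2 ^ b * ((2 * (b + 1)).descFactorial (b + 1) * ℓ ^ (b + 1)) := by ring
      _ ≤ 2 ^ s * 2 ^ b * (2 ^ (b + 1) * (ℓ * (b + 1)).descFactorial (b + 1)) :=
        Nat.mul_le_mul_left _ h2
      _ = 2 ^ (2 * b + 1) * (2 ^ s * (ℓ * (b + 1)).descFactorial (b + 1)) := by ring
      _ ≤ _ := Nat.mul_le_mul_right _ (Nat.pow_le_pow_right (by norm_num) (by omega))

/-- The error of the bucketing, `(2 ℓ) ^ (1 - B)` for buckets of size `B = b + 1`. -/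
def leakBound (b ℓ : ℕ) : ℝ≥0∞ := ((2 * ℓ : ℝ≥0∞) ^ b)⁻¹

/-- The permutations for which all triples of some bucket have an index in `S`. -/
def badPerms {b ℓ : ℕ} (S : Finset (Fin (ℓ * (b + 1)))) :
    Set (Equiv.Perm (Fin (ℓ * (b + 1)))) := {π | ∃ j : Fin ℓ, ∀ k : Fin (b + 1), π (slot j k) ∈ S}

/-- For a fixed bucket, the event splits according to the injection of its places into `S`; each
injection has the probability given by `B`-wise independence. Then sum over the buckets. -/
theorem toOuterMeasure_badPerms_le {b ℓ : ℕ} {D : PMF (Equiv.Perm (Fin (ℓ * (b + 1))))}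
    (hD : KWiseIndependent (b + 1) D) (hℓ : 1 ≤ ℓ) (S : Finset (Fin (ℓ * (b + 1)))) :
    D.toOuterMeasure (badPerms S) ≤ 2 ^ S.card * leakBound b ℓ := by
  classical
  have h1 : ∀ j : Fin ℓ, D.toOuterMeasure {π | ∀ k : Fin (b + 1), π (slot j k) ∈ S} ≤
      (S.card.descFactorial (b + 1) : ℕ) *
        (((ℓ * (b + 1)).descFactorial (b + 1) : ℕ) : ℝ≥0∞)⁻¹ := by
    intro j
    let s : Fin (b + 1) ↪ Fin (ℓ * (b + 1)) :=
      ⟨fun k => slot j k, fun k k' h => (Prod.ext_iff.1 (finProdFinEquiv.injective h)).2⟩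
    have hsub : {π : Equiv.Perm (Fin (ℓ * (b + 1))) | ∀ k : Fin (b + 1), π (slot j k) ∈ S} ⊆
        ⋃ t : Fin (b + 1) ↪ S, {π | ∀ i, π (s i) = (t i : Fin (ℓ * (b + 1)))} := by
      intro π hπ
      rw [Set.mem_iUnion]
      exact ⟨⟨fun k => ⟨π (slot j k), hπ k⟩, fun k k' h => s.injective (π.injective
        (congrArg Subtype.val h))⟩, fun i => rfl⟩
    calc _ ≤ _ := MeasureTheory.measure_mono hsub
      _ ≤ ∑ t : Fin (b + 1) ↪ S, D.toOuterMeasure {π | ∀ i, π (s i) = (t i : Fin _)} :=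
        (MeasureTheory.measure_iUnion_le _).trans_eq (tsum_fintype _)
      _ = ∑ t : Fin (b + 1) ↪ S, (((ℓ * (b + 1)).descFactorial (b + 1) : ℕ) : ℝ≥0∞)⁻¹ :=
        Finset.sum_congr rfl fun t _ => hD s (t.trans (Function.Embedding.subtype _))
      _ = _ := by simp [Fintype.card_embedding_eq]
  have h2 : D.toOuterMeasure (badPerms S) ≤ ℓ * ((S.card.descFactorial (b + 1) : ℕ) *
      (((ℓ * (b + 1)).descFactorial (b + 1) : ℕ) : ℝ≥0∞)⁻¹) := by
    have : badPerms S = ⋃ j : Fin ℓ, {π | ∀ k : Fin (b + 1), π (slot j k) ∈ S} := by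
      ext π; simp [badPerms]
    rw [this]
    refine (MeasureTheory.measure_iUnion_le _).trans ?_
    rw [tsum_fintype]
    refine (Finset.sum_le_sum fun j _ => h1 j).trans ?_
    simp
  refine h2.trans ?_
  have hs : S.card ≤ ℓ * (b + 1) := by simpa using S.card_le_univ
  have hpos : (ℓ * (b + 1)).descFactorial (b + 1) ≠ 0 := by
    rw [Ne, Nat.descFactorial_eq_zero_iff_lt]; nlinarith
  have hne : (2 * ℓ : ℝ≥0∞) ^ b ≠ 0 := by
    have : (ℓ : ℝ≥0∞) ≠ 0 := by simpa using (by omega : ℓ ≠ 0)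
    exact pow_ne_zero _ (mul_ne_zero (by norm_num) this)
  have hnt : (2 * ℓ : ℝ≥0∞) ^ b ≠ ∞ :=
    ENNReal.pow_ne_top (ENNReal.mul_ne_top (by norm_num) (by simp))
  rw [leakBound, ← mul_assoc, ← div_eq_mul_inv, ← div_eq_mul_inv,
    ENNReal.div_le_iff (by exact_mod_cast hpos) (ENNReal.natCast_ne_top _), ← ENNReal.mul_div_right_comm,
    ENNReal.le_div_iff_mul_le (Or.inl hne) (Or.inl hnt)]
  exact_mod_cast descFactorial_bucket_le hℓ hs

theorem leakBound_ne_top {b ℓ : ℕ} (hℓ : 1 ≤ ℓ) : leakBound b ℓ ≠ ∞ := by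
  have : (ℓ : ℝ≥0∞) ≠ 0 := by simpa using (by omega : ℓ ≠ 0)
  exact ENNReal.inv_ne_top.2 (pow_ne_zero _ (mul_ne_zero (by norm_num) this))

theorem leakBound_toReal (b ℓ : ℕ) :
    (leakBound b ℓ).toReal = (2 * (ℓ : ℝ)) ^ (1 - ((b + 1 : ℕ) : ℤ)) := by
  rw [show (1 - ((b + 1 : ℕ) : ℤ)) = -(b : ℤ) by push_cast; ring, zpow_neg, zpow_natCast]
  simp [leakBound, ENNReal.toReal_inv, ENNReal.toReal_pow, ENNReal.toReal_mul]

theorem uniform_guess_le {n : ℕ} (S : Finset (Fin n)) (v : Fin n → ZMod 2) :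
    (PMF.uniformOfFintype (Fin n → ZMod 2)).toOuterMeasure {x | ∀ i ∈ S, x i = v i} ≤
      (2 ^ S.card)⁻¹ := by
  classical
  have h : {x : Fin n → ZMod 2 | ∀ i ∈ S, x i = v i} =
      (Fintype.piFinset fun i => if i ∈ S then {v i} else Finset.univ : Finset (Fin n → ZMod 2)) := by
    ext x
    simp only [Set.mem_ofPred_eq, Finset.mem_coe, Fintype.mem_piFinset]
    refine forall_congr' fun i => ?_
    by_cases hi : i ∈ S <;> simp [hi]
  have hc : (Fintype.piFinset fun i => if i ∈ S then {v i} else Finset.univ).card * 2 ^ S.card =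
      2 ^ n := by
    rw [Fintype.card_piFinset, Finset.prod_congr rfl (g := fun i => if i ∈ S then 1 else 2)]
    · rw [Finset.prod_ite]
      simp only [Finset.prod_const, one_pow, one_mul]
      rw [← pow_add]
      congr 1
      rw [Finset.filter_not, Finset.card_sdiff_of_subset (Finset.filter_subset _ _)]
      have := S.card_le_univ
      simp at this ⊢
      omega
    · intro i _; by_cases hi : i ∈ S <;> simp [hi, ZMod.card]
  rw [h, PMF.toOuterMeasure_uniformOfFintype_apply]
  simp only [Fintype.card_pi, ZMod.card, Finset.prod_const, Finset.card_univ, Fintype.card_fin,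
    Finset.coe_sort_coe, Fintype.card_coe]
  rw [ENNReal.div_le_iff (by simp) (by simp), mul_comm, ← div_eq_mul_inv,
    ENNReal.le_div_iff_mul_le (Or.inl (by simp)) (Or.inl (by simp))]
  exact_mod_cast hc.le

/-- For a fixed list with set of indices `S`, the bits and the permutation are independent: the
guesses are right with probability at most `2 ^ (-|S|)`, and a bucket lies in `S` with probability
at most `2 ^ |S|` times the claimed bound. The powers of two cancel. -/
theorem leakProb_le {b ℓ : ℕ} {D : PMF (Equiv.Perm (Fin (ℓ * (b + 1))))}
    (G : PMF (List (Fin (ℓ * (b + 1)) × ZMod 2))) (hD : KWiseIndependent (b + 1) D)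
    (hℓ : 1 ≤ ℓ) : leakProb b ℓ D G ≤ (2 * (ℓ : ℝ)) ^ (1 - ((b + 1 : ℕ) : ℤ)) := by
  classical
  rw [← leakBound_toReal]
  refine ENNReal.toReal_mono (leakBound_ne_top hℓ) ?_
  rw [← expect_indicator]
  simp only [expect_bind, expect_pure]
  rw [expect_comm]
  refine (expect_mono G fun L => ?_).trans (expect_const G _).le
  let S : Finset (Fin (ℓ * (b + 1))) := (L.map Prod.fst).toFinset
  -- One guess is selected for every listed index; repeated or contradictory guesses only shrink the
  -- event. The default `0` is never used on `S`.
  let v : Fin (ℓ * (b + 1)) → ZMod 2 := fun i =>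
    if h : ∃ g, (i, g) ∈ L then h.choose else 0
  have hv : ∀ i ∈ S, (i, v i) ∈ L := by
    intro i hi
    have h : ∃ g, (i, g) ∈ L := by simpa [S] using hi
    simpa only [v, dif_pos h] using h.choose_spec
  let X : Set (Fin (ℓ * (b + 1)) → ZMod 2) := {x | ∀ i ∈ S, x i = v i}
  have hle : ∀ x π, Set.indicator {w : (Fin (ℓ * (b + 1)) → ZMod 2) ×
        List (Fin (ℓ * (b + 1)) × ZMod 2) × Equiv.Perm (Fin (ℓ * (b + 1))) |
          (∀ p ∈ w.2.1, w.1 p.1 = p.2) ∧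
          ∃ j : Fin ℓ, ∀ k : Fin (b + 1), ∃ g, (w.2.2 (slot j k), g) ∈ w.2.1} 1 (x, L, π) ≤
      (Set.indicator X 1 x * (badPerms S).indicator 1 π : ℝ≥0∞) := by
    intro x π
    rw [Set.indicator_apply]
    split_ifs with h
    swap
    · exact zero_le
    have h1 : x ∈ X := fun i hi => h.1 _ (hv i hi)
    have h2 : π ∈ badPerms S := by
      obtain ⟨j, hj⟩ := h.2
      exact ⟨j, fun k => by simpa [S] using hj k⟩
    simp [h1, h2]
  refine (expect_mono _ fun x => expect_mono D fun π => hle x π).trans ?_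
  have hmul : ∀ x, (expect D fun π => Set.indicator X 1 x *
      (badPerms S).indicator 1 π) = Set.indicator X 1 x *
        D.toOuterMeasure (badPerms S) := by
    intro x
    rw [← expect_indicator]
    simp only [expect, ← ENNReal.tsum_mul_left]
    exact tsum_congr fun π => by ring
  simp only [hmul]
  have hmul' : (expect (PMF.uniformOfFintype (Fin (ℓ * (b + 1)) → ZMod 2)) fun x =>
      Set.indicator X 1 x * D.toOuterMeasure (badPerms S)) =
      (PMF.uniformOfFintype _).toOuterMeasure X *
        D.toOuterMeasure (badPerms S) := by
    rw [← expect_indicator _ X]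
    simp only [expect, ← ENNReal.tsum_mul_right]
    exact tsum_congr fun π => by ring
  rw [hmul']
  calc _ ≤ (2 ^ S.card)⁻¹ * (2 ^ S.card * leakBound b ℓ) :=
        mul_le_mul' (uniform_guess_le S v) (toOuterMeasure_badPerms_le hD hℓ S)
    _ = leakBound b ℓ := by
        rw [← mul_assoc, ENNReal.inv_mul_cancel (by simp) (by simp), one_mul]

end

section

/-! ### The combination of a bucket in closed form -/

/-- The combination of a bucket in which the bits `d` have been opened. -/
def combineAll {V : Type} [AddCommGroup V] [Module (ZMod 2) V] {m : ℕ} (d : Fin m → ZMod 2)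
    (t : Fin (m + 1) → Triple V) : Triple V :=
  (∑ k, (t k).1, (t 0).2.1, ∑ k, (t k).2.2 + ∑ k : Fin m, d k • (t k.succ).1)

theorem combine_combineAll {V : Type} [AddCommGroup V] [Module (ZMod 2) V] {m : ℕ}
    (d : Fin (m + 1) → ZMod 2) (t : Fin (m + 2) → Triple V) :
    combine (d (Fin.last m)) (combineAll (fun k => d k.castSucc) fun k => t k.castSucc)
      (t (Fin.last (m + 1))) = combineAll d t := by
  simp only [combine, combineAll, Fin.sum_univ_castSucc (n := m + 1), Fin.castSucc_zero,
    Fin.sum_univ_castSucc (n := m) (f := fun k => d k • (t k.succ).1), Fin.succ_castSucc,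
    Fin.succ_last, Prod.mk.injEq, true_and]
  abel

variable {κ : ℕ}

/-- The `y` of the running result always stays that of the first triple, so the `k`-th opened bit
compares `y` of the first triple with `y` of the `k`-th added one, and the recursion unrolls. -/
theorem combineA_eq (m : ℕ) (t : Fin (m + 1) → Triple (Auth κ)) :
    combineA m t = (fun k => (t 0).2.1 + (t k.succ).2.1,
      combineAll (fun k => ((t 0).2.1 + (t k.succ).2.1).1) t) := by
  induction m with
  | zero =>
      refine Prod.ext (funext fun k => k.elim0) ?_
      simp [combineA, combineAll]
  | succ m ih =>
      have h := ih fun k => t k.castSucc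
      simp only [combineA, h]
      refine Prod.ext ?_ ?_
      · funext k
        refine Fin.lastCases ?_ (fun k => ?_) k
        · simp [combineAll]
        · simp
      · rw [← combine_combineAll]
        simp [combineAll]

theorem combineB_eq (Δ : Str κ) (m : ℕ) (t : Fin (m + 1) → Triple (Str κ)) (o : Fin m → Auth κ) :
    combineB Δ m t o =
      if ∀ k, (o k).2 = (t 0).2.1 + (t k.succ).2.1 + (o k).1 • Δ then
        some (combineAll (fun k => (o k).1) t) else none := by
  induction m with
  | zero => simp [combineB, combineAll]
  | succ m ih =>
      rw [combineB, ih]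
      by_cases h : ∀ k : Fin m, (o k.castSucc).2 =
          (t 0).2.1 + (t k.succ.castSucc).2.1 + (o k.castSucc).1 • Δ
      · rw [if_pos (by simpa using h), Option.bind_some]
        simp only [Fin.forall_fin_succ' (n := m), Fin.succ_castSucc, Fin.succ_last]
        rw [← combine_combineAll]
        simp only [eq_true h, true_and]
        rfl
      · rw [if_neg (by simpa using h), if_neg, Option.bind_none]
        intro h'
        exact h fun k => by simpa using h' k.castSucc

/-- The bits and MACs for given bits and keys. -/
def share {n : ℕ} (Δ : Str κ) (x y : Fin n → ZMod 2) (K : Fin n → Triple (Str κ)) :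
    Fin n → Triple (Auth κ) := fun i =>
  (mac Δ (x i) (K i).1, mac Δ (y i) (K i).2.1, mac Δ (x i * y i) (K i).2.2)

variable {b ℓ : ℕ}

/-- The bits that an honest `A` reveals. -/
def openBits (π : Equiv.Perm (Fin (ℓ * (b + 1)))) (y : Fin (ℓ * (b + 1)) → ZMod 2) :
    Fin ℓ → Fin b → ZMod 2 := fun j k => y (π (slot j 0)) + y (π (slot j k.succ))

/-- The keys of the revealed bits. -/
def openKeys (π : Equiv.Perm (Fin (ℓ * (b + 1)))) (K : Fin (ℓ * (b + 1)) → Triple (Str κ)) :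
    Fin ℓ → Fin b → Str κ := fun j k => (K (π (slot j 0))).2.1 + (K (π (slot j k.succ))).2.1

/-- The bits `x` of the results. -/
def bucketX (π : Equiv.Perm (Fin (ℓ * (b + 1)))) (x : Fin (ℓ * (b + 1)) → ZMod 2) :
    Fin ℓ → ZMod 2 := fun j => ∑ k, x (π (slot j k))

/-- The bits `y` of the results. -/
def bucketY (π : Equiv.Perm (Fin (ℓ * (b + 1)))) (y : Fin (ℓ * (b + 1)) → ZMod 2) :
    Fin ℓ → ZMod 2 := fun j => y (π (slot j 0))

/-- The keys of the results, if the bits `d` have been revealed. -/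
def bucketK (π : Equiv.Perm (Fin (ℓ * (b + 1)))) (d : Fin ℓ → Fin b → ZMod 2)
    (K : Fin (ℓ * (b + 1)) → Triple (Str κ)) : Fin ℓ → Triple (Str κ) := fun j =>
  combineAll (d j) fun k => K (π (slot j k))

theorem sum_mac {m : ℕ} (Δ : Str κ) (x : Fin m → ZMod 2) (K : Fin m → Str κ) :
    ∑ k, mac Δ (x k) (K k) = mac Δ (∑ k, x k) (∑ k, K k) := by
  refine Prod.ext ?_ ?_
  · simp [mac, Prod.fst_sum]
  · simp [mac, Prod.snd_sum, Finset.sum_add_distrib, Finset.sum_smul]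

theorem zmod_two_add_self_eq (a c : ZMod 2) : a + (a + c) = c := by
  rw [← add_assoc, CharTwo.add_self_eq_zero, zero_add]

/-- Correctness of the combination: MACs are linear in bits and keys once the opened bits are fixed,
and `xₖ yₖ + (y₀ + yₖ) xₖ = y₀ xₖ` in characteristic two. -/
theorem combineAll_mac {m : ℕ} (Δ : Str κ) (x y : Fin (m + 1) → ZMod 2)
    (K : Fin (m + 1) → Triple (Str κ)) :
    combineAll (fun k => y 0 + y k.succ) (share Δ x y K) =
      (mac Δ (∑ k, x k) (combineAll (fun k => y 0 + y k.succ) K).1, mac Δ (y 0) (K 0).2.1,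
        mac Δ ((∑ k, x k) * y 0) (combineAll (fun k => y 0 + y k.succ) K).2.2) := by
  have hd : ∀ k : Fin m, (y 0 + y k.succ) • mac Δ (x k.succ) (K k.succ).1 =
      mac Δ ((y 0 + y k.succ) * x k.succ) ((y 0 + y k.succ) • (K k.succ).1) := by
    intro k
    simp [mac, smul_smul, smul_add]
  have hadd : ∀ (a c : ZMod 2) (u v : Str κ), mac Δ a u + mac Δ c v = mac Δ (a + c) (u + v) := by
    intro a c u v
    refine Prod.ext rfl ?_
    simp [mac, add_smul]; abel
  simp only [combineAll, share, hd, sum_mac, hadd]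
  congr 3
  rw [Fin.sum_univ_succ, Fin.sum_univ_succ, add_mul, add_assoc, ← Finset.sum_add_distrib,
    Finset.sum_mul]
  congr 1
  refine Finset.sum_congr rfl fun k _ => ?_
  linear_combination (x k.succ * y k.succ) * (CharTwo.two_eq_zero (R := ZMod 2))

theorem protocolA_share (π : Equiv.Perm (Fin (ℓ * (b + 1)))) (Δ : Str κ)
    (x y : Fin (ℓ * (b + 1)) → ZMod 2) (K : Fin (ℓ * (b + 1)) → Triple (Str κ)) :
    protocolA π (share Δ x y K) =
      ((π, fun j k => mac Δ (openBits π y j k) (openKeys π K j k)),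
        share Δ (bucketX π x) (bucketY π y) (bucketK π (openBits π y) K)) := by
  simp only [protocolA, combineA_eq]
  refine Prod.ext (Prod.ext rfl ?_) ?_
  · funext j k
    simp only [share, openBits, openKeys, mac]
    refine Prod.ext rfl ?_
    simp [add_smul]; abel
  · funext j
    exact combineAll_mac Δ (fun k => x (π (slot j k))) (fun k => y (π (slot j k)))
      fun k => K (π (slot j k))

/-- All revealed bits have correct MACs. -/
def checks (Δ : Str κ) (π : Equiv.Perm (Fin (ℓ * (b + 1))))
    (K : Fin (ℓ * (b + 1)) → Triple (Str κ)) (o : Fin ℓ → Fin b → Auth κ) : Prop :=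
  ∀ j k, (o j k).2 = openKeys π K j k + (o j k).1 • Δ

open scoped Classical in
theorem protocolB_some (Δ : Str κ) (K : Fin (ℓ * (b + 1)) → Triple (Str κ))
    (π : Equiv.Perm (Fin (ℓ * (b + 1)))) (o : Fin ℓ → Fin b → Auth κ) :
    protocolB (Δ, K) (some (π, o)) =
      if checks Δ π K o then some (Δ, bucketK π (fun j k => (o j k).1) K) else none := by
  have hs : (∀ j, (combineB Δ b (fun k => K (π (slot j k))) (o j)).isSome = true) ↔
      checks Δ π K o := by
    refine forall_congr' fun j => ?_
    rw [combineB_eq]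
    split_ifs with h
    · simpa [openKeys] using h
    · simpa [openKeys] using h
  simp only [protocolB, Option.bind_some]
  by_cases h : checks Δ π K o
  · rw [dif_pos (hs.2 h), if_pos h]
    congr 2
    funext j
    rw [← Option.some_inj, Option.some_get, combineB_eq]
    exact if_pos (h j)
  · rw [dif_neg (mt hs.1 h), if_neg h]

theorem checks_mac (Δ : Str κ) (π : Equiv.Perm (Fin (ℓ * (b + 1))))
    (y : Fin (ℓ * (b + 1)) → ZMod 2) (K : Fin (ℓ * (b + 1)) → Triple (Str κ)) :
    checks Δ π K fun j k => mac Δ (openBits π y j k) (openKeys π K j k) := fun _ _ => rfl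

end

section

/-! ### A calculus of efficient functions -/

/-- The function `f` has cost at most `(M + 2) ^ k`. -/
def Eff (M k : ℕ) {α β : Type} (f : α → β) : Prop := ∃ c ≤ (M + 2) ^ k, Cost f c

namespace Eff

variable {M j k l : ℕ} {α β γ δ : Type}

/-- The base `M + 2` is at least `2`, so a factor `2 ^ e` costs `e` in the exponent. All constants
of the calculus are absorbed in this way, and exponents simply add up. -/
theorem bound (hjk : j ≤ k) {c : ℕ} (hc : c ≤ (M + 2) ^ j) (e : ℕ) : c * 2 ^ e ≤ (M + 2) ^ (k + e) := by
  rw [pow_add]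
  exact Nat.mul_le_mul (hc.trans (Nat.pow_le_pow_right (by omega) hjk))
    (Nat.pow_le_pow_left (by omega) e)

theorem mono {f : α → β} (h : Eff M j f) (hjk : j ≤ k) : Eff M k f := by
  obtain ⟨c, hc, hf⟩ := h
  exact ⟨c, hc.trans (Nat.pow_le_pow_right (by omega) hjk), hf⟩

theorem one_le (M k : ℕ) : 1 ≤ (M + 2) ^ k := Nat.one_le_pow _ _ (by omega)

theorem var : Eff M 0 (fun a : α => a) := ⟨1, one_le M 0, .id⟩

theorem unit : Eff M 0 (fun _ : α => ()) := ⟨1, one_le M 0, .unit⟩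

theorem bit (x : ZMod 2) : Eff M 0 (fun _ : α => x) := ⟨1, one_le M 0, .bit x⟩

theorem index {m : ℕ} (i : Fin m) : Eff M 0 (fun _ : α => i) := ⟨1, one_le M 0, .index i⟩

theorem comp {f : α → β} {g : β → γ} (hf : Eff M j f) (hg : Eff M k g) :
    Eff M (j + k + 1) (fun a => g (f a)) := by
  obtain ⟨c, hc, hf⟩ := hf
  obtain ⟨d, hd, hg⟩ := hg
  refine ⟨c + d, ?_, hf.comp hg⟩
  have h₁ := bound (Nat.le_add_right j k) hc 1
  have h₂ := bound (Nat.le_add_left k j) hd 1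
  omega

theorem fst {f : α → β × γ} (hf : Eff M k f) : Eff M (k + 1) (fun a => (f a).1) :=
  (hf.comp (k := 0) ⟨1, one_le M 0, .fst⟩).mono (by simp)

theorem snd {f : α → β × γ} (hf : Eff M k f) : Eff M (k + 1) (fun a => (f a).2) :=
  (hf.comp (k := 0) ⟨1, one_le M 0, .snd⟩).mono (by simp)

theorem inl {f : α → β} (hf : Eff M k f) : Eff M (k + 1) (fun a => (Sum.inl (f a) : β ⊕ γ)) :=
  (hf.comp (k := 0) ⟨1, one_le M 0, .inl⟩).mono (by simp)

theorem inr {f : α → γ} (hf : Eff M k f) : Eff M (k + 1) (fun a => (Sum.inr (f a) : β ⊕ γ)) :=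
  (hf.comp (k := 0) ⟨1, one_le M 0, .inr⟩).mono (by simp)

theorem pair {f : α → β} {g : α → γ} (hf : Eff M j f) (hg : Eff M k g) :
    Eff M (j + k + 2) (fun a => (f a, g a)) := by
  obtain ⟨c, hc, hf⟩ := hf
  obtain ⟨d, hd, hg⟩ := hg
  refine ⟨c + d + 1, ?_, hf.pair hg⟩
  have h₁ := bound (Nat.le_add_right j k) hc 2
  have h₂ := bound (Nat.le_add_left k j) hd 2
  have h₃ := bound (Nat.zero_le (j + k)) (one_le M 0) 2
  omega

theorem add {f g : α → ZMod 2} (hf : Eff M j f) (hg : Eff M k g) :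
    Eff M (j + k + 3) (fun a => f a + g a) :=
  ((hf.pair hg).comp (k := 0) ⟨1, one_le M 0, .add⟩).mono (by simp)

theorem mul {f g : α → ZMod 2} (hf : Eff M j f) (hg : Eff M k g) :
    Eff M (j + k + 3) (fun a => f a * g a) :=
  ((hf.pair hg).comp (k := 0) ⟨1, one_le M 0, .mul⟩).mono (by simp)

theorem ite {c : α → ZMod 2} {f g : α → β} (hc : Eff M l c) (hf : Eff M j f) (hg : Eff M k g) :
    Eff M (l + j + k + 5) (fun a => if c a = 1 then f a else g a) :=
  ((hc.pair (hf.pair hg)).comp (k := 0) ⟨1, one_le M 0, .select⟩).mono (by omega)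

theorem elim {s : α → β ⊕ γ} {f : β → α → δ} {g : γ → α → δ} (hs : Eff M l s)
    (hf : Eff M j fun p : β × α => f p.1 p.2) (hg : Eff M k fun p : γ × α => g p.1 p.2) :
    Eff M (l + j + k + 5) (fun a => (s a).elim (fun x => f x a) fun y => g y a) := by
  have h₁ := hs.pair var
  have h₂ : Eff M (j + k + 2) (fun p : (β ⊕ γ) × α =>
      p.1.elim (fun x => f x p.2) fun y => g y p.2) := by
    obtain ⟨c, hc, hf⟩ := hf
    obtain ⟨d, hd, hg⟩ := hg
    refine ⟨c + d + 1, ?_, hf.cases hg⟩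
    have h₁ := bound (Nat.le_add_right j k) hc 2
    have h₂ := bound (Nat.le_add_left k j) hd 2
    have h₃ := bound (Nat.zero_le (j + k)) (one_le M 0) 2
    omega
  exact (h₁.comp h₂).mono (by omega)

theorem vector {m : ℕ} {f : Fin m → α → β} (hm : m ≤ (M + 2) ^ j) (hf : ∀ i, Eff M k (f i)) :
    Eff M (j + k + 1) (fun a i => f i a) := by
  choose c hc hf using hf
  refine ⟨(∑ i, c i) + 1, ?_, .vector hf⟩
  have h₁ : ∑ i, c i ≤ m * (M + 2) ^ k := by
    simpa using Finset.sum_le_card_nsmul Finset.univ c _ fun i _ => hc i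
  have h₂ : m * (M + 2) ^ k ≤ (M + 2) ^ (j + k) := by
    rw [pow_add]; exact Nat.mul_le_mul_right _ hm
  have h₃ := bound (le_refl (j + k)) (h₁.trans h₂) 1
  have h₄ := bound (Nat.zero_le (j + k)) (one_le M 0) 1
  have := bound (le_refl (j + k)) le_rfl (M := M) 1
  omega

theorem lookup {m : ℕ} {v : α → Fin m → β} {i : α → Fin m} (hm : m ≤ (M + 2) ^ l)
    (hv : Eff M j v) (hi : Eff M k i) :
    Eff M (l + j + k + 5) (fun a => v a (i a)) := by
  have h : Eff M (l + 1) (fun p : (Fin m → β) × Fin m => p.1 p.2) := by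
    refine ⟨m + 1, ?_, .lookup⟩
    have := bound (le_refl l) hm 1
    have := bound (Nat.zero_le l) (one_le M 0) 1
    have := bound (le_refl l) le_rfl (M := M) 1
    have := one_le M l
    omega
  exact ((hv.pair hi).comp h).mono (by omega)

theorem perm {m : ℕ} {v : α → Equiv.Perm (Fin m)} {i : α → Fin m} (hm : m ≤ (M + 2) ^ l)
    (hv : Eff M j v) (hi : Eff M k i) :
    Eff M (l + j + k + 5) (fun a => v a (i a)) := by
  have h : Eff M (l + 1) (fun p : Equiv.Perm (Fin m) × Fin m => p.1 p.2) := by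
    refine ⟨m + 1, ?_, .perm⟩
    have := bound (le_refl l) le_rfl (M := M) 1
    have := one_le M l
    omega
  exact ((hv.pair hi).comp h).mono (by omega)

theorem eqIndex {m : ℕ} {f g : α → Fin m} (hm : m ≤ (M + 2) ^ l) (hf : Eff M j f)
    (hg : Eff M k g) :
    Eff M (l + j + k + 5) (fun a => if f a = g a then (1 : ZMod 2) else 0) := by
  have h : Eff M (l + 1) (fun p : Fin m × Fin m => if p.1 = p.2 then (1 : ZMod 2) else 0) := by
    refine ⟨m + 1, ?_, .eqIndex⟩
    have := bound (le_refl l) le_rfl (M := M) 1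
    have := one_le M l
    omega
  exact ((hf.pair hg).comp h).mono (by omega)

/-- Folding a binary operation on bits over an index set. -/
theorem fold (op : ZMod 2 → ZMod 2 → ZMod 2)
    (hop : Cost (fun p : ZMod 2 × ZMod 2 => op p.1 p.2) 1)
    (F : ∀ m : ℕ, (Fin m → ZMod 2) → ZMod 2) (e : ZMod 2) (h₀ : ∀ v, F 0 v = e)
    (hs : ∀ m v, F (m + 1) v = op (v 0) (F m fun i => v i.succ)) {m : ℕ}
    {f : Fin m → α → ZMod 2} (hm : m ≤ (M + 2) ^ j) (hf : ∀ i, Eff M k (f i)) :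
    Eff M (j + k + 3) (fun a => F m fun i => f i a) := by
  -- Each further term costs its own computation, one pairing and one operation.
  have key : ∀ (m : ℕ) (f : Fin m → α → ZMod 2), (∀ i, Eff M k (f i)) →
      ∃ c ≤ m * ((M + 2) ^ k + 2) + 1, Cost (fun a => F m fun i => f i a) c := by
    intro m
    induction m with
    | zero =>
        intro f _
        simp only [h₀]
        exact ⟨1, by simp, .bit e⟩
    | succ m ih =>
        intro f hf
        obtain ⟨c, hc, h⟩ := ih (fun i => f i.succ) fun i => hf _
        obtain ⟨d, hd, h'⟩ := hf 0
        simp only [hs]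
        refine ⟨d + c + 1 + 1, ?_, (h'.pair h).comp hop⟩
        rw [Nat.add_mul]; omega
  obtain ⟨c, hc, h⟩ := key m f hf
  refine ⟨c, hc.trans ?_, h⟩
  have h₁ := one_le M k
  calc m * ((M + 2) ^ k + 2) + 1 ≤ (M + 2) ^ j * ((M + 2) ^ k * 3) + (M + 2) ^ j * (M + 2) ^ k := by
        refine Nat.add_le_add (Nat.mul_le_mul hm (by omega)) ?_
        rw [← pow_add]; exact one_le _ _
    _ = (M + 2) ^ (j + k) * 2 ^ 2 := by rw [pow_add]; ring
    _ ≤ (M + 2) ^ (j + k) * (M + 2) ^ 3 := Nat.mul_le_mul_left _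
        ((Nat.pow_le_pow_right (by norm_num) (by norm_num)).trans
          (Nat.pow_le_pow_left (by omega) 3))
    _ = _ := by rw [← pow_add]

theorem sum {m : ℕ} {f : Fin m → α → ZMod 2} (hm : m ≤ (M + 2) ^ j) (hf : ∀ i, Eff M k (f i)) :
    Eff M (j + k + 3) (fun a => ∑ i, f i a) :=
  fold (· + ·) .add (fun _ v => ∑ i, v i) 0 (fun _ => by simp) (fun _ _ => Fin.sum_univ_succ _)
    hm hf

theorem prod {m : ℕ} {f : Fin m → α → ZMod 2} (hm : m ≤ (M + 2) ^ j) (hf : ∀ i, Eff M k (f i)) :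
    Eff M (j + k + 3) (fun a => ∏ i, f i a) :=
  fold (· * ·) .mul (fun _ v => ∏ i, v i) 1 (fun _ => by simp) (fun _ _ => Fin.prod_univ_succ _)
    hm hf

end Eff

/-! ### Simulators given by their reactions to single messages -/

/-- The reactions of a simulator to the different commands and to the messages of the ideal box,
given its state, its coins and its permutation. -/
structure Reactions (b ℓ κ coins : ℕ) (S : Type) where
  keyQuery : Str κ × S × Str coins × Equiv.Perm (Fin (ℓ * (b + 1))) → S × SimOut b ℓ κ
  chooseA : (Fin (ℓ * (b + 1)) → AChoice κ) × S × Str coins × Equiv.Perm (Fin (ℓ * (b + 1))) →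
    S × SimOut b ℓ κ
  chooseB : BChoice (ℓ * (b + 1)) κ × S × Str coins × Equiv.Perm (Fin (ℓ * (b + 1))) →
    S × SimOut b ℓ κ
  guess : (Fin (ℓ * (b + 1)) × ZMod 2) × S × Str coins × Equiv.Perm (Fin (ℓ * (b + 1))) →
    S × SimOut b ℓ κ
  deliver : Party × S × Str coins × Equiv.Perm (Fin (ℓ * (b + 1))) → S × SimOut b ℓ κ
  abort : Party × S × Str coins × Equiv.Perm (Fin (ℓ * (b + 1))) → S × SimOut b ℓ κ
  send : Msg b ℓ κ × S × Str coins × Equiv.Perm (Fin (ℓ * (b + 1))) → S × SimOut b ℓ κ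
  sendMalformed : Unit × S × Str coins × Equiv.Perm (Fin (ℓ * (b + 1))) → S × SimOut b ℓ κ
  forward : Unit × S × Str coins × Equiv.Perm (Fin (ℓ * (b + 1))) → S × SimOut b ℓ κ
  resp : RespCode × S × Str coins × Equiv.Perm (Fin (ℓ * (b + 1))) → S × SimOut b ℓ κ

variable {b ℓ κ coins : ℕ} {S : Type}

/-- Dispatch on the kind of the message. -/
def Reactions.step (h : Reactions b ℓ κ coins S)
    (a : S × SimIn b ℓ κ × Str coins × Equiv.Perm (Fin (ℓ * (b + 1)))) : S × SimOut b ℓ κ :=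
  a.2.1.elim
    (fun c => c.elim
      (fun c => c.elim (fun c => h.keyQuery (c, a.1, a.2.2))
        fun c => c.elim (fun c => h.chooseA (c, a.1, a.2.2))
          fun c => c.elim (fun c => h.chooseB (c, a.1, a.2.2))
            fun c => c.elim (fun c => h.guess (c, a.1, a.2.2))
              fun c => c.elim (fun c => h.deliver (c, a.1, a.2.2))
                fun c => h.abort (c, a.1, a.2.2))
      fun c => c.elim (fun c => h.send (c, a.1, a.2.2))
        fun c => c.elim (fun c => h.sendMalformed (c, a.1, a.2.2))
          fun c => h.forward (c, a.1, a.2.2))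
    fun c => h.resp (c, a.1, a.2.2)

structure Reactions.Efficient (h : Reactions b ℓ κ coins S) (M k : ℕ) : Prop where
  keyQuery : Eff M k h.keyQuery
  chooseA : Eff M k h.chooseA
  chooseB : Eff M k h.chooseB
  guess : Eff M k h.guess
  deliver : Eff M k h.deliver
  abort : Eff M k h.abort
  send : Eff M k h.send
  sendMalformed : Eff M k h.sendMalformed
  forward : Eff M k h.forward
  resp : Eff M k h.resp

theorem Reactions.Efficient.step {h : Reactions b ℓ κ coins S} {M k : ℕ} (hh : h.Efficient M k) :
    Eff M (10 * k + 400) h.step := by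
  unfold Reactions.step
  -- The exponent is left open: the syntax-directed search below assembles it along with the
  -- program, and the remaining goal compares it with the announced, generous bound.
  apply Eff.mono
  repeat' first
    | with_reducible exact Eff.unit
    | with_reducible exact Eff.var
    | with_reducible apply Eff.elim
    | with_reducible apply Eff.comp (hg := hh.keyQuery)
    | with_reducible apply Eff.comp (hg := hh.chooseA)
    | with_reducible apply Eff.comp (hg := hh.chooseB)
    | with_reducible apply Eff.comp (hg := hh.guess)
    | with_reducible apply Eff.comp (hg := hh.deliver)
    | with_reducible apply Eff.comp (hg := hh.abort)
    | with_reducible apply Eff.comp (hg := hh.send)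
    | with_reducible apply Eff.comp (hg := hh.sendMalformed)
    | with_reducible apply Eff.comp (hg := hh.forward)
    | with_reducible apply Eff.comp (hg := hh.resp)
    | with_reducible apply Eff.fst
    | with_reducible apply Eff.snd
    | with_reducible apply Eff.pair
  omega

end

section

variable {b ℓ κ coins budget : ℕ} {S : Type}

/-! ### Running a simulator -/

/-- The counterpart of `Simulator.run` for a simulator given by its steps. -/
def runStep
    (f : S × SimIn b ℓ κ × Str coins × Equiv.Perm (Fin (ℓ * (b + 1))) → S × SimOut b ℓ κ)
    (D : PMF (Equiv.Perm (Fin (ℓ * (b + 1)))))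
    (corr : Option Party) : ℕ → S × BoxState ℓ κ → SimIn b ℓ κ →
      PMF ((S × BoxState ℓ κ) × EnvResp b ℓ κ)
  | 0, s, _ => PMF.pure (s, ⟨(.ack, none), none, none⟩)
  | q + 1, s, e =>
      (PMF.uniformOfFintype (Str coins)).bind fun r => D.bind fun π =>
        match f (s.1, e, r, π) with
        | (σ, .inr (c, m)) =>
            PMF.pure ((σ, s.2), ⟨(BoxResp.decode c, m.elim (fun _ => none) some), none, none⟩)
        | (σ, .inl c) =>
            let o := boxAdv false corr s.2 (BoxCmd.decode c)
            (runStep f D corr q (σ, o.state) (.inr o.resp.encode)).bind fun w =>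
              PMF.pure (w.1, ⟨w.2.resp, o.outA.orElse fun _ => w.2.outA,
                o.outB.orElse fun _ => w.2.outB⟩)

/-- The continuation of `runStep` after a step of the simulator. -/
def afterStep
    (f : S × SimIn b ℓ κ × Str coins × Equiv.Perm (Fin (ℓ * (b + 1))) → S × SimOut b ℓ κ)
    (D : PMF (Equiv.Perm (Fin (ℓ * (b + 1)))))
    (corr : Option Party) (q : ℕ) (t : BoxState ℓ κ) (w : S × SimOut b ℓ κ) :
    PMF ((S × BoxState ℓ κ) × EnvResp b ℓ κ) :=
  match w with
  | (σ, .inr (c, m)) =>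
      PMF.pure ((σ, t), ⟨(BoxResp.decode c, m.elim (fun _ => none) some), none, none⟩)
  | (σ, .inl c) =>
      let o := boxAdv false corr t (BoxCmd.decode c)
      (runStep f D corr q (σ, o.state) (.inr o.resp.encode)).bind fun w =>
        PMF.pure (w.1, ⟨w.2.resp, o.outA.orElse fun _ => w.2.outA,
          o.outB.orElse fun _ => w.2.outB⟩)

theorem runStep_succ
    (f : S × SimIn b ℓ κ × Str coins × Equiv.Perm (Fin (ℓ * (b + 1))) → S × SimOut b ℓ κ)
    (D : PMF (Equiv.Perm (Fin (ℓ * (b + 1))))) (corr : Option Party) (q : ℕ)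
    (s : S × BoxState ℓ κ) (e : SimIn b ℓ κ) :
    runStep f D corr (q + 1) s e = (PMF.uniformOfFintype (Str coins)).bind fun r => D.bind fun π =>
      afterStep f D corr q s.2 (f (s.1, e, r, π)) := by
  rw [runStep]
  refine congrArg _ (funext fun r => congrArg _ (funext fun π => ?_))
  rcases f (s.1, e, r, π) with ⟨σ, c | ⟨c, m⟩⟩ <;> rfl

/-- Coins and permutation that a step ignores drop out of the distribution. -/
theorem runStep_of_eq
    (f : S × SimIn b ℓ κ × Str coins × Equiv.Perm (Fin (ℓ * (b + 1))) → S × SimOut b ℓ κ)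
    {D : PMF (Equiv.Perm (Fin (ℓ * (b + 1))))} {corr : Option Party} {q : ℕ}
    {s : S × BoxState ℓ κ} {e : SimIn b ℓ κ} {w : S × SimOut b ℓ κ}
    (hw : ∀ r π, f (s.1, e, r, π) = w) :
    runStep f D corr (q + 1) s e = afterStep f D corr q s.2 w := by
  simp only [runStep_succ, hw, PMF.bind_const]

theorem afterStep_report
    (f : S × SimIn b ℓ κ × Str coins × Equiv.Perm (Fin (ℓ * (b + 1))) → S × SimOut b ℓ κ)
    (D : PMF (Equiv.Perm (Fin (ℓ * (b + 1))))) (corr : Option Party) (q : ℕ) (t : BoxState ℓ κ)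
    (σ : S) (c : RespCode) (m : Unit ⊕ Msg b ℓ κ) :
    afterStep f D corr q t (σ, .inr (c, m)) =
      PMF.pure ((σ, t), ⟨(BoxResp.decode c, m.elim (fun _ => none) some), none, none⟩) := rfl

theorem afterStep_command
    (f : S × SimIn b ℓ κ × Str coins × Equiv.Perm (Fin (ℓ * (b + 1))) → S × SimOut b ℓ κ)
    (D : PMF (Equiv.Perm (Fin (ℓ * (b + 1))))) (corr : Option Party) (q : ℕ) (t : BoxState ℓ κ)
    (σ : S) (c : BoxCode ℓ κ) :
    afterStep f D corr q t (σ, .inl c) =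
      (runStep f D corr q (σ, (boxAdv false corr t (BoxCmd.decode c)).state)
        (.inr (boxAdv false corr t (BoxCmd.decode c)).resp.encode)).bind fun w =>
        PMF.pure (w.1, ⟨w.2.resp,
          (boxAdv false corr t (BoxCmd.decode c)).outA.orElse fun _ => w.2.outA,
          (boxAdv false corr t (BoxCmd.decode c)).outB.orElse fun _ => w.2.outB⟩) := rfl

theorem decode_encode (r : BoxResp) : BoxResp.decode r.encode = r := by cases r <;> rfl

/-- The simulator sends a command to the box and reports the answer. -/
theorem afterStep_forward
    {f : S × SimIn b ℓ κ × Str coins × Equiv.Perm (Fin (ℓ * (b + 1))) → S × SimOut b ℓ κ}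
    {D : PMF (Equiv.Perm (Fin (ℓ * (b + 1))))} {corr : Option Party} {q : ℕ} {t t' : BoxState ℓ κ}
    {σ σ' : S} {c : BoxCode ℓ κ} {r : BoxResp} {oA : Option (AOut ℓ κ)} {oB : Option (BOut ℓ κ)}
    {m : Unit ⊕ Msg b ℓ κ}
    (ho : boxAdv false corr t (BoxCmd.decode c) = ⟨t', r, oA, oB⟩) {r' : BoxResp}
    (hw : ∀ u π, f (σ, .inr r.encode, u, π) = (σ', .inr (r'.encode, m))) :
    afterStep f D corr (q + 1) t (σ, .inl c) =
      PMF.pure ((σ', t'), ⟨(r', m.elim (fun _ => none) some), oA, oB⟩) := by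
  rw [afterStep_command, ho, runStep_of_eq f hw, afterStep_report, PMF.pure_bind, decode_encode]
  cases oA <;> cases oB <;> rfl

/-- The simulator sends a command to the box that leads to no output. -/
theorem afterStep_continue
    {f : S × SimIn b ℓ κ × Str coins × Equiv.Perm (Fin (ℓ * (b + 1))) → S × SimOut b ℓ κ}
    {D : PMF (Equiv.Perm (Fin (ℓ * (b + 1))))} {corr : Option Party} {q : ℕ} {t t' : BoxState ℓ κ}
    {σ : S} {c : BoxCode ℓ κ} {r : BoxResp}
    (ho : boxAdv false corr t (BoxCmd.decode c) = ⟨t', r, none, none⟩) {w : S × SimOut b ℓ κ}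
    (hw : ∀ u π, f (σ, .inr r.encode, u, π) = w) :
    afterStep f D corr (q + 1) t (σ, .inl c) = afterStep f D corr q t' w := by
  rw [afterStep_command, ho, runStep_of_eq f hw]
  exact PMF.bind_pure _

theorem runStep_report
    {f : S × SimIn b ℓ κ × Str coins × Equiv.Perm (Fin (ℓ * (b + 1))) → S × SimOut b ℓ κ}
    {D : PMF (Equiv.Perm (Fin (ℓ * (b + 1))))} {corr : Option Party} {q : ℕ} {t : BoxState ℓ κ}
    {σ σ' : S} {e : SimIn b ℓ κ} {r : BoxResp}
    (hw : ∀ u π, f (σ, e, u, π) = (σ', .inr (r.encode, .inl ()))) :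
    runStep f D corr (q + 1) (σ, t) e = PMF.pure ((σ', t), ⟨(r, none), none, none⟩) := by
  rw [runStep_of_eq f hw, afterStep_report, decode_encode]
  rfl

/-- One activation of the ideal world with a simulator given by its steps. -/
def idealStep
    (f : S × SimIn b ℓ κ × Str coins × Equiv.Perm (Fin (ℓ * (b + 1))) → S × SimOut b ℓ κ)
    (D : PMF (Equiv.Perm (Fin (ℓ * (b + 1))))) (corr : Option Party) (s : S × BoxState ℓ κ) :
    EnvCmd b ℓ κ → PMF ((S × BoxState ℓ κ) × EnvResp b ℓ κ)
  | .input p => runStep f D corr 4 (s.1, (boxCall corr p s.2).1) (.inr (boxCall corr p s.2).2.encode)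
  | .adv c => runStep f D corr 4 s (.inl c.encode)

/-- The ideal world with a simulator given by its steps. -/
def stepWorld
    (f : S × SimIn b ℓ κ × Str coins × Equiv.Perm (Fin (ℓ * (b + 1))) → S × SimOut b ℓ κ)
    (start : S)
    (D : PMF (Equiv.Perm (Fin (ℓ * (b + 1))))) (corr : Option Party) :
    System (EnvCmd b ℓ κ) (EnvResp b ℓ κ) where
  State := S × BoxState ℓ κ
  start := (boxStart ℓ κ).map fun s => (start, s)
  step := idealStep f D corr

/-- A simulator whose reactions are efficient. -/
def Reactions.simulator (h : Reactions b ℓ κ coins S) (start : S) {k : ℕ} (hℓ : 1 ≤ ℓ)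
    (hh : h.Efficient (b + ℓ + κ) k) (hstart : Eff (b + ℓ + κ) k fun _ : Unit => start)
    (hcoins : coins ≤ (b + ℓ + κ + 2) ^ k) {c : ℕ} (hc : 2 * (10 * k + 400) ≤ c) :
    Simulator b ℓ κ ((b + 1 + ℓ + κ) ^ c) :=
  have hle : ∀ j ≤ 10 * k + 400, (b + ℓ + κ + 2) ^ j ≤ (b + 1 + ℓ + κ) ^ c := fun j hj =>
    -- The calculus has base `M + 2` with `M = b + ℓ + κ`, the budget has base `M + 1`. Since `ℓ ≥
    -- 1`, this base is at least `2` and its square is at least `M + 2`; hence the factor `2` in the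
    -- exponent `c`.
    calc (b + ℓ + κ + 2) ^ j ≤ ((b + 1 + ℓ + κ) ^ 2) ^ j := Nat.pow_le_pow_left (by nlinarith) j
      _ = (b + 1 + ℓ + κ) ^ (2 * j) := by rw [pow_mul]
      _ ≤ _ := Nat.pow_le_pow_right (by omega) (by omega)
  { State := S
    start := start
    coins := coins
    -- The longest exchange is that for a corrupted `A`: key query, choice, delivery, report.
    steps := 4
    step := h.step
    coins_le := hcoins.trans (hle k (by omega))
    steps_le := le_trans (by
        calc 4 = 2 ^ 2 := by norm_num
          _ ≤ (b + ℓ + κ + 2) ^ 2 := Nat.pow_le_pow_left (by omega) 2) (hle 2 (by omega))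
    start_cost := by
      obtain ⟨d, hd, h⟩ := hstart
      exact ⟨d, hd.trans (hle k (by omega)), h⟩
    step_cost := by
      obtain ⟨d, hd, h⟩ := hh.step
      exact ⟨d, hd.trans (hle _ le_rfl), h⟩ }

theorem Simulator.run_eq (S : Simulator b ℓ κ budget) (D : PMF (Equiv.Perm (Fin (ℓ * (b + 1)))))
    (corr : Option Party) (q : ℕ) (s : S.State × BoxState ℓ κ) (e : SimIn b ℓ κ) :
    S.run D corr q s e = runStep S.step D corr q s e := by
  induction q generalizing s e with
  | zero => rfl
  | succ q ih =>
      rw [runStep_succ, Simulator.run]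
      refine congrArg _ (funext fun r => congrArg _ (funext fun π => ?_))
      rcases S.step (s.1, e, r, π) with ⟨σ, c | ⟨c, m⟩⟩
      · simp only [afterStep, ih]
      · rfl

/-- This separates security from efficiency: the couplings below deal with a bare step function and
carry no cost proofs. -/
theorem idealWorld_eq (S : Simulator b ℓ κ budget) (hS : S.steps = 4)
    (D : PMF (Equiv.Perm (Fin (ℓ * (b + 1))))) (corr : Option Party) :
    idealWorld S D corr = stepWorld S.step S.start D corr := by
  unfold idealWorld stepWorld idealStep
  congr 1
  funext s i
  cases i with
  | input p => rw [hS]; exact S.run_eq ..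
  | adv c => rw [hS]; exact S.run_eq ..

theorem idealWorld_simulator (h : Reactions b ℓ κ coins S) (start : S) {k : ℕ} (hℓ : 1 ≤ ℓ)
    (hh : h.Efficient (b + ℓ + κ) k) (hstart : Eff (b + ℓ + κ) k fun _ : Unit => start)
    (hcoins : coins ≤ (b + ℓ + κ + 2) ^ k) {c : ℕ} (hc : 2 * (10 * k + 400) ≤ c)
    (D : PMF (Equiv.Perm (Fin (ℓ * (b + 1))))) (corr : Option Party) :
    idealWorld (h.simulator start hℓ hh hstart hcoins hc) D corr =
      stepWorld h.step start D corr := idealWorld_eq _ rfl D corr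

theorem Lift.of_eq_pure {S₁ S₂ O : Type} {R : PMF S₁ → PMF S₂ → ℝ≥0∞ → Prop} {p : PMF (S₁ × O)}
    {q : PMF (S₂ × O)} {s₁ : S₁} {s₂ : S₂} {o : O} {ε : ℝ≥0∞} (hp : p = PMF.pure (s₁, o))
    (hq : q = PMF.pure (s₂, o)) (h : R (PMF.pure s₁) (PMF.pure s₂) ε) : Lift R p q ε := by
  subst hp hq
  exact Lift.of_pure h o

theorem boxStart_eq (n κ : ℕ) : boxStart n κ = (PMF.uniformOfFintype (Str κ)).bind fun Δ =>
    (PMF.uniformOfFintype ((Fin n → ZMod 2) × (Fin n → ZMod 2) × (Fin n → Triple (Str κ)))).map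
      fun r => ⟨Δ, r.1, r.2.1, r.2.2, fun _ => false, false, fun _ => false⟩ := by
  rw [boxStart, uniform_prod, PMF.map_bind]
  simp only [PMF.map_comp]
  rfl

/-! ### Single activations of the two worlds -/

section Hybrid

variable {D : PMF (Equiv.Perm (Fin (ℓ * (b + 1))))} {corr : Option Party} {s : HybridState b ℓ κ}
  {c : BoxCmd (ℓ * (b + 1)) κ} {t : BoxState (ℓ * (b + 1)) κ} {r : BoxResp}

theorem hybridStep_input {p : Party} (h : boxCall corr p s.box = (t, r)) :
    hybridStep D corr s (.input p) = PMF.pure ({ s with box := t }, ⟨(r, none), none, none⟩) := by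
  simp only [hybridStep, h]

theorem idealStep_input
    {f : S × SimIn b ℓ κ × Str coins × Equiv.Perm (Fin (ℓ * (b + 1))) → S × SimOut b ℓ κ}
    {σ : S} {t t' : BoxState ℓ κ} {p : Party} (h : boxCall corr p t = (t', r)) :
    idealStep f D corr (σ, t) (.input p) = runStep f D corr 4 (σ, t') (.inr r.encode) := by
  simp only [idealStep, h]

theorem idealStep_adv
    {f : S × SimIn b ℓ κ × Str coins × Equiv.Perm (Fin (ℓ * (b + 1))) → S × SimOut b ℓ κ}
    {σ : S} {t : BoxState ℓ κ} {c : AdvCmd b ℓ κ} :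
    idealStep f D corr (σ, t) (.adv c) =
      runStep f D corr 4 (σ, t) (.inl c.encode) := rfl

theorem boxCall_of_not {n : ℕ} {p : Party} {t : BoxState n κ}
    (h : ¬ (corr ≠ some p ∧ t.started p = false)) : boxCall corr p t = (t, .ack) := if_neg h

theorem boxCall_of {n : ℕ} {p : Party} {t : BoxState n κ}
    (h : corr ≠ some p ∧ t.started p = false) : boxCall corr p t =
      ({ t with started := Function.update t.started p true }, .started p) := if_pos h

theorem hybridStep_quiet (h : boxAdv true corr s.box c = ⟨t, r, none, none⟩) :
    hybridStep D corr s (.adv (.box c)) =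
      PMF.pure ({ s with box := t }, ⟨(r, none), none, none⟩) := by
  simp only [hybridStep, h]

theorem hybridStep_ack (h : boxAdv true corr s.box c = ⟨s.box, r, none, none⟩) :
    hybridStep D corr s (.adv (.box c)) = PMF.pure (s, ⟨(r, none), none, none⟩) :=
  hybridStep_quiet h

theorem hybridStep_failA (h : boxAdv true corr s.box c = ⟨t, r, some none, none⟩) :
    hybridStep D corr s (.adv (.box c)) =
      PMF.pure ({ s with box := t }, ⟨(r, none), some none, none⟩) := by
  simp only [hybridStep, h]

theorem hybridStep_failB (h : boxAdv true corr s.box c = ⟨t, r, none, some none⟩) :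
    hybridStep D corr s (.adv (.box c)) =
      PMF.pure ({ s with box := t }, ⟨(r, none), none, some none⟩) := by
  simp only [hybridStep, h]

theorem hybridStep_keysB {v : BChoice (ℓ * (b + 1)) κ}
    (h : boxAdv true corr s.box c = ⟨t, r, none, some (some v)⟩) :
    hybridStep D corr s (.adv (.box c)) = PMF.pure ({ s with box := t, keysB := some v },
      ⟨(r, none), none, s.inboxB.map fun m => protocolB v m⟩) := by
  simp only [hybridStep, h]

theorem hybridStep_shareA {v : Fin (ℓ * (b + 1)) → Triple (Auth κ)}
    (h : boxAdv true corr s.box c = ⟨t, r, some (some v), none⟩) :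
    hybridStep D corr s (.adv (.box c)) = D.bind fun π =>
      PMF.pure ({ s with box := t, transit := some (protocolA π v).1 },
        ⟨(r, some (protocolA π v).1), some (some (protocolA π v).2), none⟩) := by
  simp only [hybridStep, h]

end Hybrid

/-- A Boolean as a bit. -/
def toBit (c : Bool) : ZMod 2 := if c then 1 else 0

@[simp] theorem toBit_true : toBit true = 1 := rfl
@[simp] theorem toBit_false : toBit false = 0 := rfl

/-- The report of a simulator that has nothing to report. -/
def ack : SimOut b ℓ κ := .inr (.inl (), .inl ())

namespace Eff

variable {M : ℕ} {α : Type}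

theorem ack : Eff M 10 (fun _ : α => (BucketAND.ack : SimOut b ℓ κ)) :=
  (Eff.inr (.pair (.inl .unit) (.inl .unit))).mono (by norm_num)

/-- Whether a party is `B`. -/
theorem isB {j : ℕ} {f : α → Party} (hf : Eff M j f) :
    Eff M (j + 10) (fun a => if f a = Party.B then (1 : ZMod 2) else 0) :=
  (Eff.eqIndex (l := 1) (by norm_num) hf (.index 1)).mono (by omega)

/-- Whether a party is `A`. -/
theorem isA {j : ℕ} {f : α → Party} (hf : Eff M j f) :
    Eff M (j + 10) (fun a => if f a = Party.A then (1 : ZMod 2) else 0) :=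
  (Eff.eqIndex (l := 1) (by norm_num) hf (.index 0)).mono (by omega)

end Eff

end

section

variable {b ℓ κ : ℕ}

/-! ### The simulator for a corrupted `A` -/

/-- The choice of a corrupted `A` at the leaky box, and her message. -/
abbrev ViewA (b ℓ κ : ℕ) := (Fin (ℓ * (b + 1)) → AChoice κ) × Msg b ℓ κ

/-- The choice for the `k`-th triple of the `j`-th bucket. -/
def ViewA.at (q : ViewA b ℓ κ) (j : Fin ℓ) (k : Fin (b + 1)) : AChoice κ := q.1 (q.2.1 (slot j k))

/-- Whether a revealed bit is false. -/
def ViewA.flag (q : ViewA b ℓ κ) (j : Fin ℓ) (k : Fin b) : ZMod 2 :=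
  (q.at j 0).2.1 + (q.at j k.succ).2.1 + (q.2.2 j k).1

/-- The difference of the MAC of a revealed bit from the MAC of the true bit. -/
def ViewA.diff (q : ViewA b ℓ κ) (j : Fin ℓ) (k : Fin b) (i : Fin κ) : ZMod 2 :=
  (q.at j 0).2.2.2.1 i + (q.at j k.succ).2.2.2.1 i + (q.2.2 j k).2 i

/-- The global key if some revealed bit is false and all checks are passed. -/
def ViewA.candidate (q : ViewA b ℓ κ) : Str κ := fun i =>
  -- Over `ZMod 2`, `1 + ∏ (1 + a)` is the disjunction of the `a`: the coordinate is `1` if some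
  -- false bit has a MAC difference with this coordinate equal to `1`.
  1 + ∏ j, ∏ k, (1 + q.flag j k * q.diff j k i)

/-- Whether all checks are passed if the global key is the candidate. -/
def ViewA.pass (q : ViewA b ℓ κ) : ZMod 2 :=
  ∏ j, ∏ k, ∏ i, (1 + (q.diff j k i + q.flag j k * q.candidate i))

/-- Whether all revealed bits are true. -/
def ViewA.honest (q : ViewA b ℓ κ) : ZMod 2 := ∏ j, ∏ k, (1 + q.flag j k)

/-- The error of the bit `z` of the `j`-th result. -/
def ViewA.error (q : ViewA b ℓ κ) (j : Fin ℓ) : ZMod 2 :=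
  ∑ k, (q.at j k).1 * (q.at j k).2.1 + ∑ k : Fin b, (q.2.2 j k).1 * (q.at j k.succ).1 +
    (∑ k, (q.at j k).1) * (q.at j 0).2.1

/-- The choice at the ideal box. -/
def ViewA.values (q : ViewA b ℓ κ) : Fin ℓ → AChoice κ := fun j =>
  (∑ k, (q.at j k).1, (q.at j 0).2.1, fun i => ∑ k, (q.at j k).2.2.1 i, (q.at j 0).2.2.2.1,
    -- The ideal box authenticates the product `X Y`, whereas the protocol yields a bit that differs
    -- from it by the error. The last term moves the MAC accordingly; a nonzero error forces a false
    -- opened bit, and if the checks pass the candidate is then `Δ`.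
    fun i => ∑ k, (q.at j k).2.2.2.2 i + ∑ k : Fin b, (q.2.2 j k).1 * (q.at j k.succ).2.2.1 i +
      q.error j * q.candidate i)

/-- The state of the simulator: the choice of `A` at the leaky box, whether `B` has called it,
whether it has served `B`, whether it has given him keys, the message to `B`, and whether the
simulator waits for an answer of the ideal box. -/
abbrev SimA (b ℓ κ : ℕ) := (Unit ⊕ (Fin (ℓ * (b + 1)) → AChoice κ)) × ZMod 2 × ZMod 2 × ZMod 2 ×
  (Unit ⊕ (Unit ⊕ Msg b ℓ κ)) × (Unit ⊕ (ViewA b ℓ κ ⊕ Unit))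

/-- `B` finishes the protocol. -/
def SimA.finish (a : (Fin (ℓ * (b + 1)) → AChoice κ) × SimA b ℓ κ × (Unit ⊕ Msg b ℓ κ)) :
    SimA b ℓ κ × SimOut b ℓ κ :=
  a.2.2.elim
    (fun _ => (a.2.1, .inl (.inr (.inr (.inr (.inr (.inr Party.B)))))))
    fun m => ((a.2.1.1, a.2.1.2.1, a.2.1.2.2.1, a.2.1.2.2.2.1, a.2.1.2.2.2.2.1,
      .inr (.inl (a.1, m))), .inl (.inl (ViewA.candidate (a.1, m))))

/-- `B` receives a message. -/
def SimA.receive (a : (Unit ⊕ Msg b ℓ κ) × SimA b ℓ κ) : SimA b ℓ κ × SimOut b ℓ κ :=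
  a.2.2.2.2.2.1.elim
    (fun _ => if a.2.2.2.2.1 = 1 then
        a.2.1.elim (fun _ => (a.2, ack)) fun v => SimA.finish (v, (a.2.1, a.2.2.1, a.2.2.2.1,
          a.2.2.2.2.1, .inr a.1, a.2.2.2.2.2.2), a.1)
      else ((a.2.1, a.2.2.1, a.2.2.2.1, a.2.2.2.2.1, .inr a.1, a.2.2.2.2.2.2), ack))
    fun _ => (a.2, ack)

/-- The reactions of the simulator. -/
def reactionsA (b ℓ κ : ℕ) : Reactions b ℓ κ 0 (SimA b ℓ κ) where
  keyQuery g := (g.2.1, .inl (.inl g.1))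
  chooseA g := (g.2.1.1.elim (fun _ => (.inr g.1, g.2.1.2)) (fun _ => g.2.1), ack)
  chooseB g := (g.2.1, ack)
  guess g := (g.2.1, ack)
  deliver g :=
    if (if g.1 = Party.B then (1 : ZMod 2) else 0) * g.2.1.2.1 * (1 + g.2.1.2.2.1) = 1 then
      g.2.1.1.elim (fun _ => (g.2.1, ack)) fun v => g.2.1.2.2.2.2.1.elim
        (fun _ => ((g.2.1.1, g.2.1.2.1, 1, 1, g.2.1.2.2.2.2.1, g.2.1.2.2.2.2.2), ack))
        fun m => SimA.finish
          (v, (g.2.1.1, g.2.1.2.1, 1, 1, g.2.1.2.2.2.2.1, g.2.1.2.2.2.2.2), m)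
    else (g.2.1, ack)
  abort g :=
    if (if g.1 = Party.B then (1 : ZMod 2) else 0) * g.2.1.2.1 * (1 + g.2.1.2.2.1) = 1 then
      ((g.2.1.1, g.2.1.2.1, 1, g.2.1.2.2.2), .inl (.inr (.inr (.inr (.inr (.inr Party.B))))))
    else (g.2.1, ack)
  send g := SimA.receive (.inr g.1, g.2.1)
  sendMalformed g := SimA.receive (.inl (), g.2.1)
  forward g := (g.2.1, ack)
  resp g := g.2.1.2.2.2.2.2.elim
    (fun _ => (g.1.elim (fun _ => g.2.1) fun c => c.elim (fun _ => (g.2.1.1, 1, g.2.1.2.2))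
      fun _ => g.2.1, .inr (g.1, .inl ())))
    fun w => w.elim
      (fun q =>
        -- This arithmetic guard reads: all checks pass under the candidate, and either no opened
        -- bit is false or the key query has confirmed the candidate.
        if q.pass * (1 + (1 + q.honest) *
            (1 + g.1.elim (fun _ => (0 : ZMod 2)) fun c => c.elim (fun _ => 0) fun x => x)) = 1 then
          ((g.2.1.1, g.2.1.2.1, g.2.1.2.2.1, g.2.1.2.2.2.1, g.2.1.2.2.2.2.1, .inr (.inr ())),
            .inl (.inr (.inl q.values)))
        else ((g.2.1.1, g.2.1.2.1, g.2.1.2.2.1, g.2.1.2.2.2.1, g.2.1.2.2.2.2.1, .inl ()),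
          .inl (.inr (.inr (.inr (.inr (.inr Party.B)))))))
      fun _ => ((g.2.1.1, g.2.1.2.1, g.2.1.2.2.1, g.2.1.2.2.2.1, g.2.1.2.2.2.2.1, .inl ()),
        .inl (.inr (.inr (.inr (.inr (.inl Party.B))))))

/-! ### Cost of the simulator for a corrupted `A` -/

section Efficiency

variable {M : ℕ} (hn : ℓ * (b + 1) ≤ (M + 2) ^ 2) (hℓ : ℓ ≤ (M + 2) ^ 1) (hb : b ≤ (M + 2) ^ 1)
  (hb' : b + 1 ≤ (M + 2) ^ 1) (hκ : κ ≤ (M + 2) ^ 1)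

include hn in
theorem ViewA.eff_at (j : Fin ℓ) (k : Fin (b + 1)) :
    Eff M 20 fun q : ViewA b ℓ κ => q.at j k := by
  unfold ViewA.at
  exact (Eff.lookup hn (.fst .var) (.perm hn (.fst (.snd .var)) (.index _))).mono (by norm_num)

include hℓ hb in
theorem ViewA.eff_opened (j : Fin ℓ) (k : Fin b) :
    Eff M 20 fun q : ViewA b ℓ κ => q.2.2 j k :=
  (Eff.lookup hb (.lookup hℓ (.snd (.snd .var)) (.index _)) (.index _)).mono (by norm_num)

include hn hℓ hb in
theorem ViewA.eff_flag (j : Fin ℓ) (k : Fin b) :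
    Eff M 100 fun q : ViewA b ℓ κ => q.flag j k := by
  have h := ViewA.eff_at (κ := κ) hn
  have h' := ViewA.eff_opened (κ := κ) hℓ hb
  exact (Eff.add (.add (.fst (.snd (h j 0))) (.fst (.snd (h j k.succ)))) (.fst (h' j k))).mono
    (by norm_num)

include hn hℓ hb hκ in
theorem ViewA.eff_diff (j : Fin ℓ) (k : Fin b) (i : Fin κ) :
    Eff M 100 fun q : ViewA b ℓ κ => q.diff j k i := by
  have h := fun k => (Eff.lookup hκ (.fst (.snd (.snd (.snd (ViewA.eff_at (κ := κ) hn j k)))))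
    (.index i))
  have h' := (Eff.lookup hκ (.snd (ViewA.eff_opened (κ := κ) hℓ hb j k)) (.index i))
  exact (Eff.add (.add (h 0) (h k.succ)) h').mono (by norm_num)

include hn hℓ hb hκ in
theorem ViewA.eff_candidate : Eff M 300 fun q : ViewA b ℓ κ => q.candidate :=
  (Eff.vector hκ fun i => .add (.bit 1) (.prod hℓ fun j => .prod hb fun k => .add (.bit 1)
    (.mul (ViewA.eff_flag hn hℓ hb j k) (ViewA.eff_diff hn hℓ hb hκ j k i)))).mono (by norm_num)

include hn hℓ hb hκ in
theorem ViewA.eff_pass : Eff M 1000 fun q : ViewA b ℓ κ => q.pass :=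
  (Eff.prod hℓ fun j => .prod hb fun k => .prod hκ fun i => .add (.bit 1)
    (.add (ViewA.eff_diff hn hℓ hb hκ j k i) (.mul (ViewA.eff_flag hn hℓ hb j k)
      (.lookup hκ (ViewA.eff_candidate hn hℓ hb hκ) (.index i))))).mono (by norm_num)

include hn hℓ hb in
theorem ViewA.eff_honest : Eff M 1000 fun q : ViewA b ℓ κ => q.honest :=
  (Eff.prod hℓ fun j => .prod hb fun k => .add (.bit 1) (ViewA.eff_flag hn hℓ hb j k)).mono
    (by norm_num)

include hn hℓ hb hb' in
theorem ViewA.eff_error (j : Fin ℓ) : Eff M 500 fun q : ViewA b ℓ κ => q.error j := by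
  have h := ViewA.eff_at (κ := κ) hn j
  have h' := ViewA.eff_opened (κ := κ) hℓ hb j
  exact (Eff.add (.add (.sum hb' fun k => .mul (.fst (h k)) (.fst (.snd (h k))))
    (.sum hb fun k => .mul (.fst (h' k)) (.fst (h k.succ))))
    (.mul (.sum hb' fun k => .fst (h k)) (.fst (.snd (h 0))))).mono (by norm_num)

include hn hℓ hb hb' hκ in
theorem ViewA.eff_values : Eff M 2000 fun q : ViewA b ℓ κ => q.values := by
  have h := ViewA.eff_at (κ := κ) hn
  have h' := ViewA.eff_opened (κ := κ) hℓ hb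
  exact (Eff.vector hℓ fun j => .pair (.sum hb' fun k => .fst (h j k)) (.pair (.fst (.snd (h j 0)))
    (.pair (.vector hκ fun i => .sum hb' fun k => .lookup hκ (.fst (.snd (.snd (h j k))))
      (.index i)) (.pair (.fst (.snd (.snd (.snd (h j 0))))) (.vector hκ fun i => .add
        (.add (.sum hb' fun k => .lookup hκ (.snd (.snd (.snd (.snd (h j k))))) (.index i))
          (.sum hb fun k => .mul (.fst (h' j k)) (.lookup hκ (.fst (.snd (.snd (h j k.succ))))
            (.index i))))
        (.mul (ViewA.eff_error hn hℓ hb hb' j)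
          (.lookup hκ (ViewA.eff_candidate hn hℓ hb hκ) (.index i)))))))).mono (by norm_num)

include hn hℓ hb hκ in
theorem SimA.eff_finish : Eff M 1000 (SimA.finish (b := b) (ℓ := ℓ) (κ := κ)) := by
  have hc := ViewA.eff_candidate (κ := κ) hn hℓ hb hκ
  unfold SimA.finish
  apply Eff.mono
  repeat' first
    | with_reducible exact Eff.unit
    | with_reducible exact Eff.var
    | with_reducible exact Eff.index _
    | with_reducible apply Eff.elim
    | with_reducible apply Eff.comp (hg := hc)
    | with_reducible apply Eff.fst
    | with_reducible apply Eff.snd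
    | with_reducible apply Eff.inl
    | with_reducible apply Eff.inr
    | with_reducible apply Eff.pair
  norm_num

include hn hℓ hb hκ in
theorem SimA.eff_receive : Eff M 2000 (SimA.receive (b := b) (ℓ := ℓ) (κ := κ)) := by
  have hc := SimA.eff_finish (κ := κ) hn hℓ hb hκ
  unfold SimA.receive
  apply Eff.mono
  repeat' first
    | with_reducible exact Eff.unit
    | with_reducible exact Eff.var
    | with_reducible exact Eff.bit _
    | with_reducible exact Eff.ack
    | with_reducible apply Eff.elim
    | with_reducible apply Eff.ite
    | with_reducible apply Eff.comp (hg := hc)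
    | with_reducible apply Eff.fst
    | with_reducible apply Eff.snd
    | with_reducible apply Eff.inl
    | with_reducible apply Eff.inr
    | with_reducible apply Eff.pair
  norm_num

include hn hℓ hb hb' hκ in
theorem reactionsA_efficient : (reactionsA b ℓ κ).Efficient M 6000 := by
  have h₁ := SimA.eff_finish (κ := κ) hn hℓ hb hκ
  have h₂ := SimA.eff_receive (κ := κ) hn hℓ hb hκ
  have h₃ := ViewA.eff_pass (κ := κ) hn hℓ hb hκ
  have h₄ := ViewA.eff_honest (κ := κ) hn hℓ hb
  have h₅ := ViewA.eff_values (κ := κ) hn hℓ hb hb' hκ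
  constructor <;> unfold reactionsA <;> dsimp only <;> apply Eff.mono
  all_goals repeat' first
    | with_reducible exact Eff.unit
    | with_reducible exact Eff.var
    | with_reducible exact Eff.index _
    | with_reducible exact Eff.bit _
    | with_reducible exact Eff.ack
    | with_reducible apply Eff.elim
    | with_reducible apply Eff.isB
    | with_reducible apply Eff.ite
    | with_reducible apply Eff.add
    | with_reducible apply Eff.mul
    | with_reducible apply Eff.comp (hg := h₁)
    | with_reducible apply Eff.comp (hg := h₂)
    | with_reducible apply Eff.comp (hg := h₃)
    | with_reducible apply Eff.comp (hg := h₄)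
    | with_reducible apply Eff.comp (hg := h₅)
    | with_reducible apply Eff.fst
    | with_reducible apply Eff.snd
    | with_reducible apply Eff.inl
    | with_reducible apply Eff.inr
    | with_reducible apply Eff.pair
  all_goals norm_num

end Efficiency

end

section

variable {b ℓ κ : ℕ}

/-! ### Security against a corrupted `A` -/

theorem zmod_two_mul_eq_one (a c : ZMod 2) : a * c = 1 ↔ a = 1 ∧ c = 1 := by
  revert a c; decide

theorem zmod_two_one_add_eq_one (a : ZMod 2) : 1 + a = 1 ↔ a = 0 := by
  revert a; decide

theorem zmod_two_ne_one (a : ZMod 2) : a ≠ 1 ↔ a = 0 := by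
  revert a; decide

theorem zmod_two_prod_eq_one {m : ℕ} (f : Fin m → ZMod 2) : ∏ i, f i = 1 ↔ ∀ i, f i = 1 := by
  induction m with
  | zero => simp
  | succ m ih => rw [Fin.prod_univ_succ, zmod_two_mul_eq_one, ih, Fin.forall_fin_succ]

theorem zmod_two_prod_eq_zero {m : ℕ} (f : Fin m → ZMod 2) : ∏ i, f i = 0 ↔ ∃ i, f i = 0 := by
  rw [← zmod_two_ne_one, Ne, zmod_two_prod_eq_one, not_forall]
  simp only [zmod_two_ne_one, ← ne_eq]

theorem zmod_two_add_eq_zero (a c : ZMod 2) : a + c = 0 ↔ a = c := by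
  revert a c; decide

/-- The keys that belong to the choice of a corrupted `A`. -/
def keysOf {n : ℕ} (Δ : Str κ) (v : Fin n → AChoice κ) : Fin n → Triple (Str κ) := fun i =>
  ((v i).2.2.1 + (v i).1 • Δ, (v i).2.2.2.1 + (v i).2.1 • Δ,
    (v i).2.2.2.2 + ((v i).1 * (v i).2.1) • Δ)

/-- The keys are the chosen MACs shifted by multiples of `Δ`, so the MAC equation turns into `diff =
flag · Δ`: a true bit needs its true MAC, and a false one needs a MAC that is off by `Δ`. -/
theorem checks_keysOf (Δ : Str κ) (q : ViewA b ℓ κ) :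
    checks Δ q.2.1 (keysOf Δ q.1) q.2.2 ↔ ∀ j k i, q.diff j k i = q.flag j k * Δ i := by
  refine forall_congr' fun j => forall_congr' fun k => ?_
  rw [funext_iff]
  refine forall_congr' fun i => ?_
  simp only [openKeys, keysOf, ViewA.diff, ViewA.flag, ViewA.at, Pi.add_apply, Pi.smul_apply,
    smul_eq_mul]
  generalize (q.2.2 j k).2 i = a, (q.2.2 j k).1 = c, Δ i = d
  generalize q.1 (q.2.1 (slot j 0)) = u, q.1 (q.2.1 (slot j k.succ)) = u'
  generalize u.2.2.2.1 i = m, u'.2.2.2.1 i = m', u.2.1 = y, u'.2.1 = y'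
  revert a c d m m' y y'
  decide

theorem ViewA.honest_eq_one (q : ViewA b ℓ κ) : q.honest = 1 ↔ ∀ j k, q.flag j k = 0 := by
  simp only [ViewA.honest, zmod_two_prod_eq_one, zmod_two_one_add_eq_one]

theorem ViewA.pass_eq_one (q : ViewA b ℓ κ) :
    q.pass = 1 ↔ ∀ j k i, q.diff j k i = q.flag j k * q.candidate i := by
  simp only [ViewA.pass, zmod_two_prod_eq_one, zmod_two_one_add_eq_one, zmod_two_add_eq_zero]

/-- True bits contribute nothing to the disjunction and every false bit contributes `Δ i`; with at
least one false bit the disjunction is `Δ i`. -/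
theorem ViewA.candidate_eq {Δ : Str κ} {q : ViewA b ℓ κ}
    (h : ∀ j k i, q.diff j k i = q.flag j k * Δ i) {j : Fin ℓ} {k : Fin b}
    (hjk : q.flag j k ≠ 0) : q.candidate = Δ := by
  have hjk : q.flag j k = 1 := by
    generalize q.flag j k = a at hjk
    revert a; decide
  funext i
  have h₀ : ∏ j, ∏ k, (1 + q.flag j k * q.diff j k i) = 1 + Δ i := by
    by_cases hi : Δ i = 0
    · rw [hi, add_zero, zmod_two_prod_eq_one]
      intro j
      rw [zmod_two_prod_eq_one]
      intro k
      simp [h, hi]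
    · have hi : Δ i = 1 := by
        generalize Δ i = a at hi
        revert a; decide
      rw [hi, show (1 + 1 : ZMod 2) = 0 from rfl, zmod_two_prod_eq_zero]
      refine ⟨j, ?_⟩
      rw [zmod_two_prod_eq_zero]
      refine ⟨k, ?_⟩
      rw [h, hjk, hi]
      rfl
  rw [ViewA.candidate, h₀]
  exact zmod_two_add_self_eq 1 (Δ i)

/-- If all opened bits are true, the checks do not involve `Δ`. Otherwise they can hold only if `Δ`
is the candidate, so a single key query settles them. -/
theorem ViewA.checks_iff (Δ : Str κ) (q : ViewA b ℓ κ) :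
    q.pass * (1 + (1 + q.honest) * (1 + if q.candidate = Δ then (1 : ZMod 2) else 0)) = 1 ↔
      checks Δ q.2.1 (keysOf Δ q.1) q.2.2 := by
  rw [checks_keysOf]
  by_cases hq : ∀ j k, q.flag j k = 0
  · rw [(ViewA.honest_eq_one q).2 hq]
    have : ∀ a c : ZMod 2, a * (1 + (1 + 1) * c) = 1 ↔ a = 1 := by decide
    rw [this, ViewA.pass_eq_one]
    simp [hq]
  · have hh : q.honest = 0 := by
      rw [← zmod_two_ne_one, Ne, ViewA.honest_eq_one]
      exact hq
    push Not at hq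
    obtain ⟨j, k, hjk⟩ := hq
    rw [hh]
    constructor
    · intro h
      split_ifs at h with hc
      · rw [← hc]
        exact (ViewA.pass_eq_one q).1 ((zmod_two_mul_eq_one _ _).1 h).1
      · have : ∀ a : ZMod 2, ¬ a * (1 + (1 + 0) * (1 + 0)) = 1 := by decide
        exact absurd h (this _)
    · intro h
      have hc := ViewA.candidate_eq h hjk
      rw [if_pos hc, (ViewA.pass_eq_one q).2 (by rwa [hc])]
      rfl

theorem ViewA.error_eq_zero {q : ViewA b ℓ κ} (h : ∀ j k, q.flag j k = 0) (j : Fin ℓ) :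
    q.error j = 0 := by
  have hf : ∀ k, (q.2.2 j k).1 = (q.at j 0).2.1 + (q.at j k.succ).2.1 := fun k =>
    ((zmod_two_add_eq_zero _ _).1 (h j k)).symm
  rw [ViewA.error, Fin.sum_univ_succ, Fin.sum_univ_succ, add_mul, Finset.sum_mul,
    zmod_two_add_eq_zero, add_assoc, ← Finset.sum_add_distrib]
  congr 1
  refine Finset.sum_congr rfl fun k _ => ?_
  rw [hf]
  linear_combination (q.at j k.succ).1 * (q.at j k.succ).2.1 * CharTwo.two_eq_zero (R := ZMod 2)

/-- Only the key of `z` is delicate: it needs the error times `Δ`, of which the simulator knows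
merely the candidate. Either the error vanishes, all opened bits being true, or a false bit has
passed and the candidate equals `Δ`. -/
theorem ViewA.keysOf_values {Δ : Str κ} {q : ViewA b ℓ κ}
    (h : checks Δ q.2.1 (keysOf Δ q.1) q.2.2) :
    keysOf Δ q.values = bucketK q.2.1 (fun j k => (q.2.2 j k).1) (keysOf Δ q.1) := by
  rw [checks_keysOf] at h
  have herr : ∀ j i, q.error j * q.candidate i = q.error j * Δ i := by
    intro j i
    by_cases hq : ∀ j k, q.flag j k = 0
    · rw [ViewA.error_eq_zero hq, zero_mul, zero_mul]
    · push Not at hq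
      obtain ⟨j, k, hjk⟩ := hq
      rw [ViewA.candidate_eq h hjk]
  funext j
  simp only [keysOf, bucketK, combineAll, ViewA.values]
  refine Prod.ext ?_ (Prod.ext ?_ ?_)
  · funext i
    simp [ViewA.at, Finset.sum_add_distrib, Finset.sum_mul]
  · rfl
  · funext i
    simp only [herr]
    simp only [ViewA.error]
    simp [ViewA.at, Finset.sum_add_distrib, Finset.sum_mul, add_mul, mul_assoc]
    linear_combination (∑ k, (q.1 (q.2.1 (slot j k))).1 * ((q.1 (q.2.1 (slot j 0))).2.1 * Δ i)) *
      CharTwo.two_eq_zero (R := ZMod 2)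

end

/-! ### Coupling of the two worlds, carried out for a corrupted `A` -/

section

variable {b ℓ κ : ℕ}

/-- An optional value as a tagged union. -/
def toSum {α : Type} : Option α → Unit ⊕ α
  | none => .inl ()
  | some a => .inr a

@[simp] theorem toSum_none {α : Type} : toSum (none : Option α) = .inl () := rfl
@[simp] theorem toSum_some {α : Type} (a : α) : toSum (some a) = .inr a := rfl

theorem sizes_le (b ℓ κ : ℕ) : ℓ * (b + 1) ≤ (b + ℓ + κ + 2) ^ 2 ∧ ℓ ≤ (b + ℓ + κ + 2) ^ 1 ∧
    b ≤ (b + ℓ + κ + 2) ^ 1 ∧ b + 1 ≤ (b + ℓ + κ + 2) ^ 1 ∧ κ ≤ (b + ℓ + κ + 2) ^ 1 := by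
  simp only [pow_one, pow_two]
  exact ⟨Nat.mul_le_mul (by omega) (by omega), by omega, by omega, by omega, by omega⟩

/-- `System.advantage_le` for the hybrid world and the ideal world. -/
theorem advantage_stepWorld_le {coins : ℕ} {S : Type}
    (f : S × SimIn b ℓ κ × Str coins × Equiv.Perm (Fin (ℓ * (b + 1))) → S × SimOut b ℓ κ)
    (start : S) (D : PMF (Equiv.Perm (Fin (ℓ * (b + 1))))) (corr : Option Party)
    (R : PMF (HybridState b ℓ κ) → PMF (S × BoxState ℓ κ) → ℝ≥0∞ → Prop) {ε : ℝ≥0∞} (hε : ε ≠ ∞)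
    (hstart : ∀ Δ : Str κ, Lift R
      ((PMF.uniformOfFintype ((Fin (ℓ * (b + 1)) → ZMod 2) × (Fin (ℓ * (b + 1)) → ZMod 2) ×
          (Fin (ℓ * (b + 1)) → Triple (Str κ)))).map fun r =>
        ((⟨⟨Δ, r.1, r.2.1, r.2.2, fun _ => false, false, fun _ => false⟩, none, none, none⟩ :
          HybridState b ℓ κ), ()))
      ((PMF.uniformOfFintype ((Fin ℓ → ZMod 2) × (Fin ℓ → ZMod 2) ×
          (Fin ℓ → Triple (Str κ)))).map fun r =>
        ((start, ⟨Δ, r.1, r.2.1, r.2.2, fun _ => false, false, fun _ => false⟩), ())) ε)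
    (hstep : ∀ μ₁ μ₂ δ, R μ₁ μ₂ δ → ∀ i, Lift R (μ₁.bind fun s => hybridStep D corr s i)
      (μ₂.bind fun s => idealStep f D corr s i) δ)
    (Z : Env (EnvCmd b ℓ κ) (EnvResp b ℓ κ)) :
    |(hybridWorld κ D corr).prob Z - (stepWorld f start D corr).prob Z| ≤ ε.toReal := by
  refine System.advantage_le _ _ R hε ?_ hstep Z
  have h₁ : ((boxStart (ℓ * (b + 1)) κ).map fun s =>
        (⟨s, none, none, none⟩ : HybridState b ℓ κ)).map (fun s => (s, ())) =
      (PMF.uniformOfFintype (Str κ)).bind fun Δ =>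
        (PMF.uniformOfFintype ((Fin (ℓ * (b + 1)) → ZMod 2) × (Fin (ℓ * (b + 1)) → ZMod 2) ×
          (Fin (ℓ * (b + 1)) → Triple (Str κ)))).map fun r =>
        ((⟨⟨Δ, r.1, r.2.1, r.2.2, fun _ => false, false, fun _ => false⟩, none, none, none⟩ :
          HybridState b ℓ κ), ()) := by
    simp only [boxStart_eq, PMF.map_bind, PMF.map_comp]
    rfl
  have h₂ : ((boxStart ℓ κ).map fun s => (start, s)).map (fun s => (s, ())) =
      (PMF.uniformOfFintype (Str κ)).bind fun Δ =>
        (PMF.uniformOfFintype ((Fin ℓ → ZMod 2) × (Fin ℓ → ZMod 2) ×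
          (Fin ℓ → Triple (Str κ)))).map fun r =>
        ((start, ⟨Δ, r.1, r.2.1, r.2.2, fun _ => false, false, fun _ => false⟩), ()) := by
    simp only [boxStart_eq, PMF.map_bind, PMF.map_comp]
    rfl
  -- The global key is shared by the two worlds from the outset, because key queries may test it at
  -- any time; the other values are related only by distribution.
  have h := Lift.bind (ε := fun _ => ε) (PMF.uniformOfFintype (Str κ)) hstart (expect_const _ _).le
  rw [← h₁, ← h₂] at h
  exact h

/-- The state of the simulator that corresponds to a state of the hybrid world. -/
def simStateA (choice : Option (Fin (ℓ * (b + 1)) → AChoice κ)) (s : HybridState b ℓ κ) :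
    SimA b ℓ κ :=
  (toSum choice, toBit (s.box.started Party.B), toBit (s.box.done Party.B),
    toBit s.keysB.isSome, toSum (s.inboxB.map toSum), .inl ())

/-- The states of the hybrid and of the ideal world correspond to each other. -/
structure RelA (choice : Option (Fin (ℓ * (b + 1)) → AChoice κ)) (s : HybridState b ℓ κ)
    (t : BoxState ℓ κ) : Prop where
  key : t.Δ = s.box.Δ
  started : t.started Party.B = s.box.started Party.B
  chosen : s.box.chosen = choice.isSome
  keys : ∀ v, choice = some v → s.box.K = keysOf s.box.Δ v
  keysB : ∀ u, s.keysB = some u → u = (s.box.Δ, s.box.K) ∧ choice.isSome = true ∧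
    s.box.done Party.B = true ∧ s.box.started Party.B = true
  -- As long as `B` has neither received `fail` from the leaky box nor finished the protocol, the
  -- ideal box has not served him and no choice has been input, so both are still available to the
  -- simulator.
  fresh : (s.box.done Party.B = true → s.keysB.isSome = true) →
    ¬ (s.keysB.isSome = true ∧ s.inboxB.isSome = true) →
      t.done Party.B = false ∧ t.chosen = false

/-- Corresponding states, as distributions. -/
inductive CoupledA : PMF (HybridState b ℓ κ) → PMF (SimA b ℓ κ × BoxState ℓ κ) → ℝ≥0∞ → Prop
  | mk {choice : Option (Fin (ℓ * (b + 1)) → AChoice κ)} {s : HybridState b ℓ κ}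
      {t : BoxState ℓ κ} (h : RelA choice s t) :
      CoupledA (PMF.pure s) (PMF.pure (simStateA choice s, t)) 0

theorem ready_of_chosen {n : ℕ} {s : BoxState n κ} (h₁ : s.started Party.B = true)
    (h₂ : s.chosen = true) : s.ready (some Party.A) := by
  intro p
  fin_cases p
  · simpa using h₂
  · simpa using h₁

variable {D : PMF (Equiv.Perm (Fin (ℓ * (b + 1))))}

theorem boxAdv_chooseA {n : ℕ} {leaky : Bool} {corr : Option Party} {s : BoxState n κ}
    {v : Fin n → AChoice κ} (h : corr = some Party.A ∧ s.chosen = false) :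
    boxAdv leaky corr s (.chooseA v) = ⟨{ s with
      x := fun i => (v i).1
      y := fun i => (v i).2.1
      K := keysOf s.Δ v
      chosen := true }, .ack, none, none⟩ := if_pos h

/-- This is the whole exchange with the ideal box once `B` has both keys and message: it makes the
box output what `B` computes in the protocol, `fail` included. Of the final state of the box only
the key and the calls matter later. -/
theorem afterStep_finishA (v : Fin (ℓ * (b + 1)) → AChoice κ) (choice) (s₁ s₂ s₃) (inbox)
    (m : Option (Msg b ℓ κ)) (t : BoxState ℓ κ) (hs : t.started Party.B = true)
    (hd : t.done Party.B = false) (ht : t.chosen = false) :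
    ∃ t' : BoxState ℓ κ, t'.Δ = t.Δ ∧ t'.started = t.started ∧
      afterStep (reactionsA b ℓ κ).step D (some Party.A) 3 t
        (SimA.finish (v, (choice, s₁, s₂, s₃, inbox, .inl ()), toSum m)) =
      PMF.pure (((choice, s₁, s₂, s₃, inbox, .inl ()), t'),
        ⟨(.ack, none), none, some (protocolB (t.Δ, keysOf t.Δ v) m)⟩) := by
  have hfail : ∀ q, afterStep (reactionsA b ℓ κ).step D (some Party.A) (q + 1) t
      ((choice, s₁, s₂, s₃, inbox, .inl ()), .inl (.inr (.inr (.inr (.inr (.inr Party.B)))))) =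
      PMF.pure (((choice, s₁, s₂, s₃, inbox, .inl ()), t.finish Party.B),
        ⟨(.ack, none), none, some none⟩) := by
    intro q
    refine afterStep_forward (r := .ack) (r' := .ack) (m := .inl ()) ?_ fun _ _ => rfl
    simp [BoxCmd.decode, boxAdv, hs, hd]
  rcases m with _ | ⟨π, o⟩
  · exact ⟨t.finish Party.B, rfl, rfl, hfail 2⟩
  have hk : afterStep (reactionsA b ℓ κ).step D (some Party.A) 3 t
      (SimA.finish (v, (choice, s₁, s₂, s₃, inbox, .inl ()), toSum (some (π, o)))) =
      afterStep (reactionsA b ℓ κ).step D (some Party.A) 2 t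
        (if ViewA.pass (v, π, o) * (1 + (1 + ViewA.honest (v, π, o)) *
          (1 + if ViewA.candidate (v, π, o) = t.Δ then (1 : ZMod 2) else 0)) = 1 then
          ((choice, s₁, s₂, s₃, inbox, .inr (.inr ())),
            .inl (.inr (.inl (ViewA.values (v, π, o)))))
        else ((choice, s₁, s₂, s₃, inbox, .inl ()),
          .inl (.inr (.inr (.inr (.inr (.inr Party.B))))))) :=
    afterStep_continue (r := .answer (if ViewA.candidate (v, π, o) = t.Δ then 1 else 0))
      (by simp [BoxCmd.decode, boxAdv]) fun _ _ => rfl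
  rw [hk, protocolB_some]
  by_cases hch : checks t.Δ π (keysOf t.Δ v) o
  · rw [if_pos ((ViewA.checks_iff t.Δ (v, π, o)).2 hch), if_pos hch]
    obtain ⟨t₁, ht₁, hK, hΔ, hst, hdn, hc⟩ : ∃ t₁ : BoxState ℓ κ,
        boxAdv false (some Party.A) t (.chooseA (ViewA.values (v, π, o))) =
          ⟨t₁, .ack, none, none⟩ ∧ t₁.K = keysOf t.Δ (ViewA.values (v, π, o)) ∧ t₁.Δ = t.Δ ∧
        t₁.started = t.started ∧ t₁.done = t.done ∧ t₁.chosen = true :=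
      ⟨_, boxAdv_chooseA ⟨rfl, ht⟩, rfl, rfl, rfl, rfl, rfl⟩
    refine ⟨t₁.finish Party.B, hΔ, hst, ?_⟩
    have hmid : afterStep (reactionsA b ℓ κ).step D (some Party.A) 2 t
        ((choice, s₁, s₂, s₃, inbox, .inr (.inr ())),
          .inl (.inr (.inl (ViewA.values (v, π, o))))) =
        afterStep (reactionsA b ℓ κ).step D (some Party.A) 1 t₁
          ((choice, s₁, s₂, s₃, inbox, .inl ()),
            .inl (.inr (.inr (.inr (.inr (.inl Party.B)))))) :=
      afterStep_continue (r := .ack) ht₁ fun _ _ => rfl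
    have hlast : afterStep (reactionsA b ℓ κ).step D (some Party.A) 1 t₁
          ((choice, s₁, s₂, s₃, inbox, .inl ()),
            .inl (.inr (.inr (.inr (.inr (.inl Party.B)))))) =
        PMF.pure (((choice, s₁, s₂, s₃, inbox, .inl ()), t₁.finish Party.B),
          ⟨(.ack, none), none, some (some (t₁.Δ, t₁.K))⟩) := by
      refine afterStep_forward (r := .ack) (r' := .ack) (m := .inl ()) ?_ fun _ _ => rfl
      simp [BoxCmd.decode, boxAdv, hdn, hd, ready_of_chosen (hst ▸ hs) hc]
    rw [hmid, hlast, hK, hΔ, ViewA.keysOf_values (q := (v, π, o)) hch]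
  · rw [if_neg (mt (ViewA.checks_iff t.Δ (v, π, o)).1 hch), if_neg hch]
    exact ⟨t.finish Party.B, rfl, rfl, hfail 1⟩

theorem liftA_ack {choice : Option (Fin (ℓ * (b + 1)) → AChoice κ)} {s : HybridState b ℓ κ}
    {t : BoxState ℓ κ} (h : RelA choice s t) {p : PMF (HybridState b ℓ κ × EnvResp b ℓ κ)}
    {e : SimIn b ℓ κ} (hp : p = PMF.pure (s, ⟨(.ack, none), none, none⟩))
    (he : ∀ u π, (reactionsA b ℓ κ).step (simStateA choice s, e, u, π) = (simStateA choice s, ack)) :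
    Lift CoupledA p (runStep (reactionsA b ℓ κ).step D (some Party.A) 4 (simStateA choice s, t) e)
      0 :=
  Lift.of_eq_pure hp (runStep_report (r := .ack) he) (.mk h)

/-- A second message is ignored, and a first one is only stored while the keys are missing;
otherwise `B` finishes now and `afterStep_finishA` applies. -/
theorem liftA_receive {choice : Option (Fin (ℓ * (b + 1)) → AChoice κ)} {s : HybridState b ℓ κ}
    {t : BoxState ℓ κ} (h : RelA choice s t) (m : Option (Msg b ℓ κ)) {e : SimIn b ℓ κ}
    (he : ∀ u π, (reactionsA b ℓ κ).step (simStateA choice s, e, u, π) =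
      SimA.receive (toSum m, simStateA choice s)) :
    Lift CoupledA (PMF.pure (s.receive m))
      (runStep (reactionsA b ℓ κ).step D (some Party.A) 4 (simStateA choice s, t) e) 0 := by
  obtain ⟨box, transit, keysB, inboxB⟩ := s
  rcases inboxB with _ | m'
  swap
  · exact liftA_ack h rfl he
  rcases keysB with _ | u
  · refine Lift.of_eq_pure (s₁ := ⟨box, transit, none, some m⟩) (o := ⟨(.ack, none), none, none⟩)
      rfl (runStep_report (r := .ack) he) (.mk ⟨h.key, h.started, h.chosen, h.keys, h.keysB, ?_⟩)
    intro h₁ _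
    exact h.fresh h₁ (by simp)
  · obtain ⟨hu, hch, hdn, hst⟩ := h.keysB u rfl
    rcases choice with _ | v
    · cases hch
    obtain ⟨hd, hc⟩ := h.fresh (fun _ => rfl) (by simp)
    obtain ⟨t', hΔ, hs', hrun⟩ := afterStep_finishA (D := D) v (.inr v) (toBit (box.started Party.B))
      (toBit (box.done Party.B)) 1 (.inr (toSum m)) m t (h.started.trans hst) hd hc
    have h' : RelA (some v) ⟨box, transit, some u, some m⟩ t' :=
      ⟨hΔ.trans h.key, by rw [hs']; exact h.started, h.chosen, h.keys, h.keysB,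
        fun _ h' => absurd ⟨rfl, rfl⟩ h'⟩
    refine Lift.of_eq_pure ?_ ((runStep_of_eq _ he).trans hrun) (.mk h')
    rw [h.key, ← h.keys v rfl, ← hu]
    rfl

/-- The mirror image of `liftA_receive`: the keys arrive, and `B` finishes at once if a message is
already waiting. -/
theorem liftA_deliver {choice : Option (Fin (ℓ * (b + 1)) → AChoice κ)} {s : HybridState b ℓ κ}
    {t : BoxState ℓ κ} (h : RelA choice s t) (p : Party) :
    Lift CoupledA (hybridStep D (some Party.A) s (.adv (.box (.deliver p))))
      (runStep (reactionsA b ℓ κ).step D (some Party.A) 4 (simStateA choice s, t)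
        (.inl (AdvCmd.box (.deliver p)).encode)) 0 := by
  by_cases hp : p = Party.B ∧ s.box.started Party.B = true ∧ s.box.done Party.B = false ∧
      choice.isSome = true
  · obtain ⟨rfl, hst, hdn, hch⟩ := hp
    rcases choice with _ | v
    · cases hch
    have hready := ready_of_chosen hst (h.chosen.trans hch)
    rw [hybridStep_keysB (t := s.box.finish Party.B) (r := .ack) (v := (s.box.Δ, s.box.K))
      (by simp [boxAdv, hready, hdn])]
    have hk : s.keysB = none := by
      rcases hk : s.keysB with _ | u
      · rfl
      · have := (h.keysB u hk).2.2.1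
        rw [hdn] at this
        cases this
    obtain ⟨hd, hc⟩ := h.fresh (fun h' => absurd h' (by simp [hdn])) (by simp [hk])
    obtain ⟨box, transit, keysB, inboxB⟩ := s
    rcases inboxB with _ | m
    · have h' : RelA (some v) ⟨box.finish Party.B, transit, some (box.Δ, box.K), none⟩ t :=
        ⟨h.key, h.started, h.chosen, h.keys, by rintro _ ⟨⟩; exact ⟨rfl, rfl, by simp
          [BoxState.finish], hst⟩, fun _ _ => ⟨hd, hc⟩⟩
      refine Lift.of_eq_pure rfl (runStep_report (r := .ack) fun u π => ?_) (.mk h')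
      show (reactionsA b ℓ κ).deliver (Party.B, _, u, π) = _
      simp at hst hdn
      simp [reactionsA, simStateA, hst, hdn, BoxState.finish, ack, BoxResp.encode]
    · obtain ⟨t', hΔ, hs', hrun⟩ := afterStep_finishA (D := D) v (.inr v)
        (toBit (box.started Party.B)) 1 1 (.inr (toSum m)) m t (h.started.trans hst) hd hc
      have h' : RelA (some v) ⟨box.finish Party.B, transit, some (box.Δ, box.K), some m⟩ t' :=
        ⟨hΔ.trans h.key, by rw [hs']; exact h.started, h.chosen, h.keys, by
          rintro _ ⟨⟩; exact ⟨rfl, rfl, by simp [BoxState.finish], hst⟩,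
          fun _ h' => absurd ⟨rfl, rfl⟩ h'⟩
      refine Lift.of_eq_pure (s₁ := ⟨box.finish Party.B, transit, some (box.Δ, box.K), some m⟩)
        ?_ (.trans (runStep_of_eq _ fun u π => ?_) hrun) ?_
      · rw [h.key, ← h.keys v rfl]
        rfl
      · show (reactionsA b ℓ κ).deliver (Party.B, _, u, π) = _
        simp at hst hdn
        simp [reactionsA, simStateA, hst, hdn]
      · have := CoupledA.mk h'
        simpa [simStateA, BoxState.finish] using this
  · refine liftA_ack h (hybridStep_ack ?_) fun u π => ?_
    · rw [boxAdv, if_neg]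
      rintro ⟨h₁, h₂, h₃⟩
      obtain rfl : p = Party.B := by fin_cases p <;> simp_all
      have hst := h₂ Party.B
      have hch := h₂ Party.A
      simp at hst hch
      exact hp ⟨rfl, by simpa using hst, h₃, h.chosen.symm.trans hch⟩
    · show (reactionsA b ℓ κ).deliver (p, _, u, π) = _
      rcases choice with _ | v
      · simp [reactionsA, simStateA]
      · by_cases hB : p = Party.B
        · cases hst : s.box.started Party.B <;> cases hdn : s.box.done Party.B <;>
            simp_all [reactionsA, simStateA]
        · simp [reactionsA, simStateA, hB]

theorem liftA_abort {choice : Option (Fin (ℓ * (b + 1)) → AChoice κ)} {s : HybridState b ℓ κ}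
    {t : BoxState ℓ κ} (h : RelA choice s t) (p : Party) :
    Lift CoupledA (hybridStep D (some Party.A) s (.adv (.box (.abort p))))
      (runStep (reactionsA b ℓ κ).step D (some Party.A) 4 (simStateA choice s, t)
        (.inl (AdvCmd.box (.abort p)).encode)) 0 := by
  by_cases hp : p = Party.B ∧ s.box.started Party.B = true ∧ s.box.done Party.B = false
  · obtain ⟨rfl, hst, hdn⟩ := hp
    have hk : s.keysB = none := by
      rcases hk : s.keysB with _ | u
      · rfl
      · have := (h.keysB u hk).2.2.1
        rw [hdn] at this
        cases this
    obtain ⟨hd, hc⟩ := h.fresh (fun h' => absurd h' (by simp [hdn])) (by simp [hk])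
    rw [hybridStep_failB (t := s.box.finish Party.B) (r := .ack) (by simp [boxAdv, hst, hdn])]
    have h' : RelA choice { s with box := s.box.finish Party.B } (t.finish Party.B) :=
      ⟨h.key, h.started, h.chosen, h.keys, fun u hu => absurd (hk.symm.trans hu) (by simp),
        fun h₁ => absurd (h₁ (by simp [BoxState.finish])) (by simp [hk])⟩
    refine Lift.of_eq_pure rfl (.trans (runStep_of_eq _ (w := (simStateA choice
      { s with box := s.box.finish Party.B }, .inl (.inr (.inr (.inr (.inr (.inr Party.B)))))))
      fun u π => ?_) (afterStep_forward (r := .ack) (r' := .ack) (m := .inl ())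
        (oA := none) (oB := some none) (t' := t.finish Party.B) ?_ fun _ _ => rfl)) (.mk h')
    · show (reactionsA b ℓ κ).abort (Party.B, _, u, π) = _
      simp [reactionsA, simStateA, hst, hdn, BoxState.finish]
    · have := h.started
      simp [BoxCmd.decode, boxAdv, hst, hd, this]
  · refine liftA_ack h (hybridStep_ack ?_) fun u π => ?_
    · rw [boxAdv, if_neg]
      rintro ⟨-, h₁, h₂, h₃⟩
      obtain rfl : p = Party.B := by fin_cases p <;> simp_all
      exact hp ⟨rfl, h₂, h₃⟩
    · show (reactionsA b ℓ κ).abort (p, _, u, π) = _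
      by_cases hB : p = Party.B
      · cases hst : s.box.started Party.B <;> cases hdn : s.box.done Party.B <;>
          simp_all [reactionsA, simStateA]
      · simp [reactionsA, simStateA, hB]

theorem liftA_step {choice : Option (Fin (ℓ * (b + 1)) → AChoice κ)} {s : HybridState b ℓ κ}
    {t : BoxState ℓ κ} (h : RelA choice s t) (i : EnvCmd b ℓ κ) :
    Lift CoupledA (hybridStep D (some Party.A) s i)
      (idealStep (reactionsA b ℓ κ).step D (some Party.A) (simStateA choice s, t) i) 0 := by
  rcases i with p | c
  · obtain rfl | rfl : p = Party.A ∨ p = Party.B := by fin_cases p <;> simp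
    · rw [hybridStep_input (boxCall_of_not (by simp)), idealStep_input (boxCall_of_not (by simp))]
      exact liftA_ack h rfl fun _ _ => rfl
    · by_cases hs : s.box.started Party.B = true
      · rw [hybridStep_input (boxCall_of_not (by simp [hs])),
          idealStep_input (boxCall_of_not (by simp [h.started, hs]))]
        exact liftA_ack h rfl fun _ _ => rfl
      · rw [Bool.not_eq_true] at hs
        rw [hybridStep_input (boxCall_of ⟨by decide, hs⟩),
          idealStep_input (boxCall_of ⟨by decide, h.started.trans hs⟩)]
        refine Lift.of_eq_pure rfl (runStep_report (r := .started Party.B) fun _ _ => ?_)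
          (.mk (choice := choice) ⟨h.key, ?_, h.chosen, h.keys, ?_, h.fresh⟩)
        · simp [Reactions.step, reactionsA, simStateA, BoxResp.encode]
        · simp
        · intro u hu
          have := (h.keysB u hu).2.2.2
          rw [hs] at this
          cases this
  rw [idealStep_adv]
  rcases c with c | m | _ | _
  · rcases c with Δ' | v | v | ⟨i, g⟩ | p | p
    · rw [hybridStep_ack (r := .answer (if Δ' = s.box.Δ then 1 else 0)) (by simp [boxAdv])]
      refine Lift.of_eq_pure rfl (.trans (runStep_of_eq _ (w := (simStateA choice s, .inl (.inl Δ')))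
        fun _ _ => rfl) (afterStep_forward (t' := t) (oA := none) (oB := none) (r := .answer (if Δ' = s.box.Δ then 1 else 0))
        (r' := .answer (if Δ' = s.box.Δ then 1 else 0)) (m := .inl ()) ?_
        fun _ _ => rfl)) (.mk h)
      simp [BoxCmd.decode, boxAdv, h.key]
    · rcases choice with _ | v'
      · have hch : s.box.chosen = false := h.chosen
        rw [hybridStep_quiet (boxAdv_chooseA ⟨rfl, hch⟩)]
        refine Lift.of_eq_pure rfl (runStep_report (r := .ack) fun _ _ => rfl)
          (.mk (choice := some v) ⟨h.key, h.started, rfl, ?_, ?_, h.fresh⟩)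
        · rintro _ ⟨⟩
          rfl
        · intro u hu
          cases (h.keysB u hu).2.1
      · have hch : s.box.chosen = true := h.chosen
        rw [hybridStep_ack (r := .ack) (by simp [boxAdv, hch])]
        exact liftA_ack h rfl fun _ _ => rfl
    · rw [hybridStep_ack (r := .ack) (by simp [boxAdv])]
      exact liftA_ack h rfl fun _ _ => rfl
    · rw [hybridStep_ack (r := .ack) (by simp [boxAdv])]
      exact liftA_ack h rfl fun _ _ => rfl
    · exact liftA_deliver h p
    · exact liftA_abort h p
  · exact liftA_receive h (some m) fun _ _ => rfl
  · exact liftA_receive h none fun _ _ => rfl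
  · exact liftA_ack h rfl fun _ _ => rfl

theorem advantageA (Z : Env (EnvCmd b ℓ κ) (EnvResp b ℓ κ)) :
    |(hybridWorld κ D (some Party.A)).prob Z - (stepWorld (reactionsA b ℓ κ).step
      (.inl (), 0, 0, 0, .inl (), .inl ()) D (some Party.A)).prob Z| ≤ 0 := by
  refine (advantage_stepWorld_le _ _ _ _ CoupledA ENNReal.zero_ne_top ?_ ?_ Z).trans_eq rfl
  · intro Δ
    -- A corrupted `A` overwrites the sampled bits and keys before any output depends on them, and
    -- `RelA` does not mention them until then, so arbitrary samples may be paired.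
    refine Lift.bind_bind _ _ fun u v => ?_
    refine Lift.of_pure (.mk (choice := none) ⟨rfl, rfl, rfl, ?_, ?_, ?_⟩) ()
    · rintro _ ⟨⟩
    · rintro _ ⟨⟩
    · exact fun _ _ => ⟨rfl, rfl⟩
  · rintro _ _ _ ⟨h⟩ i
    rw [PMF.pure_bind, PMF.pure_bind]
    exact liftA_step h i

end

section

variable {b ℓ κ : ℕ}

/-! ### The simulator if no party is corrupted -/

/-- The state of the simulator: whether `A` and `B` have called the leaky box, whether `A` and `B`
have been served, whether `B` has received the message, and whether the simulator waits for the
delivery of the output of `A`. -/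
abbrev SimN := ZMod 2 × ZMod 2 × ZMod 2 × ZMod 2 × ZMod 2 × ZMod 2

/-- The revealed bits and their MACs, made of random coins. -/
def randomMsg (b ℓ κ : ℕ) (u : Str (ℓ * (b * (κ + 1)))) : Fin ℓ → Fin b → Auth κ := fun j k =>
  (u (finProdFinEquiv (j, finProdFinEquiv (k, 0))),
    fun i => u (finProdFinEquiv (j, finProdFinEquiv (k, i.succ))))

/-- The reactions of the simulator. -/
def reactionsN (b ℓ κ : ℕ) : Reactions b ℓ κ (ℓ * (b * (κ + 1))) SimN where
  keyQuery g := (g.2.1, .inl (.inl g.1))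
  chooseA g := (g.2.1, ack)
  chooseB g := (g.2.1, ack)
  guess g := (g.2.1, ack)
  deliver g :=
    if g.2.1.1 * g.2.1.2.1 = 1 then
      if (if g.1 = Party.A then (1 : ZMod 2) else 0) = 1 then
        if g.2.1.2.2.1 = 1 then (g.2.1, ack)
        else ((g.2.1.1, g.2.1.2.1, 1, g.2.1.2.2.2.1, g.2.1.2.2.2.2.1, 1),
          .inl (.inr (.inr (.inr (.inr (.inl Party.A))))))
      else if g.2.1.2.2.2.1 = 1 then (g.2.1, ack)
      else ((g.2.1.1, g.2.1.2.1, g.2.1.2.2.1, 1, g.2.1.2.2.2.2.1, 0),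
        -- In the protocol `B` outputs only when he has both his keys and the message; the simulator
        -- holds back the ideal delivery until then, here and in `forward`.
        if g.2.1.2.2.2.2.1 = 1 then .inl (.inr (.inr (.inr (.inr (.inl Party.B))))) else ack)
    else (g.2.1, ack)
  abort g := (g.2.1, ack)
  send g := (g.2.1, ack)
  sendMalformed g := (g.2.1, ack)
  forward g :=
    if g.2.1.2.2.1 * (1 + g.2.1.2.2.2.2.1) = 1 then
      ((g.2.1.1, g.2.1.2.1, g.2.1.2.2.1, g.2.1.2.2.2.1, 1, 0),
        if g.2.1.2.2.2.1 = 1 then .inl (.inr (.inr (.inr (.inr (.inl Party.B))))) else ack)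
    else (g.2.1, ack)
  resp g :=
    -- The ideal box has just served `A`, so the report is accompanied by a simulated message with a
    -- fresh permutation.
    if g.2.1.2.2.2.2.2 = 1 then
      ((g.2.1.1, g.2.1.2.1, g.2.1.2.2.1, g.2.1.2.2.2.1, g.2.1.2.2.2.2.1, 0),
        .inr (g.1, .inr (g.2.2.2, randomMsg b ℓ κ g.2.2.1)))
    else (g.1.elim (fun _ => g.2.1) fun c => c.elim (fun p =>
        if (if p = Party.A then (1 : ZMod 2) else 0) = 1 then (1, g.2.1.2)
        else (g.2.1.1, 1, g.2.1.2.2)) fun _ => g.2.1, .inr (g.1, .inl ()))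

/-! ### Cost of the simulator if no party is corrupted -/

section Efficiency

variable {M : ℕ} (hℓ : ℓ ≤ (M + 2) ^ 1) (hb : b ≤ (M + 2) ^ 1) (hκ : κ ≤ (M + 2) ^ 1)

include hℓ hb hκ in
theorem coins_le : ℓ * (b * (κ + 1)) ≤ (M + 2) ^ 4 := by
  rw [pow_one] at hℓ hb hκ
  calc ℓ * (b * (κ + 1)) ≤ (M + 2) * ((M + 2) * (M + 2) ^ 2) :=
        Nat.mul_le_mul hℓ (Nat.mul_le_mul hb (by nlinarith))
    _ = _ := by ring

include hℓ hb hκ in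
theorem eff_randomMsg : Eff M 100 (randomMsg b ℓ κ) := by
  have hc := coins_le hℓ hb hκ
  exact (Eff.vector hℓ fun j => .vector hb fun k => .pair (.lookup hc .var (.index _))
    (.vector hκ fun i => .lookup hc .var (.index _))).mono (by norm_num)

include hℓ hb hκ in
theorem reactionsN_efficient : (reactionsN b ℓ κ).Efficient M 1000 := by
  have h₁ := eff_randomMsg hℓ hb hκ
  constructor <;> unfold reactionsN <;> dsimp only <;> apply Eff.mono
  all_goals repeat' first
    | with_reducible exact Eff.unit
    | with_reducible exact Eff.var
    | with_reducible exact Eff.index _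
    | with_reducible exact Eff.bit _
    | with_reducible exact Eff.ack
    | with_reducible apply Eff.elim
    | with_reducible apply Eff.isA
    | with_reducible apply Eff.ite
    | with_reducible apply Eff.add
    | with_reducible apply Eff.mul
    | with_reducible apply Eff.comp (hg := h₁)
    | with_reducible apply Eff.fst
    | with_reducible apply Eff.snd
    | with_reducible apply Eff.inl
    | with_reducible apply Eff.inr
    | with_reducible apply Eff.pair
  all_goals norm_num

end Efficiency

end

section

variable {b ℓ κ : ℕ}

/-! ### Uniformity of the results -/

section Marginals

variable (π : Equiv.Perm (Fin (ℓ * (b + 1))))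

/-- Every index is `π (slot j k)` for exactly one pair `(j, k)`, so values can be prescribed bucket
by bucket. This provides the preimages in the surjectivity proofs. -/
theorem exists_arrange {V : Type} (g : Fin ℓ → Fin (b + 1) → V) :
    ∃ K : Fin (ℓ * (b + 1)) → V, ∀ j k, K (π (slot j k)) = g j k :=
  ⟨fun i => g (finProdFinEquiv.symm (π.symm i)).1 (finProdFinEquiv.symm (π.symm i)).2,
    fun j k => by simp [slot]⟩

theorem uniform_map_bucketX :
    (PMF.uniformOfFintype (Fin (ℓ * (b + 1)) → ZMod 2)).map (bucketX π) =
      PMF.uniformOfFintype (Fin ℓ → ZMod 2) := by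
  refine uniform_map_hom (AddMonoidHom.mk' (bucketX π) fun x x' => ?_) fun X => ?_
  · funext j
    simp [bucketX, Finset.sum_add_distrib]
  · obtain ⟨x, hx⟩ := exists_arrange π fun j k => if k = 0 then X j else 0
    refine ⟨x, funext fun j => ?_⟩
    simp [bucketX, hx]

theorem uniform_map_bucketY :
    (PMF.uniformOfFintype (Fin (ℓ * (b + 1)) → ZMod 2)).map
        (fun y => (bucketY π y, openBits π y)) =
      PMF.uniformOfFintype ((Fin ℓ → ZMod 2) × (Fin ℓ → Fin b → ZMod 2)) := by
  refine uniform_map_hom (AddMonoidHom.mk' (fun y => (bucketY π y, openBits π y))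
    fun y y' => ?_) fun ⟨Y, d⟩ => ?_
  · refine Prod.ext rfl (funext fun j => funext fun k => ?_)
    simp [openBits]; ring
  · obtain ⟨y, hy⟩ := exists_arrange π fun j => Fin.cons (α := fun _ => ZMod 2) (Y j)
      fun k => Y j + d j k
    refine ⟨y, Prod.ext (funext fun j => ?_) (funext fun j => funext fun k => ?_)⟩
    · simp [bucketY, hy]
    · simp [openBits, hy, zmod_two_add_self_eq]

/-- For fixed opened bits the map is a homomorphism. A preimage puts the desired result into the
first triple and leaves only the keys of `y` in the others, where they produce the desired keys of
the opened bits. -/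
theorem uniform_map_bucketK (d : Fin ℓ → Fin b → ZMod 2) :
    (PMF.uniformOfFintype (Fin (ℓ * (b + 1)) → Triple (Str κ))).map
        (fun K => (bucketK π d K, openKeys π K)) =
      PMF.uniformOfFintype ((Fin ℓ → Triple (Str κ)) × (Fin ℓ → Fin b → Str κ)) := by
  refine uniform_map_hom (AddMonoidHom.mk' (fun K => (bucketK π d K, openKeys π K))
    fun K K' => ?_) fun ⟨T, o⟩ => ?_
  · refine Prod.ext (funext fun j => ?_) (funext fun j => funext fun k => ?_)
    · simp only [bucketK, combineAll, Pi.add_apply, Prod.fst_add, Prod.snd_add,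
        Finset.sum_add_distrib, smul_add, Prod.mk_add_mk]
      refine Prod.ext rfl (Prod.ext rfl ?_)
      simp only; abel
    · simp only [openKeys, Pi.add_apply, Prod.fst_add, Prod.snd_add]; abel
  · obtain ⟨K, hK⟩ := exists_arrange π fun j => Fin.cons (α := fun _ => Triple (Str κ)) (T j)
      fun k => (0, (T j).2.1 + o j k, 0)
    refine ⟨K, Prod.ext (funext fun j => ?_) (funext fun j => funext fun k => ?_)⟩
    · simp [bucketK, combineAll, hK, Fin.sum_univ_succ]
    · simp only [AddMonoidHom.mk'_apply, openKeys, hK, Fin.cons_zero, Fin.cons_succ]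
      funext i
      exact zmod_two_add_self_eq _ _

/-- What the environment sees of the execution of the protocol. -/
def resultOf (Δ : Str κ) (r : (Fin (ℓ * (b + 1)) → ZMod 2) × (Fin (ℓ * (b + 1)) → ZMod 2) ×
    (Fin (ℓ * (b + 1)) → Triple (Str κ))) :
    ((Fin ℓ → ZMod 2) × (Fin ℓ → ZMod 2) × (Fin ℓ → Triple (Str κ))) ×
      (Fin ℓ → Fin b → Auth κ) :=
  ((bucketX π r.1, bucketY π r.2.1, bucketK π (openBits π r.2.1) r.2.2),
    fun j k => mac Δ (openBits π r.2.1 j k) (openKeys π r.2.2 j k))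

/-- The map is not linear, because opened bits multiply keys, but it is triangular: `y` determines
the opened bits, and for fixed `y` the keys are mapped uniformly. Passing from keys of opened bits
to MACs is a bijection. -/
theorem uniform_map_resultOf (Δ : Str κ) :
    (PMF.uniformOfFintype _).map (resultOf π Δ) = PMF.uniformOfFintype _ := by
  let e : (Fin ℓ → ZMod 2) × ((Fin ℓ → ZMod 2) × (Fin ℓ → Fin b → ZMod 2)) ×
      ((Fin ℓ → Triple (Str κ)) × (Fin ℓ → Fin b → Str κ)) ≃
      ((Fin ℓ → ZMod 2) × (Fin ℓ → ZMod 2) × (Fin ℓ → Triple (Str κ))) ×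
        (Fin ℓ → Fin b → Auth κ) :=
    { toFun := fun p => ((p.1, p.2.1.1, p.2.2.1), fun j k => mac Δ (p.2.1.2 j k) (p.2.2.2 j k))
      invFun := fun q => (q.1.1, (q.1.2.1, fun j k => (q.2 j k).1),
        (q.1.2.2, fun j k => (q.2 j k).2 - (q.2 j k).1 • Δ))
      left_inv := fun p => by simp [mac]
      right_inv := fun q => by simp [mac] }
  rw [← uniform_map_equiv e, uniform_prod, uniform_prod, uniform_prod (α := Fin ℓ → ZMod 2)
    (β := ((Fin ℓ → ZMod 2) × (Fin ℓ → Fin b → ZMod 2)) × _), uniform_prod (α :=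
      (Fin ℓ → ZMod 2) × (Fin ℓ → Fin b → ZMod 2)), ← uniform_map_bucketX π,
    ← uniform_map_bucketY π]
  simp only [PMF.map_bind, PMF.map_comp, PMF.bind_map, Function.comp_def]
  refine congrArg _ (funext fun x => congrArg _ (funext fun y => ?_))
  rw [← uniform_map_bucketK π (openBits π y), PMF.map_comp]
  rfl

theorem uniform_map_randomMsg (b ℓ κ : ℕ) {α : Type} [Fintype α] [Nonempty α] [AddGroup α] :
    (PMF.uniformOfFintype (α × Str (ℓ * (b * (κ + 1))))).map
      (fun p => (p.1, randomMsg b ℓ κ p.2)) = PMF.uniformOfFintype _ := by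
  refine uniform_map_hom (AddMonoidHom.mk' (fun p : α × Str (ℓ * (b * (κ + 1))) =>
    (p.1, randomMsg b ℓ κ p.2)) fun p p' => rfl) fun ⟨a, o⟩ => ?_
  refine ⟨(a, fun i => Fin.cons (α := fun _ => ZMod 2)
    (o (finProdFinEquiv.symm i).1 (finProdFinEquiv.symm (finProdFinEquiv.symm i).2).1).1
    (o (finProdFinEquiv.symm i).1 (finProdFinEquiv.symm (finProdFinEquiv.symm i).2).1).2
    (finProdFinEquiv.symm (finProdFinEquiv.symm i).2).2), Prod.ext rfl ?_⟩
  funext j k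
  show randomMsg b ℓ κ _ j k = _
  simp [randomMsg]

end Marginals

/-- For activations whose visible answer does not depend on the hidden randomness: the distributions
of states are merely relabelled. -/
theorem Lift.bind_map_pure {S₁ S₂ T₁ T₂ O α β : Type} {R : PMF S₁ → PMF S₂ → ℝ≥0∞ → Prop}
    {μ : PMF α} {ν : PMF β} {F : α → T₁} {G : β → T₂} {p : T₁ → PMF (S₁ × O)}
    {q : T₂ → PMF (S₂ × O)} (F' : α → S₁) (G' : β → S₂) (o : O) {ε : ℝ≥0∞}
    (hp : ∀ a, p (F a) = PMF.pure (F' a, o)) (hq : ∀ a, q (G a) = PMF.pure (G' a, o))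
    (h : R (μ.map F') (ν.map G') ε) : Lift R ((μ.map F).bind p) ((ν.map G).bind q) ε := by
  have := Lift.of_rel h o
  rw [PMF.map_comp, PMF.map_comp] at this
  rw [PMF.bind_map, PMF.bind_map]
  simp only [Function.comp_def, hp, hq]
  exact this

/-! ### Security if no party is corrupted -/

/-- The state of the hybrid world before `A` is served. -/
def hybridEarly (b ℓ : ℕ) (Δ : Str κ) (st dn : Party → Bool) (r : (Fin (ℓ * (b + 1)) → ZMod 2) ×
    (Fin (ℓ * (b + 1)) → ZMod 2) × (Fin (ℓ * (b + 1)) → Triple (Str κ))) : HybridState b ℓ κ :=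
  ⟨⟨Δ, r.1, r.2.1, r.2.2, st, false, dn⟩, none, if dn Party.B = true then some (Δ, r.2.2) else none,
    none⟩

/-- The state of the ideal world before `A` is served. -/
def idealEarly (ℓ : ℕ) (Δ : Str κ) (st dn : Party → Bool) (r : (Fin ℓ → ZMod 2) ×
    (Fin ℓ → ZMod 2) × (Fin ℓ → Triple (Str κ))) : SimN × BoxState ℓ κ :=
  ((toBit (st Party.A), toBit (st Party.B), 0, toBit (dn Party.B), 0, 0),
    ⟨Δ, r.1, r.2.1, r.2.2, st, false, fun _ => false⟩)

/-- The states of the hybrid and of the ideal world correspond to each other after `A` has been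
served. -/
structure RelN (s : HybridState b ℓ κ) (t : BoxState ℓ κ) : Prop where
  key : t.Δ = s.box.Δ
  started : ∀ p, s.box.started p = true
  started' : ∀ p, t.started p = true
  doneA : s.box.done Party.A = true
  doneA' : t.done Party.A = true
  doneB : s.box.done Party.B = s.keysB.isSome
  -- The ideal box has served `B` once he has both the keys and the message.
  doneB' : t.done Party.B = (s.keysB.isSome && s.inboxB.isSome)
  keysB : ∀ u, s.keysB = some u → u = (s.box.Δ, s.box.K)
  transit : ∃ m, s.transit = some m ∧
    protocolB (s.box.Δ, s.box.K) (some m) = some (t.Δ, t.K) ∧ ∀ m', s.inboxB = some m' → m' = some m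

/-- The state of the simulator after `A` has been served. -/
def simStateN (s : HybridState b ℓ κ) : SimN :=
  (1, 1, 1, toBit s.keysB.isSome, toBit s.inboxB.isSome, 0)

/-- Corresponding distributions of states. -/
inductive CoupledN : PMF (HybridState b ℓ κ) → PMF (SimN × BoxState ℓ κ) → ℝ≥0∞ → Prop
  -- Until `A` is served, all bits and local keys remain uniform given the transcript, even if `B`
  -- already holds his keys.
  | early (Δ : Str κ) (st dn : Party → Bool) (h : dn Party.A = false) :
      CoupledN ((PMF.uniformOfFintype _).map (hybridEarly b ℓ Δ st dn))
        ((PMF.uniformOfFintype _).map (idealEarly ℓ Δ st dn)) 0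
  -- At that moment the results are coupled; afterwards both worlds are deterministic, and the ideal
  -- box stores what `B` will compute from the message.
  | late {s : HybridState b ℓ κ} {t : BoxState ℓ κ} (h : RelN s t) :
      CoupledN (PMF.pure s) (PMF.pure (simStateN s, t)) 0

variable {D : PMF (Equiv.Perm (Fin (ℓ * (b + 1))))}

theorem liftN_ack {s : HybridState b ℓ κ}
    {t : BoxState ℓ κ} (h : RelN s t) {p : PMF (HybridState b ℓ κ × EnvResp b ℓ κ)}
    {e : SimIn b ℓ κ} (hp : p = PMF.pure (s, ⟨(.ack, none), none, none⟩))
    (he : ∀ u π, (reactionsN b ℓ κ).step (simStateN s, e, u, π) = (simStateN s, ack)) :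
    Lift CoupledN p (runStep (reactionsN b ℓ κ).step D none 4 (simStateN s, t) e) 0 :=
  Lift.of_eq_pure hp (runStep_report (r := .ack) he) (.late h)

theorem RelN.deliverB {s : HybridState b ℓ κ} {t : BoxState ℓ κ} (h : RelN s t)
    (hd : t.done Party.B = false) (c₁ c₂ c₃ c₄ c₅ : ZMod 2) :
    afterStep (reactionsN b ℓ κ).step D none 3 t
      ((c₁, c₂, c₃, c₄, c₅, 0), .inl (.inr (.inr (.inr (.inr (.inl Party.B)))))) =
    PMF.pure (((c₁, c₂, c₃, c₄, c₅, 0), t.finish Party.B),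
      ⟨(.ack, none), none, some (some (t.Δ, t.K))⟩) := by
  have hr : t.ready none := fun p => by simpa using h.started' p
  refine afterStep_forward (r := .ack) (r' := .ack) (m := .inl ()) ?_ fun _ _ => rfl
  simp [BoxCmd.decode, boxAdv, hr, hd]

theorem liftN_late {s : HybridState b ℓ κ} {t : BoxState ℓ κ} (h : RelN s t)
    (i : EnvCmd b ℓ κ) : Lift CoupledN (hybridStep D none s i)
      (idealStep (reactionsN b ℓ κ).step D none (simStateN s, t) i) 0 := by
  rcases i with p | c
  · rw [hybridStep_input (boxCall_of_not (by simp [h.started])),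
      idealStep_input (boxCall_of_not (by simp [h.started']))]
    exact liftN_ack h rfl fun _ _ => rfl
  rw [idealStep_adv]
  obtain ⟨m, htr, hm, hin⟩ := h.transit
  rcases c with c | m | _ | _
  · rcases c with Δ' | v | v | ⟨i, g⟩ | p | p
    · rw [hybridStep_ack (r := .answer (if Δ' = s.box.Δ then 1 else 0)) (by simp [boxAdv])]
      refine Lift.of_eq_pure rfl (.trans (runStep_of_eq _ (w := (simStateN s, .inl (.inl Δ')))
        fun _ _ => rfl) (afterStep_forward (t' := t) (oA := none) (oB := none)
        (r := .answer (if Δ' = s.box.Δ then 1 else 0))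
        (r' := .answer (if Δ' = s.box.Δ then 1 else 0)) (m := .inl ()) ?_
        fun _ _ => rfl)) (.late h)
      simp [BoxCmd.decode, boxAdv, h.key]
    · rw [hybridStep_ack (r := .ack) (by simp [boxAdv])]
      exact liftN_ack h rfl fun _ _ => rfl
    · rw [hybridStep_ack (r := .ack) (by simp [boxAdv])]
      exact liftN_ack h rfl fun _ _ => rfl
    · rw [hybridStep_ack (r := .ack) (by simp [boxAdv])]
      exact liftN_ack h rfl fun _ _ => rfl
    · obtain rfl | rfl : p = Party.A ∨ p = Party.B := by fin_cases p <;> simp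
      · rw [hybridStep_ack (r := .ack) (by simp [boxAdv, h.doneA])]
        exact liftN_ack h rfl fun _ _ => rfl
      rcases hk : s.keysB with _ | u
      · have hdn : s.box.done Party.B = false := by rw [h.doneB, hk]; rfl
        have hd : t.done Party.B = false := by rw [h.doneB', hk]; rfl
        have hr : s.box.ready none := fun p => by simpa using h.started p
        rw [hybridStep_keysB (t := s.box.finish Party.B) (r := .ack) (v := (s.box.Δ, s.box.K))
          (by simp [boxAdv, hr, hdn])]
        rcases hi : s.inboxB with _ | m'
        · refine Lift.of_eq_pure (by rw [hi]; rfl) (runStep_report (r := .ack) fun u π => ?_)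
            (.late (s := { s with box := s.box.finish Party.B, keysB := some (s.box.Δ, s.box.K) })
              (t := t) ⟨h.key, h.started, h.started', h.doneA, h.doneA', rfl, ?_, ?_, m, htr, hm,
                hin⟩)
          · show (reactionsN b ℓ κ).deliver (Party.B, _, u, π) = _
            simp [reactionsN, simStateN, hk, hi, ack, BoxResp.encode]
          · simp [hd, hi]
          · rintro _ ⟨⟩; rfl
        · obtain rfl := hin _ hi
          refine Lift.of_eq_pure
            (s₁ := { s with box := s.box.finish Party.B, keysB := some (s.box.Δ, s.box.K) })
            (o := ⟨(.ack, none), none, some (some (t.Δ, t.K))⟩) ?_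
            (.trans (runStep_of_eq _ (w := ((1, 1, 1, 1, 1, 0), _)) fun u π => ?_)
              (h.deliverB hd 1 1 1 1 1)) ?_
          · simp [hi, hm]
          · show (reactionsN b ℓ κ).deliver (Party.B, _, u, π) = _
            simp [reactionsN, simStateN, hk, hi]
          · have h' : RelN (HybridState.mk (s.box.finish Party.B) s.transit
                (some (s.box.Δ, s.box.K)) s.inboxB) (t.finish Party.B) :=
              ⟨h.key, h.started, h.started', h.doneA, h.doneA', rfl,
                by simp [BoxState.finish, hi], by rintro _ ⟨⟩; rfl, m, htr, hm, hin⟩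
            have := CoupledN.late h'
            simpa [simStateN, hi] using this
      · rw [hybridStep_ack (r := .ack) (by simp [boxAdv, h.doneB, hk])]
        refine liftN_ack h rfl fun u π => ?_
        show (reactionsN b ℓ κ).deliver (Party.B, _, u, π) = _
        simp [reactionsN, simStateN, hk]
    · rw [hybridStep_ack (r := .ack) (by simp [boxAdv])]
      exact liftN_ack h rfl fun _ _ => rfl
  · exact liftN_ack h rfl fun _ _ => rfl
  · exact liftN_ack h rfl fun _ _ => rfl
  · have hstep : hybridStep D none s (.adv .forward) = PMF.pure (s.receive (some m)) := by
      simp only [hybridStep, htr]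
    rw [hstep]
    rcases hi : s.inboxB with _ | m'
    · have hd : t.done Party.B = false := by rw [h.doneB', hi]; simp
      rcases hk : s.keysB with _ | u
      · refine Lift.of_eq_pure (s₁ := { s with inboxB := some (some m) })
          (o := ⟨(.ack, none), none, none⟩) (by simp [HybridState.receive, hi, hk])
          (runStep_report (r := .ack) fun u π => ?_)
            (.late (s := { s with inboxB := some (some m) })
              (t := t) ⟨h.key, h.started, h.started', h.doneA, h.doneA', h.doneB, ?_, h.keysB, m,
                htr, hm, ?_⟩)
        · show (reactionsN b ℓ κ).forward ((), _, u, π) = _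
          simp [reactionsN, simStateN, hk, hi, ack, BoxResp.encode]
        · simp [hd, hk]
        · rintro _ ⟨⟩; rfl
      · refine Lift.of_eq_pure (s₁ := { s with inboxB := some (some m) })
          (o := ⟨(.ack, none), none, some (some (t.Δ, t.K))⟩) ?_
          (.trans (runStep_of_eq _ (w := ((1, 1, 1, 1, 1, 0), _)) fun u π => ?_)
            (h.deliverB hd 1 1 1 1 1)) ?_
        · rw [h.keysB u hk] at hk
          simp [HybridState.receive, hi, hk, hm]
        · show (reactionsN b ℓ κ).forward ((), _, u, π) = _
          simp [reactionsN, simStateN, hk, hi]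
        · have h' : RelN { s with inboxB := some (some m) } (t.finish Party.B) :=
            ⟨h.key, h.started, h.started', h.doneA, h.doneA', h.doneB,
              by simp [BoxState.finish, hk], h.keysB, m, htr, hm, by rintro _ ⟨⟩; rfl⟩
          have := CoupledN.late h'
          simpa [simStateN, hk] using this
    · refine liftN_ack h (by simp [HybridState.receive, hi]) fun u π => ?_
      show (reactionsN b ℓ κ).forward ((), _, u, π) = _
      simp [reactionsN, simStateN, hi]

/-- The delivery of the output of `A`. -/
theorem liftN_deliverA {Δ : Str κ} {st dn : Party → Bool} (h : dn Party.A = false)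
    (hst : ∀ p, st p = true) :
    Lift CoupledN
      (((PMF.uniformOfFintype _).map (hybridEarly b ℓ Δ st dn)).bind fun s =>
        hybridStep D none s (.adv (.box (.deliver Party.A))))
      (((PMF.uniformOfFintype _).map (idealEarly ℓ Δ st dn)).bind fun s =>
        idealStep (reactionsN b ℓ κ).step D none s (.adv (.box (.deliver Party.A)))) 0 := by
  have h₁ : ∀ r, hybridStep D none (hybridEarly b ℓ Δ st dn r) (.adv (.box (.deliver Party.A))) =
      D.bind fun π => PMF.pure (⟨(hybridEarly b ℓ Δ st dn r).box.finish Party.A,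
        some (π, (resultOf π Δ r).2), (hybridEarly b ℓ Δ st dn r).keysB, none⟩,
        ⟨(.ack, some (π, (resultOf π Δ r).2)), some (some (share Δ (resultOf π Δ r).1.1
          (resultOf π Δ r).1.2.1 (resultOf π Δ r).1.2.2)), none⟩) := by
    intro r
    have hr : (hybridEarly b ℓ Δ st dn r).box.ready none := fun p => by
      simpa [hybridEarly] using hst p
    rw [hybridStep_shareA (t := (hybridEarly b ℓ Δ st dn r).box.finish Party.A) (r := .ack)
      (v := share Δ r.1 r.2.1 r.2.2)]
    · simp only [protocolA_share]
      rfl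
    · rw [boxAdv, if_pos ⟨by simp, hr, h⟩]
      rfl
  have h₂ : ∀ r, idealStep (reactionsN b ℓ κ).step D none (idealEarly ℓ Δ st dn r)
      (.adv (.box (.deliver Party.A))) =
      (PMF.uniformOfFintype (Str (ℓ * (b * (κ + 1))))).bind fun u => D.bind fun π =>
        PMF.pure (((1, 1, 1, toBit (dn Party.B), 0, 0),
          (idealEarly ℓ Δ st dn r).2.finish Party.A),
          ⟨(.ack, some (π, randomMsg b ℓ κ u)), some (some (share Δ r.1 r.2.1 r.2.2)), none⟩) := by
    intro r
    have hr : (idealEarly ℓ Δ st dn r).2.ready none := fun p => by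
      simpa [idealEarly] using hst p
    have ho : boxAdv false none (idealEarly ℓ Δ st dn r).2 (.deliver Party.A) =
        ⟨(idealEarly ℓ Δ st dn r).2.finish Party.A, .ack, some (some (share Δ r.1 r.2.1 r.2.2)),
          none⟩ := by
      rw [boxAdv, if_pos ⟨by simp, hr, rfl⟩]
      rfl
    rw [idealStep, runStep_of_eq _ (w := ((1, 1, 1, toBit (dn Party.B), 0, 1),
      .inl (.inr (.inr (.inr (.inr (.inl Party.A)))))))]
    · rw [afterStep_command, BoxCmd.decode, ho, runStep_succ, PMF.bind_bind]
      refine congrArg _ (funext fun u => ?_)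
      rw [PMF.bind_bind]
      refine congrArg _ (funext fun π => ?_)
      exact PMF.pure_bind _ _
    · intro u π
      show (reactionsN b ℓ κ).deliver (Party.A, _, u, π) = _
      simp [reactionsN, idealEarly, hst]
  rw [PMF.bind_map, PMF.bind_map]
  simp only [Function.comp_def, h₁, h₂]
  -- The permutation is drawn first in both worlds so that it can be shared.
  rw [PMF.bind_comm]
  have hcomm : ∀ r, ((PMF.uniformOfFintype (Str (ℓ * (b * (κ + 1))))).bind fun u => D.bind fun π =>
        PMF.pure ((((1, 1, 1, toBit (dn Party.B), 0, 0) : SimN),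
          (idealEarly ℓ Δ st dn r).2.finish Party.A),
          (⟨(.ack, some (π, randomMsg b ℓ κ u)), some (some (share Δ r.1 r.2.1 r.2.2)), none⟩ :
            EnvResp b ℓ κ))) =
      D.bind fun π => (PMF.uniformOfFintype (Str (ℓ * (b * (κ + 1))))).bind fun u =>
        PMF.pure (((1, 1, 1, toBit (dn Party.B), 0, 0),
          (idealEarly ℓ Δ st dn r).2.finish Party.A),
          ⟨(.ack, some (π, randomMsg b ℓ κ u)), some (some (share Δ r.1 r.2.1 r.2.2)), none⟩) :=
    fun r => PMF.bind_comm _ _ _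
  simp only [hcomm]
  rw [PMF.bind_comm (PMF.uniformOfFintype _) D]
  refine Lift.bind (ε := fun _ => 0) D (fun π => ?_) (expect_const _ _).le
  -- The randomness of the ideal box and the coins of the simulator are merged into one uniform
  -- sample, whose image is to be matched with `resultOf`.
  have hprod : ((PMF.uniformOfFintype ((Fin ℓ → ZMod 2) × (Fin ℓ → ZMod 2) ×
        (Fin ℓ → Triple (Str κ)))).bind fun r =>
      (PMF.uniformOfFintype (Str (ℓ * (b * (κ + 1))))).bind fun u =>
        PMF.pure ((((1, 1, 1, toBit (dn Party.B), 0, 0) : SimN),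
          (idealEarly ℓ Δ st dn r).2.finish Party.A),
          (⟨(.ack, some (π, randomMsg b ℓ κ u)), some (some (share Δ r.1 r.2.1 r.2.2)), none⟩ :
            EnvResp b ℓ κ))) =
      (PMF.uniformOfFintype (((Fin ℓ → ZMod 2) × (Fin ℓ → ZMod 2) ×
        (Fin ℓ → Triple (Str κ))) × Str (ℓ * (b * (κ + 1))))).map fun p =>
        (((1, 1, 1, toBit (dn Party.B), 0, 0), (idealEarly ℓ Δ st dn p.1).2.finish Party.A),
          ⟨(.ack, some (π, randomMsg b ℓ κ p.2)), some (some (share Δ p.1.1 p.1.2.1 p.1.2.2)),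
            none⟩) := by
    rw [uniform_prod (α := (Fin ℓ → ZMod 2) × (Fin ℓ → ZMod 2) × (Fin ℓ → Triple (Str κ))),
      PMF.map_bind]
    simp only [PMF.map_comp]
    rfl
  rw [hprod]
  refine Lift.map_of_marginal (resultOf π Δ) (fun p => (p.1, randomMsg b ℓ κ p.2))
    ((uniform_map_resultOf π Δ).trans (uniform_map_randomMsg b ℓ κ).symm) ?_
  rintro r ⟨r', u⟩ hru
  obtain ⟨hr, hu⟩ := Prod.ext_iff.1 hru
  simp only at hr hu
  subst hr
  rw [← hu]
  refine Lift.of_pure ?_ _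
  have hrel : RelN (b := b) ⟨(hybridEarly b ℓ Δ st dn r).box.finish Party.A,
      some (π, (resultOf π Δ r).2), (hybridEarly b ℓ Δ st dn r).keysB, none⟩
      ((idealEarly ℓ Δ st dn (resultOf π Δ r).1).2.finish Party.A) := by
    refine ⟨rfl, hst, hst, by simp [BoxState.finish], by simp [BoxState.finish], ?_, ?_, ?_, _, rfl,
      ?_, by rintro _ ⟨⟩⟩
    · cases hd : dn Party.B <;> simp [BoxState.finish, hybridEarly, hd]
    · simp [BoxState.finish, idealEarly]
    · cases hd : dn Party.B <;> simp [BoxState.finish, hybridEarly, hd]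
    · exact (protocolB_some Δ r.2.2 π _).trans (if_pos (checks_mac Δ π r.2.1 r.2.2))
  have := CoupledN.late hrel
  cases hd : dn Party.B <;> simpa [simStateN, hybridEarly, hd] using this

theorem liftN_early {Δ : Str κ} {st dn : Party → Bool} (h : dn Party.A = false)
    (i : EnvCmd b ℓ κ) :
    Lift CoupledN
      (((PMF.uniformOfFintype _).map (hybridEarly b ℓ Δ st dn)).bind fun s => hybridStep D none s i)
      (((PMF.uniformOfFintype _).map (idealEarly ℓ Δ st dn)).bind fun s =>
        idealStep (reactionsN b ℓ κ).step D none s i) 0 := by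
  have hsame := fun (o : EnvResp b ℓ κ)
      (h₁ : ∀ r, hybridStep D none (hybridEarly b ℓ Δ st dn r) i =
        PMF.pure (hybridEarly b ℓ Δ st dn r, o))
      (h₂ : ∀ r, idealStep (reactionsN b ℓ κ).step D none (idealEarly ℓ Δ st dn r) i =
        PMF.pure (idealEarly ℓ Δ st dn r, o)) =>
    Lift.bind_map_pure (p := fun s => hybridStep D none s i)
      (q := fun s => idealStep (reactionsN b ℓ κ).step D none s i)
      (hybridEarly b ℓ Δ st dn) (idealEarly ℓ Δ st dn) o h₁ h₂
      (CoupledN.early Δ st dn h)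
  rcases i with p | c
  · by_cases hs : st p = true
    · refine hsame ⟨(.ack, none), none, none⟩ (fun r => ?_) fun r => ?_
      · exact hybridStep_input (boxCall_of_not (by simp [hybridEarly, hs]))
      · rw [idealEarly, idealStep_input (boxCall_of_not (by simp [hs]))]
        exact runStep_report (r := .ack) fun _ _ => rfl
    · rw [Bool.not_eq_true] at hs
      refine Lift.bind_map_pure (hybridEarly b ℓ Δ (Function.update st p true) dn)
        (idealEarly ℓ Δ (Function.update st p true) dn) ⟨(.started p, none), none, none⟩
        (fun r => ?_) (fun r => ?_) (.early Δ _ dn h)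
      · exact hybridStep_input (boxCall_of ⟨by simp, hs⟩)
      · rw [idealEarly, idealStep_input (boxCall_of ⟨by simp, hs⟩)]
        refine runStep_report (r := .started p) fun u π => ?_
        show (reactionsN b ℓ κ).resp (_, _, u, π) = _
        obtain rfl | rfl : p = Party.A ∨ p = Party.B := by fin_cases p <;> simp
        · simp [reactionsN, BoxResp.encode]
        · simp [reactionsN, BoxResp.encode]
  have hack := fun (h₁ : ∀ r, hybridStep D none (hybridEarly b ℓ Δ st dn r) (.adv c) =
        PMF.pure (hybridEarly b ℓ Δ st dn r, ⟨(.ack, none), none, none⟩))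
      (h₂ : ∀ r u π, (reactionsN b ℓ κ).step ((idealEarly ℓ Δ st dn r).1, .inl c.encode, u, π) =
        ((idealEarly ℓ Δ st dn r).1, ack)) =>
    hsame ⟨(.ack, none), none, none⟩ h₁ fun r => runStep_report (r := .ack) (h₂ r)
  have hnot : ¬ (∀ p, st p = true) → toBit (st Party.A) * toBit (st Party.B) = 0 := by
    intro h
    rw [Fin.forall_fin_two] at h
    cases hA : st Party.A <;> cases hB : st Party.B <;> simp_all
  rcases c with c | m | _ | _
  · rcases c with Δ' | v | v | ⟨i, g⟩ | p | p
    · refine hsame ⟨(.answer (if Δ' = Δ then 1 else 0), none), none, none⟩ (fun r => ?_) fun r => ?_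
      · exact hybridStep_ack (by simp [boxAdv, hybridEarly])
      · refine (runStep_of_eq (reactionsN b ℓ κ).step (s := idealEarly ℓ Δ st dn r)
          (e := .inl (.inl (.inl Δ'))) (w := ((idealEarly ℓ Δ st dn r).1, .inl (.inl Δ')))
          fun _ _ => rfl).trans (afterStep_forward (f := (reactionsN b ℓ κ).step) (oA := none)
          (oB := none) (σ' := (idealEarly ℓ Δ st dn r).1)
          (r := .answer (if Δ' = Δ then 1 else 0)) (r' := .answer (if Δ' = Δ then 1 else 0))
          (m := .inl ()) (t' := (idealEarly ℓ Δ st dn r).2) ?_ fun _ _ => rfl)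
        simp [BoxCmd.decode, boxAdv, idealEarly]
    · exact hack (fun r => hybridStep_ack (by simp [boxAdv])) fun _ _ _ => rfl
    · exact hack (fun r => hybridStep_ack (by simp [boxAdv])) fun _ _ _ => rfl
    · exact hack (fun r => hybridStep_ack (by simp [boxAdv])) fun _ _ _ => rfl
    · by_cases hst : ∀ p, st p = true
      swap
      · refine hack (fun r => hybridStep_ack ?_) fun r u π => ?_
        · rw [boxAdv, if_neg]
          rintro ⟨-, hr, -⟩
          exact hst fun p => by simpa [hybridEarly] using hr p
        · show (reactionsN b ℓ κ).deliver (p, _, u, π) = _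
          exact if_neg fun h' => absurd ((hnot hst).symm.trans h') (by decide)
      obtain rfl | rfl : p = Party.A ∨ p = Party.B := by fin_cases p <;> simp
      · exact liftN_deliverA h hst
      cases hd : dn Party.B
      · refine Lift.bind_map_pure (hybridEarly b ℓ Δ st (Function.update dn Party.B true))
          (idealEarly ℓ Δ st (Function.update dn Party.B true)) ⟨(.ack, none), none, none⟩
          (fun r => ?_) (fun r => ?_) (.early Δ _ _ (by simpa using h))
        · have hr : (hybridEarly b ℓ Δ st dn r).box.ready none := fun p => by
            simpa [hybridEarly] using hst p
          rw [hybridStep_keysB (t := (hybridEarly b ℓ Δ st dn r).box.finish Party.B) (r := .ack)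
            (v := (Δ, r.2.2)) (by rw [boxAdv, if_pos ⟨by simp, hr, hd⟩]; rfl)]
          simp [hybridEarly, BoxState.finish]
        · refine runStep_report (r := .ack) fun u π => ?_
          show (reactionsN b ℓ κ).deliver (Party.B, _, u, π) = _
          simp [reactionsN, hst, hd, ack, BoxResp.encode]
      · refine hack (fun r => hybridStep_ack ?_) fun r u π => ?_
        · rw [boxAdv, if_neg]
          rintro ⟨-, -, hr⟩
          exact absurd (hd.symm.trans hr) (by simp)
        · show (reactionsN b ℓ κ).deliver (Party.B, _, u, π) = _
          simp [reactionsN, idealEarly, hst, hd]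
    · exact hack (fun r => hybridStep_ack (by simp [boxAdv])) fun _ _ _ => rfl
  · exact hack (fun _ => rfl) fun _ _ _ => rfl
  · exact hack (fun _ => rfl) fun _ _ _ => rfl
  · refine hack (fun _ => rfl) fun r u π => ?_
    show (reactionsN b ℓ κ).forward ((), _, u, π) = _
    simp [reactionsN, idealEarly]

theorem advantageN (Z : Env (EnvCmd b ℓ κ) (EnvResp b ℓ κ)) :
    |(hybridWorld κ D none).prob Z - (stepWorld (reactionsN b ℓ κ).step
      (0, 0, 0, 0, 0, 0) D none).prob Z| ≤ 0 := by
  refine (advantage_stepWorld_le _ _ _ _ CoupledN ENNReal.zero_ne_top ?_ ?_ Z).trans_eq rfl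
  · intro Δ
    have := Lift.of_rel (CoupledN.early (b := b) (ℓ := ℓ) Δ (fun _ => false) (fun _ => false) rfl) ()
    rw [PMF.map_comp, PMF.map_comp] at this
    exact this
  · rintro _ _ _ (⟨Δ, st, dn, h⟩ | ⟨h⟩) i
    · exact liftN_early h i
    · rw [PMF.pure_bind, PMF.pure_bind]
      exact liftN_late h i

end

section

variable {b ℓ κ : ℕ}

/-! ### The simulator for a corrupted `B` -/

/-- The choice of a corrupted `B` at the leaky box, random coins, and the permutation. -/
abbrev ViewB (b ℓ κ : ℕ) := BChoice (ℓ * (b + 1)) κ × Str (ℓ * b + 1) ×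
  Equiv.Perm (Fin (ℓ * (b + 1)))

/-- The revealed bits. -/
def ViewB.bits (q : ViewB b ℓ κ) : Fin ℓ → Fin b → ZMod 2 := fun j k =>
  -- Coin `0` is reserved for the answers to guesses.
  q.2.1 (finProdFinEquiv (j, k)).succ

/-- The keys for the `k`-th triple of the `j`-th bucket. -/
def ViewB.at (q : ViewB b ℓ κ) (j : Fin ℓ) (k : Fin (b + 1)) : Triple (Str κ) :=
  q.1.2 (q.2.2 (slot j k))

/-- The message of `A`. -/
def ViewB.msg (q : ViewB b ℓ κ) : Msg b ℓ κ :=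
  (q.2.2, fun j k => (q.bits j k,
    fun i => (q.at j 0).2.1 i + (q.at j k.succ).2.1 i + q.bits j k * q.1.1 i))

/-- The choice at the ideal box. -/
def ViewB.values (q : ViewB b ℓ κ) : BChoice ℓ κ :=
  (q.1.1, fun j => (fun i => ∑ k, (q.at j k).1 i, (q.at j 0).2.1,
    fun i => ∑ k, (q.at j k).2.2 i + ∑ k : Fin b, q.bits j k * (q.at j k.succ).1 i))

theorem ViewB.msg_eq (q : ViewB b ℓ κ) :
    q.msg = (q.2.2, fun j k => mac q.1.1 (q.bits j k) (openKeys q.2.2 q.1.2 j k)) := rfl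

theorem ViewB.values_eq (q : ViewB b ℓ κ) : q.values = (q.1.1, bucketK q.2.2 q.bits q.1.2) := by
  refine Prod.ext rfl (funext fun j => Prod.ext (funext fun i => ?_) (Prod.ext rfl
    (funext fun i => ?_)))
  · simp [ViewB.values, bucketK, combineAll, ViewB.at]
  · simp [ViewB.values, bucketK, combineAll, ViewB.at]

/-- The state of the simulator: the choice of `B` at the leaky box, whether `A` has called it,
whether she has been served, which bits `x` have been guessed, their values, and what the simulator
does at the next message of the ideal box: report it, report that a guess was wrong, let the output
be delivered to `A`, or report it with a message of `A`. -/
abbrev SimB (b ℓ κ : ℕ) := (Unit ⊕ BChoice (ℓ * (b + 1)) κ) × ZMod 2 × ZMod 2 ×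
  Str (ℓ * (b + 1)) × Str (ℓ * (b + 1)) × (Unit ⊕ Unit ⊕ Msg b ℓ κ ⊕ Msg b ℓ κ)

/-- The vector `v` with the value `t` at the place `i`. -/
def setAt {n : ℕ} (a : Str n × Fin n × ZMod 2) : Str n := fun j =>
  if (if j = a.2.1 then (1 : ZMod 2) else 0) = 1 then a.2.2 else a.1 j

theorem setAt_eq {n : ℕ} (v : Str n) (i : Fin n) (t : ZMod 2) :
    setAt (v, i, t) = Function.update v i t := by
  funext j
  by_cases h : j = i
  · subst h; simp [setAt]
  · simp [setAt, h]

/-- The answer to a key query. -/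
def keyAnswer (a : Str κ × (Unit ⊕ BChoice (ℓ * (b + 1)) κ)) : ZMod 2 :=
  -- A corrupted `B` has told the simulator the key, so the query is answered without the ideal box;
  -- the product is an equality test. Before the choice every query fails.
  a.2.elim (fun _ => 0) fun v => ∏ i, (1 + (a.1 i + v.1 i))

/-- The reaction to a guess at a bit `x` if the bit is `t`. -/
def SimB.guessed (a : (Fin (ℓ * (b + 1)) × ZMod 2) × SimB b ℓ κ × ZMod 2) :
    SimB b ℓ κ × SimOut b ℓ κ :=
  if 1 + (a.2.2 + a.1.2) = 1 then
    ((a.2.1.1, a.2.1.2.1, a.2.1.2.2.1, setAt (a.2.1.2.2.2.1, a.1.1, 1),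
      setAt (a.2.1.2.2.2.2.1, a.1.1, a.2.2), .inl ()), .inr (.inr (.inr 1), .inl ()))
  else ((a.2.1.1, a.2.1.2.1, 1, a.2.1.2.2.2.1, a.2.1.2.2.2.2.1, .inr (.inl ())),
    .inl (.inr (.inr (.inr (.inr (.inr Party.A))))))

/-- The reactions of the simulator. -/
def reactionsB (b ℓ κ : ℕ) : Reactions b ℓ κ (ℓ * b + 1) (SimB b ℓ κ) where
  keyQuery g := (g.2.1, .inr (.inr (.inr (keyAnswer (g.1, g.2.1.1))), .inl ()))
  chooseA g := (g.2.1, ack)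
  chooseB g := (g.2.1.1.elim (fun _ => (.inr g.1, g.2.1.2)) (fun _ => g.2.1), ack)
  guess g :=
    if g.2.1.2.1 * (1 + g.2.1.2.2.1) = 1 then
      SimB.guessed (g.1, g.2.1,
        -- Lazy sampling: a bit that has been guessed before keeps its value, a new one is the fresh
        -- coin.
        if g.2.1.2.2.2.1 g.1.1 = 1 then g.2.1.2.2.2.2.1 g.1.1 else g.2.2.1 0)
    else (g.2.1, ack)
  deliver g :=
    if (if g.1 = Party.A then (1 : ZMod 2) else 0) * g.2.1.2.1 * (1 + g.2.1.2.2.1) = 1 then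
      g.2.1.1.elim (fun _ => (g.2.1, ack)) fun v =>
        ((g.2.1.1, g.2.1.2.1, 1, g.2.1.2.2.2.1, g.2.1.2.2.2.2.1,
          .inr (.inr (.inl (ViewB.msg (v, g.2.2))))),
          .inl (.inr (.inr (.inl (ViewB.values (v, g.2.2))))))
    else (g.2.1, ack)
  abort g :=
    if (if g.1 = Party.A then (1 : ZMod 2) else 0) * g.2.1.2.1 * (1 + g.2.1.2.2.1) = 1 then
      ((g.2.1.1, g.2.1.2.1, 1, g.2.1.2.2.2.1, g.2.1.2.2.2.2.1, .inl ()),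
        .inl (.inr (.inr (.inr (.inr (.inr Party.A))))))
    else (g.2.1, ack)
  send g := (g.2.1, ack)
  sendMalformed g := (g.2.1, ack)
  forward g := (g.2.1, ack)
  resp g := g.2.1.2.2.2.2.2.elim
    (fun _ => (g.1.elim (fun _ => g.2.1) fun c => c.elim (fun _ => (g.2.1.1, 1, g.2.1.2.2))
      fun _ => g.2.1, .inr (g.1, .inl ())))
    fun w => w.elim
      (fun _ => ((g.2.1.1, g.2.1.2.1, g.2.1.2.2.1, g.2.1.2.2.2.1, g.2.1.2.2.2.2.1, .inl ()),
        .inr (.inr (.inr 0), .inl ())))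
      fun w => w.elim
        (fun m => ((g.2.1.1, g.2.1.2.1, g.2.1.2.2.1, g.2.1.2.2.2.1, g.2.1.2.2.2.2.1,
          .inr (.inr (.inr m))), .inl (.inr (.inr (.inr (.inr (.inl Party.A)))))))
        fun m => ((g.2.1.1, g.2.1.2.1, g.2.1.2.2.1, g.2.1.2.2.2.1, g.2.1.2.2.2.2.1, .inl ()),
          .inr (g.1, .inr m))

/-! ### Cost of the simulator for a corrupted `B` -/

section Efficiency

variable {M : ℕ} (hn : ℓ * (b + 1) ≤ (M + 2) ^ 2) (hℓ : ℓ ≤ (M + 2) ^ 1) (hb : b ≤ (M + 2) ^ 1)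
  (hb' : b + 1 ≤ (M + 2) ^ 1) (hκ : κ ≤ (M + 2) ^ 1)

include hℓ hb in
theorem coinsB_le : ℓ * b + 1 ≤ (M + 2) ^ 4 := by
  have h := Nat.mul_le_mul hℓ hb
  calc ℓ * b + 1 ≤ (M + 2) ^ 1 * (M + 2) ^ 1 + (M + 2) ^ 2 := by
        have := Eff.one_le M 2
        omega
    _ = (M + 2) ^ 2 * 2 := by ring
    _ ≤ (M + 2) ^ 2 * (M + 2) ^ 2 := Nat.mul_le_mul_left _
        (le_trans (by norm_num : 2 ≤ 2 ^ 2) (Nat.pow_le_pow_left (by omega) 2))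
    _ = _ := by ring

include hℓ hb in
theorem ViewB.eff_bits (j : Fin ℓ) (k : Fin b) : Eff M 20 fun q : ViewB b ℓ κ => q.bits j k :=
  (Eff.lookup (coinsB_le hℓ hb) (.fst (.snd .var)) (.index _)).mono (by norm_num)

include hn in
theorem ViewB.eff_at (j : Fin ℓ) (k : Fin (b + 1)) : Eff M 20 fun q : ViewB b ℓ κ => q.at j k :=
  (Eff.lookup hn (.snd (.fst .var)) (.perm hn (.snd (.snd .var)) (.index _))).mono (by norm_num)

include hn hℓ hb hκ in
theorem ViewB.eff_msg : Eff M 300 fun q : ViewB b ℓ κ => q.msg := by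
  have h := ViewB.eff_at (κ := κ) hn
  have h' := ViewB.eff_bits (κ := κ) hℓ hb
  exact (Eff.pair (.snd (.snd .var)) (.vector hℓ fun j => .vector hb fun k => .pair (h' j k)
    (.vector hκ fun i => .add (.add (.lookup hκ (.fst (.snd (h j 0))) (.index i))
      (.lookup hκ (.fst (.snd (h j k.succ))) (.index i)))
      (.mul (h' j k) (.lookup hκ (.fst (.fst .var)) (.index i)))))).mono (by norm_num)

include hn hℓ hb hb' hκ in
theorem ViewB.eff_values : Eff M 300 fun q : ViewB b ℓ κ => q.values := by
  have h := ViewB.eff_at (κ := κ) hn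
  have h' := ViewB.eff_bits (κ := κ) hℓ hb
  exact (Eff.pair (.fst (.fst .var)) (.vector hℓ fun j => .pair
    (.vector hκ fun i => .sum hb' fun k => .lookup hκ (.fst (h j k)) (.index i))
    (.pair (.fst (.snd (h j 0))) (.vector hκ fun i => .add
      (.sum hb' fun k => .lookup hκ (.snd (.snd (h j k))) (.index i))
      (.sum hb fun k => .mul (h' j k) (.lookup hκ (.fst (h j k.succ)) (.index i))))))).mono
    (by norm_num)

include hn in
theorem eff_setAt : Eff M 100 (setAt (n := ℓ * (b + 1))) :=
  (Eff.vector hn fun j => .ite (.eqIndex hn (.index j) (.fst (.snd .var))) (.snd (.snd .var))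
    (.lookup hn (.fst .var) (.index j))).mono (by norm_num)

include hκ in
theorem eff_keyAnswer : Eff M 100 (keyAnswer (b := b) (ℓ := ℓ) (κ := κ)) :=
  (Eff.elim (.snd .var) (.bit 0) (.prod hκ fun i => .add (.bit 1) (.add
    (.lookup hκ (.fst (.snd .var)) (.index i)) (.lookup hκ (.fst (.fst .var)) (.index i))))).mono
    (by norm_num)

include hn in
theorem SimB.eff_guessed : Eff M 1000 (SimB.guessed (b := b) (ℓ := ℓ) (κ := κ)) := by
  have h₁ := eff_setAt hn
  unfold SimB.guessed
  apply Eff.mono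
  repeat' first
    | with_reducible exact Eff.unit
    | with_reducible exact Eff.var
    | with_reducible exact Eff.index _
    | with_reducible exact Eff.bit _
    | with_reducible apply Eff.ite
    | with_reducible apply Eff.add
    | with_reducible apply Eff.comp (hg := h₁)
    | with_reducible apply Eff.fst
    | with_reducible apply Eff.snd
    | with_reducible apply Eff.inl
    | with_reducible apply Eff.inr
    | with_reducible apply Eff.pair
  norm_num

include hn hℓ hb hb' hκ in
theorem reactionsB_efficient : (reactionsB b ℓ κ).Efficient M 3000 := by
  have h₁ := ViewB.eff_msg (κ := κ) hn hℓ hb hκ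
  have h₂ := ViewB.eff_values (κ := κ) hn hℓ hb hb' hκ
  have h₃ := eff_keyAnswer (b := b) (ℓ := ℓ) (κ := κ) hκ
  have h₄ := SimB.eff_guessed (κ := κ) hn
  have hc := coinsB_le hℓ hb
  constructor <;> unfold reactionsB <;> dsimp only <;> apply Eff.mono
  all_goals repeat' first
    | with_reducible exact Eff.unit
    | with_reducible exact Eff.var
    | with_reducible exact Eff.index _
    | with_reducible exact Eff.bit _
    | with_reducible exact Eff.ack
    | with_reducible apply Eff.elim
    | with_reducible apply Eff.isA
    | with_reducible apply Eff.ite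
    | with_reducible apply Eff.add
    | with_reducible apply Eff.mul
    | with_reducible apply Eff.comp (hg := h₁)
    | with_reducible apply Eff.comp (hg := h₂)
    | with_reducible apply Eff.comp (hg := h₃)
    | with_reducible apply Eff.comp (hg := h₄)
    | with_reducible apply Eff.lookup hn
    | with_reducible apply Eff.lookup hc
    | with_reducible apply Eff.fst
    | with_reducible apply Eff.snd
    | with_reducible apply Eff.inl
    | with_reducible apply Eff.inr
    | with_reducible apply Eff.pair
  all_goals norm_num

end Efficiency

end

section

variable {b ℓ κ : ℕ}

/-! ### Uniformity of the results with some bits guessed -/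

/-- The indices of the bits that have been guessed. -/
def guessedSet {n : ℕ} (known : Str n) : Finset (Fin n) := {i | known i = 1}

/-- The vector `x` with the guessed bits replaced by their values. -/
def fill {n : ℕ} (known val x : Str n) : Str n := fun i => if known i = 1 then val i else x i

theorem guessedSet_update {n : ℕ} {known : Str n} {i : Fin n} (h : known i ≠ 1) :
    (guessedSet (Function.update known i 1)).card = (guessedSet known).card + 1 := by
  have : guessedSet (Function.update known i 1) = insert i (guessedSet known) := by
    ext j
    by_cases hj : j = i
    · subst hj; simp [guessedSet]
    · simp [guessedSet, hj]
  rw [this, Finset.card_insert_of_notMem (by simpa [guessedSet] using h)]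

/-- A coordinate split off from the hidden vector becomes a recorded bit; this identifies the hybrid
state after a right guess. -/
theorem fill_update {n : ℕ} {known val x : Str n} {i : Fin n} (h : known i ≠ 1) (c : ZMod 2) :
    fill known val (Function.update x i c) =
      fill (Function.update known i 1) (Function.update val i c) x := by
  funext j
  by_cases hj : j = i
  · subst hj; simp [fill, h]
  · simp [fill, hj]

/-- The probability `1/2` of a right guess, which compensates the doubling of the error. -/
theorem expect_uniform_bit (g : ZMod 2) (e : ℝ≥0∞) :
    expect (PMF.uniformOfFintype (ZMod 2)) (fun c => if c = g then e else 0) = 2⁻¹ * e := by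
  unfold expect
  rw [tsum_eq_single g]
  · simp [PMF.uniformOfFintype_apply]
  · intro c hc
    simp [hc]

theorem uniform_prod_update {n : ℕ} {β : Type} [Fintype β] [Nonempty β] (i : Fin n) :
    PMF.uniformOfFintype (Str n × β) = (PMF.uniformOfFintype (ZMod 2)).bind fun c =>
      (PMF.uniformOfFintype (Str n × β)).map fun r => (Function.update r.1 i c, r.2) := by
  conv_lhs => rw [uniform_prod, uniform_pi_update i]
  rw [PMF.bind_bind]
  refine congrArg _ (funext fun c => ?_)
  rw [PMF.bind_map, uniform_prod (α := Str n), PMF.map_bind]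
  simp only [PMF.map_comp]
  rfl

theorem uniform_map_map {α α' β β' γ : Type} [Fintype α] [Nonempty α] [Fintype α'] [Nonempty α']
    [Fintype β] [Nonempty β] [Fintype β'] [Nonempty β'] [Fintype γ] [Nonempty γ] {f : α → α'}
    {g : β → β'} (hf : (PMF.uniformOfFintype α).map f = PMF.uniformOfFintype α')
    (hg : (PMF.uniformOfFintype β).map g = PMF.uniformOfFintype β') :
    (PMF.uniformOfFintype (α × β × γ)).map (fun r => (f r.1, g r.2.1)) =
      PMF.uniformOfFintype (α' × β') := by
  rw [uniform_prod, uniform_prod (α := β), uniform_prod (α := α'), ← hf, ← hg]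
  simp only [PMF.map_bind, PMF.map_comp, PMF.bind_map, Function.comp_def]
  refine congrArg _ (funext fun x => ?_)
  rw [PMF.map]
  refine congrArg _ (funext fun y => ?_)
  exact PMF.map_const _ _

/-- Each bucket contains an unguessed bit, which masks the sum like a one-time pad. The guessed bits
merely translate the result. -/
theorem uniform_map_bucketX_fill {π : Equiv.Perm (Fin (ℓ * (b + 1)))}
    {known val : Str (ℓ * (b + 1))} (h : π ∉ badPerms (guessedSet known)) :
    (PMF.uniformOfFintype (Str (ℓ * (b + 1)))).map (fun x => bucketX π (fill known val x)) =
      PMF.uniformOfFintype (Fin ℓ → ZMod 2) := by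
  let φ : Str (ℓ * (b + 1)) →+ (Fin ℓ → ZMod 2) :=
    AddMonoidHom.mk' (fun x => bucketX π (fill known 0 x)) fun x x' => by
      funext j
      simp only [bucketX, fill, Pi.add_apply, ← Finset.sum_add_distrib]
      refine Finset.sum_congr rfl fun k _ => ?_
      split_ifs <;> simp
  have hφ : Function.Surjective φ := by
    intro X
    -- An unguessed place in every bucket: the preimage of `X` puts `X j` there and `0` elsewhere.
    have hk : ∀ j, ∃ k, known (π (slot j k)) ≠ 1 := by
      by_contra! hj
      exact h (by simpa [badPerms, guessedSet] using hj)
    choose k hk using hk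
    obtain ⟨x, hx⟩ := exists_arrange π fun j k' => if k' = k j then X j else 0
    refine ⟨x, funext fun j => ?_⟩
    show bucketX π (fill known 0 x) j = X j
    rw [bucketX, Finset.sum_eq_single (k j)]
    · simp [fill, hk, hx]
    · intro k' _ hk'
      simp [fill, hx, hk']
    · simp
  have hfill : (fun x => bucketX π (fill known val x)) =
      Equiv.addRight (bucketX π (fill known val 0)) ∘ φ := by
    funext x j
    show bucketX π (fill known val x) j =
      bucketX π (fill known 0 x) j + bucketX π (fill known val 0) j
    rw [bucketX, bucketX, bucketX, ← Finset.sum_add_distrib]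
    refine Finset.sum_congr rfl fun k _ => ?_
    simp only [fill]
    split_ifs <;> simp
  rw [hfill, ← PMF.map_comp, uniform_map_hom φ hφ, uniform_map_equiv]

/-- The simulated side of the common marginal. The local keys of the ideal box are omitted, since
the choice made for `B` overwrites them; coin `0` is not used here. -/
theorem uniform_map_bits (v : BChoice (ℓ * (b + 1)) κ) (π : Equiv.Perm (Fin (ℓ * (b + 1)))) :
    (PMF.uniformOfFintype (((Fin ℓ → ZMod 2) × (Fin ℓ → ZMod 2) × (Fin ℓ → Triple (Str κ))) ×
      Str (ℓ * b + 1))).map (fun p => (p.1.1, p.1.2.1, ViewB.bits (v, p.2, π))) =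
      PMF.uniformOfFintype _ := by
  refine uniform_map_hom (AddMonoidHom.mk' (fun p : ((Fin ℓ → ZMod 2) × (Fin ℓ → ZMod 2) ×
    (Fin ℓ → Triple (Str κ))) × Str (ℓ * b + 1) => (p.1.1, p.1.2.1, ViewB.bits (v, p.2, π)))
    fun p p' => rfl) fun ⟨X, Y, d⟩ => ?_
  refine ⟨((X, Y, 0), Fin.cons (α := fun _ => ZMod 2) 0 fun i =>
    d (finProdFinEquiv.symm i).1 (finProdFinEquiv.symm i).2), Prod.ext rfl (Prod.ext rfl ?_)⟩
  funext j k
  show Fin.cons (α := fun _ => ZMod 2) 0 (fun i => d (finProdFinEquiv.symm i).1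
    (finProdFinEquiv.symm i).2) (finProdFinEquiv (j, k)).succ = d j k
  rw [Fin.cons_succ, Equiv.symm_apply_apply]

/-! ### Security against a corrupted `B` -/

theorem keyAnswer_eq (Δ' : Str κ) (choice : Option (BChoice (ℓ * (b + 1)) κ)) (Δ : Str κ)
    (h : ∀ v, choice = some v → v.1 = Δ) :
    keyAnswer (Δ', toSum choice) = if choice.isSome = true ∧ Δ' = Δ then 1 else 0 := by
  rcases choice with _ | v
  · simp [keyAnswer]
  · have hp : ∏ i, (1 + (Δ' i + v.1 i)) = 1 ↔ Δ' = v.1 := by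
      simp only [zmod_two_prod_eq_one, zmod_two_one_add_eq_one, zmod_two_add_eq_zero, funext_iff]
    rw [← h v rfl]
    by_cases hΔ : Δ' = v.1
    · rw [if_pos ⟨rfl, hΔ⟩]
      exact hp.2 hΔ
    · rw [if_neg (by simp [hΔ])]
      exact (zmod_two_ne_one _).1 (mt hp.1 hΔ)

/-- The state of the hybrid world before `A` is served. -/
def hybridLive (Δ : Str κ) (choice : Option (BChoice (ℓ * (b + 1)) κ)) (st : Party → Bool)
    (known val : Str (ℓ * (b + 1))) (r : Str (ℓ * (b + 1)) × (Fin (ℓ * (b + 1)) → ZMod 2) ×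
      (Fin (ℓ * (b + 1)) → Triple (Str κ))) : HybridState b ℓ κ :=
  ⟨⟨(choice.map Prod.fst).getD Δ, fill known val r.1, r.2.1, (choice.map Prod.snd).getD r.2.2, st,
    choice.isSome, fun _ => false⟩, none, none, none⟩

/-- The state of the simulator before `A` is served. -/
def simLive (choice : Option (BChoice (ℓ * (b + 1)) κ)) (st : Party → Bool)
    (known val : Str (ℓ * (b + 1))) : SimB b ℓ κ :=
  (toSum choice, toBit (st Party.A), 0, known, val, .inl ())

/-- The state of the ideal world before `A` is served. -/
def idealLive (Δ : Str κ) (choice : Option (BChoice (ℓ * (b + 1)) κ)) (st : Party → Bool)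
    (known val : Str (ℓ * (b + 1))) (r : (Fin ℓ → ZMod 2) × (Fin ℓ → ZMod 2) ×
      (Fin ℓ → Triple (Str κ))) : SimB b ℓ κ × BoxState ℓ κ :=
  (simLive choice st known val, ⟨Δ, r.1, r.2.1, r.2.2, st, false, fun _ => false⟩)

/-- The states of the hybrid and of the ideal world correspond to each other after `A` has been
served. -/
structure RelB (choice : Option (BChoice (ℓ * (b + 1)) κ)) (s : HybridState b ℓ κ)
    (t : BoxState ℓ κ) : Prop where
  chosen : s.box.chosen = choice.isSome
  key : ∀ v, choice = some v → v.1 = s.box.Δ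
  started : s.box.started Party.A = true
  started' : t.started Party.A = true
  done : s.box.done Party.A = true

/-- Corresponding distributions of states. -/
inductive CoupledB : PMF (HybridState b ℓ κ) → PMF (SimB b ℓ κ × BoxState ℓ κ) → ℝ≥0∞ → Prop
  -- The error bounds the probability that a permutation drawn now puts a whole bucket into the
  -- guessed set.
  | live (Δ : Str κ) (choice : Option (BChoice (ℓ * (b + 1)) κ)) (st : Party → Bool)
      (known val : Str (ℓ * (b + 1))) :
      CoupledB ((PMF.uniformOfFintype _).map (hybridLive Δ choice st known val))
        ((PMF.uniformOfFintype _).map (idealLive Δ choice st known val))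
        (2 ^ (guessedSet known).card * leakBound b ℓ)
  -- Once `A` has received an output, possibly `fail`, no later answer depends on the hidden bits,
  -- so no error remains.
  | served {choice : Option (BChoice (ℓ * (b + 1)) κ)} {s : HybridState b ℓ κ} {t : BoxState ℓ κ}
      (known val : Str (ℓ * (b + 1))) (h : RelB choice s t) :
      CoupledB (PMF.pure s) (PMF.pure ((toSum choice, 1, 1, known, val, .inl ()), t)) 0

variable {D : PMF (Equiv.Perm (Fin (ℓ * (b + 1))))}

theorem liftB_served {choice : Option (BChoice (ℓ * (b + 1)) κ)} {s : HybridState b ℓ κ}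
    {t : BoxState ℓ κ} (known val : Str (ℓ * (b + 1))) (h : RelB choice s t) (i : EnvCmd b ℓ κ) :
    Lift CoupledB (hybridStep D (some Party.B) s i)
      (idealStep (reactionsB b ℓ κ).step D (some Party.B)
        ((toSum choice, 1, 1, known, val, .inl ()), t) i) 0 := by
  have hack : ∀ {p : PMF (HybridState b ℓ κ × EnvResp b ℓ κ)} {e : SimIn b ℓ κ},
      p = PMF.pure (s, ⟨(.ack, none), none, none⟩) →
      (∀ u π, (reactionsB b ℓ κ).step ((toSum choice, 1, 1, known, val, .inl ()), e, u, π) =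
        ((toSum choice, 1, 1, known, val, .inl ()), ack)) →
      Lift CoupledB p (runStep (reactionsB b ℓ κ).step D (some Party.B) 4
        ((toSum choice, 1, 1, known, val, .inl ()), t) e) 0 := fun hp he =>
    Lift.of_eq_pure hp (runStep_report (r := .ack) he) (.served known val h)
  rcases i with p | c
  · obtain rfl | rfl : p = Party.A ∨ p = Party.B := by fin_cases p <;> simp
    · rw [hybridStep_input (boxCall_of_not (by simp [h.started])),
        idealStep_input (boxCall_of_not (by simp [h.started']))]
      exact hack rfl fun _ _ => rfl
    · rw [hybridStep_input (boxCall_of_not (by simp)), idealStep_input (boxCall_of_not (by simp))]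
      exact hack rfl fun _ _ => rfl
  rw [idealStep_adv]
  rcases c with c | m | _ | _
  · rcases c with Δ' | v | v | ⟨i, g⟩ | p | p
    · have hk := keyAnswer_eq Δ' choice s.box.Δ h.key
      rw [hybridStep_ack (r := .answer (keyAnswer (Δ', toSum choice)))
        (by simp [boxAdv, hk, h.chosen])]
      exact Lift.of_eq_pure rfl (runStep_report (r := .answer _) fun _ _ => rfl)
        (.served known val h)
    · rw [hybridStep_ack (r := .ack) (by simp [boxAdv])]
      exact hack rfl fun _ _ => rfl
    · rcases choice with _ | v'
      · have hc : s.box.chosen = false := h.chosen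
        rw [hybridStep_quiet (t := { s.box with Δ := v.1, K := v.2, chosen := true }) (r := .ack)
          (by simp [boxAdv, hc])]
        refine Lift.of_eq_pure rfl (runStep_report (r := .ack) fun _ _ => rfl)
          (.served (choice := some v) known val ⟨rfl, ?_, h.started, h.started', h.done⟩)
        rintro _ ⟨⟩; rfl
      · have hc : s.box.chosen = true := h.chosen
        rw [hybridStep_ack (r := .ack) (by simp [boxAdv, hc])]
        exact hack rfl fun _ _ => rfl
    · rw [hybridStep_ack (r := .ack) (by simp [boxAdv, h.done])]
      exact hack rfl fun _ _ => rfl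
    · obtain rfl | rfl : p = Party.A ∨ p = Party.B := by fin_cases p <;> simp
      · rw [hybridStep_ack (r := .ack) (by simp [boxAdv, h.done])]
        exact hack rfl fun _ _ => rfl
      · rw [hybridStep_ack (r := .ack) (by simp [boxAdv])]
        exact hack rfl fun _ _ => rfl
    · obtain rfl | rfl : p = Party.A ∨ p = Party.B := by fin_cases p <;> simp
      · rw [hybridStep_ack (r := .ack) (by simp [boxAdv, h.done])]
        exact hack rfl fun _ _ => rfl
      · rw [hybridStep_ack (r := .ack) (by simp [boxAdv])]
        exact hack rfl fun _ _ => rfl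
  · exact hack rfl fun _ _ => rfl
  · exact hack rfl fun _ _ => rfl
  · exact hack rfl fun _ _ => rfl

/-! ### Guesses of a corrupted `B` -/

section Guess

variable {Δ : Str κ} {choice : Option (BChoice (ℓ * (b + 1)) κ)} {st : Party → Bool}
  {known val : Str (ℓ * (b + 1))} {i : Fin (ℓ * (b + 1))} {g : ZMod 2}

theorem hybridStep_guess_right {r : Str (ℓ * (b + 1)) × (Fin (ℓ * (b + 1)) → ZMod 2) ×
    (Fin (ℓ * (b + 1)) → Triple (Str κ))} (hst : st Party.A = true)
    (hx : fill known val r.1 i = g) :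
    hybridStep D (some Party.B) (hybridLive Δ choice st known val r) (.adv (.box (.guess i g))) =
      PMF.pure (hybridLive Δ choice st known val r, ⟨(.answer 1, none), none, none⟩) :=
  hybridStep_ack (by simp [boxAdv, hybridLive, hst, hx])

theorem hybridStep_guess_wrong {r : Str (ℓ * (b + 1)) × (Fin (ℓ * (b + 1)) → ZMod 2) ×
    (Fin (ℓ * (b + 1)) → Triple (Str κ))} (hst : st Party.A = true)
    (hx : fill known val r.1 i ≠ g) :
    hybridStep D (some Party.B) (hybridLive Δ choice st known val r) (.adv (.box (.guess i g))) =
      PMF.pure (⟨(hybridLive Δ choice st known val r).box.finish Party.A, none, none, none⟩,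
        ⟨(.answer 0, none), some none, none⟩) :=
  hybridStep_failA (by simp [boxAdv, hybridLive, hst, hx])

theorem afterStep_guess_right (t : BoxState ℓ κ) :
    afterStep (reactionsB b ℓ κ).step D (some Party.B) 3 t
      (SimB.guessed ((i, g), simLive choice st known val, g)) =
    PMF.pure ((simLive choice st (Function.update known i 1) (Function.update val i g), t),
      ⟨(.answer 1, none), none, none⟩) := by
  rw [SimB.guessed, if_pos (by rw [CharTwo.add_self_eq_zero]; rfl), setAt_eq, setAt_eq]
  rfl

theorem afterStep_guess_wrong {t : BoxState ℓ κ} {c : ZMod 2} (hst : st Party.A = true)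
    (ht : t.started Party.A = true) (hd : t.done Party.A = false) (hc : c ≠ g) :
    afterStep (reactionsB b ℓ κ).step D (some Party.B) 3 t
      (SimB.guessed ((i, g), simLive choice st known val, c)) =
    PMF.pure (((toSum choice, 1, 1, known, val, .inl ()), t.finish Party.A),
      ⟨(.answer 0, none), some none, none⟩) := by
  rw [SimB.guessed, if_neg]
  · rw [simLive, hst]
    refine afterStep_forward (r := .ack) (r' := .answer 0) (m := .inl ()) ?_ fun _ _ => rfl
    simp [BoxCmd.decode, boxAdv, ht, hd]
  · rw [zmod_two_one_add_eq_one, zmod_two_add_eq_zero]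
    exact hc

/-- A wrong guess. -/
theorem liftB_guess_wrong {r : Str (ℓ * (b + 1)) × (Fin (ℓ * (b + 1)) → ZMod 2) ×
    (Fin (ℓ * (b + 1)) → Triple (Str κ))} {r' : (Fin ℓ → ZMod 2) × (Fin ℓ → ZMod 2) ×
    (Fin ℓ → Triple (Str κ))} {c : ZMod 2} (hst : st Party.A = true)
    (hx : fill known val r.1 i ≠ g) (hc : c ≠ g) :
    Lift CoupledB
      (hybridStep D (some Party.B) (hybridLive Δ choice st known val r) (.adv (.box (.guess i g))))
      (afterStep (reactionsB b ℓ κ).step D (some Party.B) 3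
        (idealLive Δ choice st known val r').2
        (SimB.guessed ((i, g), simLive choice st known val, c))) 0 :=
  Lift.of_eq_pure (hybridStep_guess_wrong hst hx) (afterStep_guess_wrong hst hst rfl hc)
    (.served known val ⟨rfl, by rintro _ rfl; rfl, hst, hst, by simp [BoxState.finish]⟩)

theorem idealStep_guess {r : (Fin ℓ → ZMod 2) × (Fin ℓ → ZMod 2) × (Fin ℓ → Triple (Str κ))}
    (hst : st Party.A = true) :
    idealStep (reactionsB b ℓ κ).step D (some Party.B) (idealLive Δ choice st known val r)
      (.adv (.box (.guess i g))) =
    (PMF.uniformOfFintype (ZMod 2)).bind fun c =>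
      afterStep (reactionsB b ℓ κ).step D (some Party.B) 3 (idealLive Δ choice st known val r).2
        (SimB.guessed ((i, g), simLive choice st known val, fill known val (fun _ => c) i)) := by
  have hcoin : (PMF.uniformOfFintype (Str (ℓ * b + 1))).map (fun u => u 0) =
      PMF.uniformOfFintype (ZMod 2) :=
    uniform_map_hom (α := Str (ℓ * b + 1)) (Pi.evalAddMonoidHom (fun _ => ZMod 2) 0) fun c => ⟨fun _ => c, rfl⟩
  rw [idealStep, runStep_succ, ← hcoin, PMF.bind_map]
  refine congrArg _ (funext fun u => ?_)
  have : ∀ π, (reactionsB b ℓ κ).step ((idealLive Δ choice st known val r).1,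
      .inl (AdvCmd.box (.guess i g)).encode, u, π) =
      SimB.guessed ((i, g), simLive choice st known val, fill known val (fun _ => u 0) i) := by
    intro π
    show (reactionsB b ℓ κ).guess ((i, g), _, u, π) = _
    refine if_pos ?_
    simp [idealLive, simLive, hst]
  simp only [this, PMF.bind_const, Function.comp_def]

/-- A repeated guess has a determined answer and leaves the error unchanged or ends it. For a new
guess, the bit `x i` of the hybrid world is coupled with the coin of the simulator: right, and one
more bit is recorded while the error doubles; wrong, and `A` fails in both worlds with no error
left. The average is the old error. -/
theorem liftB_guess (hst : st Party.A = true) :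
    Lift CoupledB
      (((PMF.uniformOfFintype _).map (hybridLive Δ choice st known val)).bind fun s =>
        hybridStep D (some Party.B) s (.adv (.box (.guess i g))))
      (((PMF.uniformOfFintype _).map (idealLive Δ choice st known val)).bind fun s =>
        idealStep (reactionsB b ℓ κ).step D (some Party.B) s (.adv (.box (.guess i g))))
      (2 ^ (guessedSet known).card * leakBound b ℓ) := by
  by_cases hi : known i = 1
  · have hfill : ∀ x, fill known val x i = val i := fun x => if_pos hi
    by_cases hg : val i = g
    · refine Lift.bind_map_pure (hybridLive Δ choice st known val) (idealLive Δ choice st known val)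
        ⟨(.answer 1, none), none, none⟩ (fun r => ?_) (fun r => ?_) (.live Δ choice st known val)
      · exact hybridStep_guess_right hst ((hfill _).trans hg)
      · rw [idealStep_guess hst]
        simp only [hfill, hg, PMF.bind_const]
        rw [afterStep_guess_right, ← hg, ← hi, Function.update_eq_self, Function.update_eq_self]
        rfl
    · rw [PMF.bind_map, PMF.bind_map]
      -- The recorded value refutes the guess for certain, and after `fail` the hidden values are
      -- irrelevant, so any coupling works.
      refine (Lift.bind_bind _ _ fun r r' => ?_).mono zero_le
      simp only [Function.comp_def, idealStep_guess hst, hfill, PMF.bind_const]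
      exact liftB_guess_wrong hst (by rwa [hfill]) hg
  · have hfill : ∀ c, fill known val (fun _ => c) i = c := fun c => if_neg hi
    rw [PMF.bind_map, PMF.bind_map, uniform_prod_update i, PMF.bind_bind]
    simp only [Function.comp_def, idealStep_guess hst, hfill, PMF.bind_map]
    rw [PMF.bind_comm _ (PMF.uniformOfFintype (ZMod 2))]
    -- The coin `c` is at once the split-off bit `x i` and the simulator's sample for it.
    refine Lift.bind (ε := fun c => if c = g then
      2 ^ ((guessedSet known).card + 1) * leakBound b ℓ else 0) _ (fun c => ?_) ?_
    · have hx : ∀ x : Str (ℓ * (b + 1)), fill known val (Function.update x i c) i = c := fun x => by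
        simp [fill, hi]
      by_cases hc : c = g
      · subst hc
        have hlive : ∀ r, hybridLive (b := b) (ℓ := ℓ) Δ choice st known val
            (Function.update r.1 i c, r.2) = hybridLive Δ choice st (Function.update known i 1)
              (Function.update val i c) r := fun r => by
          rw [hybridLive, fill_update hi]
          rfl
        have hright := fun r : Str (ℓ * (b + 1)) × (Fin (ℓ * (b + 1)) → ZMod 2) ×
          (Fin (ℓ * (b + 1)) → Triple (Str κ)) => (hybridStep_guess_right (D := D) (Δ := Δ)
            (choice := choice) (r := (Function.update r.1 i c, r.2)) hst (hx r.1)).trans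
              (congrArg (fun s => PMF.pure (s, _)) (hlive r))
        simp only [hright, afterStep_guess_right, if_true]
        rw [← guessedSet_update hi]
        have := Lift.of_rel (CoupledB.live (b := b) Δ choice st (Function.update known i 1)
          (Function.update val i c)) (⟨(.answer 1, none), none, none⟩ : EnvResp b ℓ κ)
        rw [PMF.map_comp, PMF.map_comp] at this
        exact this
      · rw [if_neg hc]
        exact Lift.bind_bind _ _ fun r r' => liftB_guess_wrong hst (by rwa [hx]) hc
    · rw [expect_uniform_bit, pow_succ, mul_comm (2 ^ _) 2, mul_assoc, ← mul_assoc,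
        ENNReal.inv_mul_cancel (by norm_num) (by norm_num), one_mul]

end Guess

end

/-! ### Corrupted `B`: delivery to `A`, and the remaining activations -/

section

variable {b ℓ κ : ℕ} {D : PMF (Equiv.Perm (Fin (ℓ * (b + 1))))}

section Deliver

variable {Δ : Str κ} {v : BChoice (ℓ * (b + 1)) κ} {st : Party → Bool}
  {known val : Str (ℓ * (b + 1))}

theorem ready_of_chosenB {n : ℕ} {s : BoxState n κ} (h₁ : s.started Party.A = true)
    (h₂ : s.chosen = true) : s.ready (some Party.B) := by
  intro p
  fin_cases p
  · simpa using h₁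
  · simpa using h₂

theorem boxAdv_chooseB {n : ℕ} {leaky : Bool} {corr : Option Party} {s : BoxState n κ}
    {v : BChoice n κ} (h : corr = some Party.B ∧ s.chosen = false) :
    boxAdv leaky corr s (.chooseB v) =
      ⟨{ s with Δ := v.1, K := v.2, chosen := true }, .ack, none, none⟩ := if_pos h

theorem idealStep_live {choice choice' : Option (BChoice (ℓ * (b + 1)) κ)}
    {r : (Fin ℓ → ZMod 2) × (Fin ℓ → ZMod 2) × (Fin ℓ → Triple (Str κ))} {c : AdvCmd b ℓ κ}
    {a : BoxResp} (h : ∀ u π, (reactionsB b ℓ κ).step (simLive choice st known val,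
      .inl c.encode, u, π) = (simLive choice' st known val, .inr (a.encode, .inl ()))) :
    idealStep (reactionsB b ℓ κ).step D (some Party.B) (idealLive Δ choice st known val r)
      (.adv c) =
    PMF.pure (idealLive Δ choice' st known val r, ⟨(a, none), none, none⟩) :=
  runStep_report h

theorem hybridStep_deliver {r : Str (ℓ * (b + 1)) × (Fin (ℓ * (b + 1)) → ZMod 2) ×
    (Fin (ℓ * (b + 1)) → Triple (Str κ))} (hst : st Party.A = true) :
    hybridStep D (some Party.B) (hybridLive Δ (some v) st known val r)
      (.adv (.box (.deliver Party.A))) = D.bind fun π =>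
        PMF.pure (⟨(hybridLive Δ (some v) st known val r).box.finish Party.A,
          some (π, fun j k => mac v.1 (openBits π r.2.1 j k) (openKeys π v.2 j k)), none, none⟩,
          ⟨(.ack, some (π, fun j k => mac v.1 (openBits π r.2.1 j k) (openKeys π v.2 j k))),
            some (some (share v.1 (bucketX π (fill known val r.1)) (bucketY π r.2.1)
              (bucketK π (openBits π r.2.1) v.2))), none⟩) := by
  have hr : (hybridLive Δ (some v) st known val r).box.ready (some Party.B) :=
    ready_of_chosenB hst rfl
  rw [hybridStep_shareA (t := (hybridLive Δ (some v) st known val r).box.finish Party.A)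
    (r := .ack) (v := share v.1 (fill known val r.1) r.2.1 v.2)]
  · simp only [protocolA_share]
    rfl
  · rw [boxAdv, if_pos ⟨by simp, hr, rfl⟩]
    rfl

theorem idealStep_deliver {r : (Fin ℓ → ZMod 2) × (Fin ℓ → ZMod 2) × (Fin ℓ → Triple (Str κ))}
    (hst : st Party.A = true) :
    idealStep (reactionsB b ℓ κ).step D (some Party.B) (idealLive Δ (some v) st known val r)
      (.adv (.box (.deliver Party.A))) =
    (PMF.uniformOfFintype (Str (ℓ * b + 1))).bind fun u => D.bind fun π =>
      PMF.pure (((.inr v, 1, 1, known, val, .inl ()),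
        BoxState.finish ⟨v.1, r.1, r.2.1, (ViewB.values (v, u, π)).2, st, true, fun _ => false⟩
          Party.A),
        ⟨(.ack, some (ViewB.msg (v, u, π))),
          some (some (share v.1 r.1 r.2.1 (ViewB.values (v, u, π)).2)), none⟩) := by
  rw [idealStep, runStep_succ]
  refine congrArg _ (funext fun u => congrArg _ (funext fun π => ?_))
  have hf : (reactionsB b ℓ κ).step ((idealLive Δ (some v) st known val r).1,
      .inl (AdvCmd.box (.deliver Party.A)).encode, u, π) =
      ((.inr v, 1, 1, known, val, .inr (.inr (.inl (ViewB.msg (v, u, π))))),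
        .inl (.inr (.inr (.inl (ViewB.values (v, u, π)))))) := by
    show (reactionsB b ℓ κ).deliver (Party.A, _, u, π) = _
    simp [reactionsB, idealLive, simLive, hst]
  have h₁ : boxAdv false (some Party.B) (idealLive Δ (some v) st known val r).2
      (.chooseB (ViewB.values (v, u, π))) =
      ⟨⟨v.1, r.1, r.2.1, (ViewB.values (v, u, π)).2, st, true, fun _ => false⟩, .ack, none,
        none⟩ := boxAdv_chooseB ⟨rfl, rfl⟩
  have h₂ : boxAdv false (some Party.B)
      ⟨v.1, r.1, r.2.1, (ViewB.values (v, u, π)).2, st, true, fun _ => false⟩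
      (.deliver Party.A) =
      ⟨BoxState.finish ⟨v.1, r.1, r.2.1, (ViewB.values (v, u, π)).2, st, true, fun _ => false⟩
        Party.A, .ack, some (some (share v.1 r.1 r.2.1 (ViewB.values (v, u, π)).2)), none⟩ :=
    if_pos ⟨by simp, ready_of_chosenB hst rfl, rfl⟩
  have h₃ := afterStep_continue (f := (reactionsB b ℓ κ).step) (D := D) (q := 2)
    (σ := (.inr v, 1, 1, known, val, .inr (.inr (.inl (ViewB.msg (v, u, π))))))
    (c := .inr (.inr (.inl (ViewB.values (v, u, π)))))
    (w := ((.inr v, 1, 1, known, val, .inr (.inr (.inr (ViewB.msg (v, u, π))))),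
      .inl (.inr (.inr (.inr (.inr (.inl Party.A))))))) h₁ fun _ _ => rfl
  have h₄ := afterStep_forward (f := (reactionsB b ℓ κ).step) (D := D) (q := 1)
    (σ := (.inr v, 1, 1, known, val, .inr (.inr (.inr (ViewB.msg (v, u, π))))))
    (c := .inr (.inr (.inr (.inr (.inl Party.A)))))
    (σ' := (.inr v, 1, 1, known, val, .inl ())) (m := .inr (ViewB.msg (v, u, π))) h₂
    (r' := .ack) fun _ _ => rfl
  rw [hf]
  exact h₃.trans h₄

/-- The delivery of the output of `A`. -/
theorem liftB_deliver (hD : KWiseIndependent (b + 1) D) (hℓ : 1 ≤ ℓ) (hst : st Party.A = true) :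
    Lift CoupledB
      (((PMF.uniformOfFintype _).map (hybridLive Δ (some v) st known val)).bind fun s =>
        hybridStep D (some Party.B) s (.adv (.box (.deliver Party.A))))
      (((PMF.uniformOfFintype _).map (idealLive Δ (some v) st known val)).bind fun s =>
        idealStep (reactionsB b ℓ κ).step D (some Party.B) s (.adv (.box (.deliver Party.A))))
      (2 ^ (guessedSet known).card * leakBound b ℓ) := by
  classical
  rw [PMF.bind_map, PMF.bind_map]
  simp only [Function.comp_def, hybridStep_deliver hst, idealStep_deliver hst]
  have hprod : ∀ F : ((Fin ℓ → ZMod 2) × (Fin ℓ → ZMod 2) × (Fin ℓ → Triple (Str κ))) ×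
      Str (ℓ * b + 1) → Equiv.Perm (Fin (ℓ * (b + 1))) →
        (SimB b ℓ κ × BoxState ℓ κ) × EnvResp b ℓ κ,
      ((PMF.uniformOfFintype ((Fin ℓ → ZMod 2) × (Fin ℓ → ZMod 2) ×
        (Fin ℓ → Triple (Str κ)))).bind fun r => (PMF.uniformOfFintype (Str (ℓ * b + 1))).bind
          fun u => D.bind fun π => PMF.pure (F (r, u) π)) =
      D.bind fun π => (PMF.uniformOfFintype (((Fin ℓ → ZMod 2) × (Fin ℓ → ZMod 2) ×
        (Fin ℓ → Triple (Str κ))) × Str (ℓ * b + 1))).map fun p => F p π := by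
    intro F
    simp only [uniform_prod (α := (Fin ℓ → ZMod 2) × (Fin ℓ → ZMod 2) × (Fin ℓ → Triple (Str κ))),
      PMF.map_bind, PMF.map_comp]
    rw [PMF.bind_comm D]
    refine congrArg _ (funext fun r => ?_)
    rw [PMF.bind_comm _ D]
    rfl
  rw [hprod fun p π => (((.inr v, 1, 1, known, val, .inl ()),
    BoxState.finish ⟨v.1, p.1.1, p.1.2.1, (ViewB.values (v, p.2, π)).2, st, true, fun _ => false⟩
      Party.A), ⟨(.ack, some (ViewB.msg (v, p.2, π))),
        some (some (share v.1 p.1.1 p.1.2.1 (ViewB.values (v, p.2, π)).2)), none⟩),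
    PMF.bind_comm _ D]
  -- The permutation is shared and independent of the guesses. Bad permutations are charged with
  -- error `1`, good ones with `0`; the average is bounded by the bucketing estimate.
  refine Lift.bind (ε := (badPerms (guessedSet known)).indicator 1) D (fun π => ?_) ?_
  swap
  · rw [expect_indicator]
    exact toOuterMeasure_badPerms_le hD hℓ _
  by_cases hπ : π ∈ badPerms (guessedSet known)
  · exact Lift.of_one_le (by simp [hπ])
  rw [Set.indicator_of_notMem hπ]
  -- The bits of the results and the opened bits are uniform on both sides. With `Δ` and the local
  -- keys chosen by `B`, they determine everything that is output or sent.
  refine Lift.map_of_marginal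
    (fun r => (bucketX π (fill known val r.1), bucketY π r.2.1, openBits π r.2.1))
    (fun p => (p.1.1, p.1.2.1, ViewB.bits (v, p.2, π)))
    ((uniform_map_map (uniform_map_bucketX_fill hπ) (uniform_map_bucketY π)).trans
      (uniform_map_bits v π).symm) ?_
  rintro r ⟨⟨X, Y, K⟩, u⟩ hru
  simp only [Prod.mk.injEq] at hru
  obtain ⟨rfl, rfl, hd⟩ := hru
  rw [ViewB.msg_eq, ViewB.values_eq, ← hd]
  exact Lift.of_pure (.served (choice := some v) known val
    ⟨rfl, by rintro _ ⟨⟩; rfl, hst, hst, by simp [BoxState.finish]⟩) _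

end Deliver

theorem liftB_live (hD : KWiseIndependent (b + 1) D) (hℓ : 1 ≤ ℓ) {Δ : Str κ}
    {choice : Option (BChoice (ℓ * (b + 1)) κ)} {st : Party → Bool}
    {known val : Str (ℓ * (b + 1))} (i : EnvCmd b ℓ κ) :
    Lift CoupledB
      (((PMF.uniformOfFintype _).map (hybridLive Δ choice st known val)).bind fun s =>
        hybridStep D (some Party.B) s i)
      (((PMF.uniformOfFintype _).map (idealLive Δ choice st known val)).bind fun s =>
        idealStep (reactionsB b ℓ κ).step D (some Party.B) s i)
      (2 ^ (guessedSet known).card * leakBound b ℓ) := by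
  have hsame := fun (o : EnvResp b ℓ κ)
      (h₁ : ∀ r, hybridStep D (some Party.B) (hybridLive Δ choice st known val r) i =
        PMF.pure (hybridLive Δ choice st known val r, o))
      (h₂ : ∀ r, idealStep (reactionsB b ℓ κ).step D (some Party.B)
        (idealLive Δ choice st known val r) i = PMF.pure (idealLive Δ choice st known val r, o)) =>
    Lift.bind_map_pure (p := fun s => hybridStep D (some Party.B) s i)
      (q := fun s => idealStep (reactionsB b ℓ κ).step D (some Party.B) s i)
      (hybridLive Δ choice st known val) (idealLive Δ choice st known val) o h₁ h₂
      (CoupledB.live Δ choice st known val)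
  rcases i with p | c
  · by_cases hs : p = Party.A ∧ st Party.A = false
    · obtain ⟨rfl, hs⟩ := hs
      refine Lift.bind_map_pure
        (hybridLive Δ choice (Function.update st Party.A true) known val)
        (idealLive Δ choice (Function.update st Party.A true) known val)
        ⟨(.started Party.A, none), none, none⟩ (fun r => ?_) (fun r => ?_) (.live ..)
      · exact hybridStep_input (boxCall_of ⟨by simp, hs⟩)
      · rw [idealLive, idealStep_input (boxCall_of ⟨by simp, hs⟩)]
        refine runStep_report (r := .started Party.A) fun u π => ?_
        show (reactionsB b ℓ κ).resp (_, _, u, π) = _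
        simp [reactionsB, BoxResp.encode, simLive]
    · have hs' : ¬ (some Party.B ≠ some p ∧ st p = false) := by
        obtain rfl | rfl : p = Party.A ∨ p = Party.B := by fin_cases p <;> simp
        · exact fun h => hs ⟨rfl, h.2⟩
        · simp
      refine hsame ⟨(.ack, none), none, none⟩ (fun r => ?_) fun r => ?_
      · exact hybridStep_input (boxCall_of_not hs')
      · rw [idealLive, idealStep_input (boxCall_of_not hs')]
        exact runStep_report (r := .ack) fun _ _ => rfl
  have hack := fun
      (h₁ : ∀ r, hybridStep D (some Party.B) (hybridLive Δ choice st known val r) (.adv c) =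
        PMF.pure (hybridLive Δ choice st known val r, ⟨(.ack, none), none, none⟩))
      (h₂ : ∀ u π, (reactionsB b ℓ κ).step (simLive choice st known val, .inl c.encode, u, π) =
        (simLive choice st known val, ack)) =>
    hsame ⟨(.ack, none), none, none⟩ h₁ fun r => idealStep_live (a := .ack) h₂
  rcases c with c | m | _ | _
  · rcases c with Δ' | v | v | ⟨i, g⟩ | p | p
    · refine hsame ⟨(.answer (keyAnswer (Δ', toSum choice)), none), none, none⟩ (fun r => ?_)
        fun r => idealStep_live (a := .answer _) fun _ _ => rfl
      refine hybridStep_ack ?_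
      rw [keyAnswer_eq Δ' choice (hybridLive Δ choice st known val r).box.Δ
        (by rintro v rfl; rfl)]
      simp [boxAdv, hybridLive]
      congr
    · exact hack (fun r => hybridStep_ack (by simp [boxAdv])) fun _ _ => rfl
    · rcases choice with _ | v'
      · exact Lift.bind_map_pure (hybridLive Δ (some v) st known val)
          (idealLive Δ (some v) st known val) ⟨(.ack, none), none, none⟩
          (fun r => hybridStep_quiet (boxAdv_chooseB ⟨rfl, rfl⟩))
          (fun r => idealStep_live (a := .ack) fun _ _ => rfl) (.live ..)
      · exact hack (fun r => hybridStep_ack (by simp [boxAdv, hybridLive])) fun _ _ => rfl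
    · cases hst : st Party.A
      · refine hack (fun r => hybridStep_ack (by simp [boxAdv, hybridLive, hst])) fun u π => ?_
        show (reactionsB b ℓ κ).guess ((i, g), _, u, π) = _
        simp [reactionsB, simLive, hst]
      · exact liftB_guess hst
    · by_cases hp : p = Party.A ∧ st Party.A = true ∧ choice.isSome = true
      · obtain ⟨rfl, hst, hc⟩ := hp
        obtain ⟨v, rfl⟩ := Option.isSome_iff_exists.1 hc
        exact liftB_deliver hD hℓ hst
      · refine hack (fun r => hybridStep_ack ?_) fun u π => ?_
        · rw [boxAdv, if_neg]
          rintro ⟨h₁, h₂, -⟩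
          obtain rfl : p = Party.A := by fin_cases p <;> simp_all
          exact hp ⟨rfl, by simpa [hybridLive] using h₂ Party.A,
            by simpa [hybridLive] using h₂ Party.B⟩
        · show (reactionsB b ℓ κ).deliver (p, _, u, π) = _
          by_cases hA : p = Party.A
          · rcases choice with _ | v
            · simp [reactionsB, simLive]
            · cases hst : st Party.A
              · simp [reactionsB, simLive, hst]
              · exact absurd ⟨hA, hst, rfl⟩ hp
          · simp [reactionsB, hA]
    · by_cases hp : p = Party.A ∧ st Party.A = true
      · obtain ⟨rfl, hst⟩ := hp
        rw [PMF.bind_map, PMF.bind_map]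
        -- `A` fails, so her hidden bits are never used again and need not be coupled.
        refine (Lift.bind_bind _ _ fun r r' => ?_).mono zero_le
        refine Lift.of_eq_pure (hybridStep_failA (by simp [boxAdv, hybridLive, hst]; rfl))
          (.trans (runStep_of_eq (reactionsB b ℓ κ).step (w := ((toSum choice, 1, 1, known, val,
            .inl ()), .inl (.inr (.inr (.inr (.inr (.inr Party.A))))))) fun u π => ?_)
            (afterStep_forward (f := (reactionsB b ℓ κ).step) (r := .ack) (r' := .ack)
              (m := .inl ()) (oA := some none) (oB := none)
              (t' := (idealLive Δ choice st known val r').2.finish Party.A) ?_ fun _ _ => rfl))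
          (.served known val ⟨rfl, by rintro v rfl; rfl, hst, hst, by simp [BoxState.finish]⟩)
        · show (reactionsB b ℓ κ).abort (Party.A, _, u, π) = _
          simp [reactionsB, idealLive, simLive, hst]
        · simp [BoxCmd.decode, boxAdv, idealLive, hst]
      · refine hack (fun r => hybridStep_ack ?_) fun u π => ?_
        · rw [boxAdv, if_neg]
          rintro ⟨-, h₁, h₂, -⟩
          obtain rfl : p = Party.A := by fin_cases p <;> simp_all
          exact hp ⟨rfl, h₂⟩
        · show (reactionsB b ℓ κ).abort (p, _, u, π) = _
          by_cases hA : p = Party.A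
          · cases hst : st Party.A
            · simp [reactionsB, simLive, hst]
            · exact absurd ⟨hA, hst⟩ hp
          · simp [reactionsB, hA]
  · exact hack (fun _ => rfl) fun _ _ => rfl
  · exact hack (fun _ => rfl) fun _ _ => rfl
  · exact hack (fun _ => rfl) fun _ _ => rfl

theorem advantageB (hD : KWiseIndependent (b + 1) D) (hℓ : 1 ≤ ℓ)
    (Z : Env (EnvCmd b ℓ κ) (EnvResp b ℓ κ)) :
    |(hybridWorld κ D (some Party.B)).prob Z - (stepWorld (reactionsB b ℓ κ).step
      (.inl (), 0, 0, fun _ => 0, fun _ => 0, .inl ()) D (some Party.B)).prob Z| ≤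
      (leakBound b ℓ).toReal := by
  refine advantage_stepWorld_le _ _ _ _ CoupledB (leakBound_ne_top hℓ) ?_ ?_ Z
  · intro Δ
    have := Lift.of_rel (CoupledB.live (b := b) (ℓ := ℓ) Δ none (fun _ => false) (fun _ => 0)
      fun _ => 0) ()
    rw [PMF.map_comp, PMF.map_comp] at this
    -- Nothing has been guessed at the start, so the initial error is `2 ^ 0` times the bound.
    have h0 : guessedSet (fun _ : Fin (ℓ * (b + 1)) => (0 : ZMod 2)) = ∅ := by simp [guessedSet]
    rw [h0, Finset.card_empty, pow_zero, one_mul] at this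
    refine cast ?_ this
    congr 2
  · rintro _ _ _ (⟨Δ, choice, st, known, val⟩ | ⟨known, val, h⟩) i
    · exact liftB_live hD hℓ i
    · rw [PMF.pure_bind, PMF.pure_bind]
      exact liftB_served known val h i

end

section

variable {b ℓ κ : ℕ}

/-! ### The theorem -/

/-- The exponent is governed by the simulator for a corrupted `A`, whose reactions have the largest
bound, `6000`. -/
theorem securelyImplements {D : PMF (Equiv.Perm (Fin (ℓ * (b + 1))))} (hℓ : 1 ≤ ℓ)
    (hD : KWiseIndependent (b + 1) D) :
    SecurelyImplements b ℓ κ D ((b + 1 + ℓ + κ) ^ (2 * (10 * 6000 + 400)))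
      (leakBound b ℓ).toReal := by
  obtain ⟨hn, hl, hb, hb', hκ⟩ := sizes_le b ℓ κ
  have hpow : ∀ {j k : ℕ}, j ≤ k → (b + ℓ + κ + 2) ^ j ≤ (b + ℓ + κ + 2) ^ k := fun h =>
    Nat.pow_le_pow_right (by omega) h
  intro corr
  rcases corr with _ | p
  · refine ⟨(reactionsN b ℓ κ).simulator (0, 0, 0, 0, 0, 0) hℓ (reactionsN_efficient hl hb hκ)
      (Eff.mono (.pair (.bit 0) (.pair (.bit 0) (.pair (.bit 0) (.pair (.bit 0) (.pair (.bit 0)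
        (.bit 0)))))) (by norm_num)) ((coins_le hl hb hκ).trans (hpow (by norm_num)))
      (by norm_num), fun Z => ?_⟩
    rw [idealWorld_simulator]
    exact (advantageN Z).trans ENNReal.toReal_nonneg
  obtain rfl | rfl : p = Party.A ∨ p = Party.B := by fin_cases p <;> simp
  · refine ⟨(reactionsA b ℓ κ).simulator (.inl (), 0, 0, 0, .inl (), .inl ()) hℓ
      (reactionsA_efficient hn hl hb hb' hκ) (Eff.mono (.pair (.inl .unit) (.pair (.bit 0)
        (.pair (.bit 0) (.pair (.bit 0) (.pair (.inl .unit) (.inl .unit)))))) (by norm_num))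
      (Nat.zero_le _) le_rfl, fun Z => ?_⟩
    rw [idealWorld_simulator]
    exact (advantageA Z).trans ENNReal.toReal_nonneg
  · refine ⟨(reactionsB b ℓ κ).simulator (.inl (), 0, 0, fun _ => 0, fun _ => 0, .inl ()) hℓ
      (reactionsB_efficient hn hl hb hb' hκ) (Eff.mono (.pair (.inl .unit) (.pair (.bit 0)
        (.pair (.bit 0) (.pair (.vector hn fun _ => .bit 0) (.pair (.vector hn fun _ => .bit 0)
          (.inl .unit)))))) (by norm_num)) ((coinsB_le hl hb).trans (hpow (by norm_num)))
      (by norm_num), fun Z => ?_⟩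
    rw [idealWorld_simulator]
    exact advantageB hD hℓ Z

/-- Since `2 ℓ = 2 ^ (log₂ ℓ + 1)`, the error is `2` to the power `-(log₂ ℓ + 1) (B - 1)`. -/
theorem leakBound_le {ψ : ℝ} (hℓ : 1 ≤ ℓ)
    (hψ : (Real.logb 2 ℓ + 1) * (((b + 1 : ℕ) : ℝ) - 1) ≥ ψ) :
    (leakBound b ℓ).toReal ≤ (2 : ℝ) ^ (-ψ) := by
  have hℓ' : (0 : ℝ) < ℓ := by exact_mod_cast hℓ
  have h2 : (2 : ℝ) * ℓ = 2 ^ (Real.logb 2 ℓ + 1) := by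
    rw [Real.rpow_add (by norm_num), Real.rpow_logb (by norm_num) (by norm_num) hℓ', Real.rpow_one,
      mul_comm]
  rw [leakBound_toReal, h2, ← Real.rpow_intCast, ← Real.rpow_mul (by norm_num)]
  refine Real.rpow_le_rpow_of_exponent_le (by norm_num) ?_
  push_cast at hψ ⊢
  linarith

end

end BucketAND

end

theorem mainTheorem6 :
    (∃ c : ℕ, ∀ (B b ℓ κ : ℕ) (D : PMF (Equiv.Perm (Fin (ℓ * (b + 1))))) (ψ : ℝ),
      B = b + 1 → 1 ≤ ℓ → BucketAND.KWiseIndependent B D →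
      (Real.logb 2 ℓ + 1) * ((B : ℝ) - 1) ≥ ψ →
      BucketAND.SecurelyImplements b ℓ κ D ((B + ℓ + κ) ^ c) ((2 : ℝ) ^ (-ψ))) ∧
    (∀ (B b ℓ : ℕ) (D : PMF (Equiv.Perm (Fin (ℓ * (b + 1)))))
      (G : PMF (List (Fin (ℓ * (b + 1)) × ZMod 2))),
      B = b + 1 → 1 ≤ ℓ → BucketAND.KWiseIndependent B D →
      BucketAND.leakProb b ℓ D G ≤ (2 * (ℓ : ℝ)) ^ (1 - (B : ℤ))) := by
  refine ⟨⟨2 * (10 * 6000 + 400), ?_⟩, ?_⟩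
  · rintro _ b ℓ κ D ψ rfl hℓ hD hψ corr
    obtain ⟨S, hS⟩ := BucketAND.securelyImplements (κ := κ) hℓ hD corr
    exact ⟨S, fun Z => (hS Z).trans (BucketAND.leakBound_le hℓ hψ)⟩
  · rintro _ b ℓ D G rfl hℓ hD
    exact BucketAND.leakProb_le G hD hℓ
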